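/- All graphs are finite, undirected and without loops. The two-variable counting logic $C^2$ consists of the first-order formulas over the language of graphs (atomic formulas $E(x,y)$ and $x=y$) that use only the two variables $x_1,x_2$, which may be reused, and that may contain counting quantifiers $\exists^{\ge t}x$ ("there are at least $t$ vertices $x$"), $t\in\mathbb N$. A graph $G$ is identified by $C^2$ if there is a $C^2$-sentence $\varphi$ with $G\models\varphi$ such that every graph satisfying $\varphi$ is isomorphic to $G$. The $C^2$-type of a vertex $v$ of $G$ is the set of all $C^2$-formulas $\varphi(x)$ with $G\models\varphi[v]$. The $C^2$-coloring $\chi$ of $G$ colors each vertex with its $C^2$-type, and the $C^2$-partition is the partition of $V(G)$ into the color classes of $\chi$. For vertex sets $P,Q$ let $[P,Q]=\{\{v,w\} : v\ne w,\ v\in P,\ w\in Q\}$. The flip of $G$ is the vertex-colored graph $(F,\chi)$, where $\chi$ is the $C^2$-coloring of $G$, $V(F)=V(G)$ and $$E(F)=E(G)\,\Delta\,\bigl([P_1,Q_1]\cup\dots\cup[P_t,Q_t]\bigr),$$ where $\Delta$ is the symmetric difference and $(P_1,Q_1),\dots,(P_t,Q_t)$ are all pairs of (not necessarily distinct) $C^2$-partition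 classes of $G$ with $|[P_i,Q_i]\cap E(G)|>|[P_i,Q_i]\setminus E(G)|$. A bouquet is a graph obtained from the disjoint union of five isomorphic copies $(T_1,v_1),\dots,(T_5,v_5)$ of a tree $T$ with a designated vertex $v$ by adding the edges of a 5-cycle on the vertex set $\{v_1,\dots,v_5\}$. A bouquet forest is a vertex-colored graph that is a disjoint union of vertex-colored trees and vertex-colored bouquets, the bouquets being pairwise non-isomorphic as vertex-colored graphs. Theorem. A graph is identified by $C^2$ if and only if its flip is a bouquet forest. -/

import Mathlib

universe u

namespace CountingLogic

/-- Formulas of the `k`-variable counting logic `C^k` in the language of graphs. The variables are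
indexed by `Fin k` and may be reused. The other Boolean connectives and the quantifiers `∃`, `∀`
are the usual abbreviations: `∃ x, φ` is `∃^{≥ 1} x, φ`. -/
inductive Formula (k : ℕ) : Type
  | eq (i j : Fin k) : Formula k
  | adj (i j : Fin k) : Formula k
  | neg (φ : Formula k) : Formula k
  | and (φ ψ : Formula k) : Formula k
  | existsGE (t : ℕ) (i : Fin k) (φ : Formula k) : Formula k

/-- The set of free variables of a formula. -/
def Formula.freeVars {k : ℕ} : Formula k → Set (Fin k)
  | .eq i j => {i, j}
  | .adj i j => {i, j}
  | .neg φ => φ.freeVars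
  | .and φ ψ => φ.freeVars ∪ ψ.freeVars
  | .existsGE _ i φ => φ.freeVars \ {i}

/-- A sentence is a formula without free variables. -/
def Formula.IsSentence {k : ℕ} (φ : Formula k) : Prop :=
  φ.freeVars = ∅

/-- Satisfaction of a formula in a graph under a partial assignment of vertices to the variables.
It is only used for assignments that are defined on all free variables of the formula. (Partial
assignments make the definition meaningful for the graph without vertices as well.) -/
def Sat {k : ℕ} {V : Type*} (G : SimpleGraph V) : Formula k → (Fin k → Option V) → Prop
  | .eq i j, a => ∃ v, a i = some v ∧ a j = some v
  | .adj i j, a => ∃ v w, a i = some v ∧ a j = some w ∧ G.Adj v w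
  | .neg φ, a => ¬ Sat G φ a
  | .and φ ψ, a => Sat G φ a ∧ Sat G ψ a
  | .existsGE t i φ, a => (t : ℕ∞) ≤ {v : V | Sat G φ (Function.update a i (some v))}.encard

/-- Truth of a sentence in a graph. -/
def Models {k : ℕ} {V : Type*} (G : SimpleGraph V) (φ : Formula k) : Prop :=
  Sat G φ (fun _ => none)

/-- A finite graph `G` is identified by `C^k` if some `C^k`-sentence is true in `G` and every finite
graph in which this sentence is true is isomorphic to `G`. -/
def IsIdentified (k : ℕ) {V : Type u} (G : SimpleGraph V) : Prop :=
  ∃ φ : Formula k, φ.IsSentence ∧ Models G φ ∧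
    ∀ (W : Type u) [Finite W] (H : SimpleGraph W), Models H φ → Nonempty (H ≃g G)

/-- The `C^k`-type of a vertex `v`: the set of all `C^k`-formulas `φ(x)` with `G ⊨ φ[v]`. An
element is a pair `(i, φ)`, where `i` is the index of the variable `x`. -/
def vertexType (k : ℕ) {V : Type*} (G : SimpleGraph V) (v : V) : Set (Fin k × Formula k) :=
  {p | p.2.freeVars ⊆ {p.1} ∧ Sat G p.2 (Function.update (fun _ => none) p.1 (some v))}

/-- The `C^2`-coloring of a graph. -/
def c2Coloring {V : Type*} (G : SimpleGraph V) : V → Set (Fin 2 × Formula 2) :=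
  vertexType 2 G

/-- The `C^2`-partition of the vertex set, as the set of its classes. -/
def c2Partition {V : Type*} (G : SimpleGraph V) : Set (Set V) :=
  (Setoid.ker (c2Coloring G)).classes

/-- `[P, Q]`: the unordered pairs of distinct vertices with one member in `P` and one in `Q`. -/
def pairsBetween {V : Type*} (P Q : Set V) : Set (Sym2 V) :=
  {e | ∃ v ∈ P, ∃ w ∈ Q, v ≠ w ∧ e = s(v, w)}

/-- The pairs that are complemented when flipping `G`: the union of the sets `[P, Q]` over all pairs
of (not necessarily distinct) `C^2`-partition classes for which edges outnumber non-edges. -/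
def flippedPairs {V : Type*} (G : SimpleGraph V) : Set (Sym2 V) :=
  {e | ∃ P ∈ c2Partition G, ∃ Q ∈ c2Partition G,
    (pairsBetween P Q \ G.edgeSet).encard < (pairsBetween P Q ∩ G.edgeSet).encard ∧
    e ∈ pairsBetween P Q}

/-- The underlying graph of the flip of `G`. The flip itself is this graph together with the
vertex coloring `c2Coloring G`. -/
def flipGraph {V : Type*} (G : SimpleGraph V) : SimpleGraph V :=
  SimpleGraph.fromEdgeSet (symmDiff G.edgeSet (flippedPairs G))

/-- Five disjoint copies of `T`, with the five copies of `r` joined to form a 5-cycle. -/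
def bouquet {U : Type*} (T : SimpleGraph U) (r : U) : SimpleGraph (Fin 5 × U) where
  Adj x y := (x.1 = y.1 ∧ T.Adj x.2 y.2) ∨
    (x.2 = r ∧ y.2 = r ∧ (SimpleGraph.cycleGraph 5).Adj x.1 y.1)
  symm := ⟨by
    rintro x y (⟨h, h'⟩ | ⟨h, h', h''⟩)
    · exact Or.inl ⟨h.symm, h'.symm⟩
    · exact Or.inr ⟨h', h, h''.symm⟩⟩
  loopless := ⟨by
    rintro x (⟨_, h⟩ | ⟨_, _, h⟩)
    · exact T.loopless.irrefl _ h
    · exact (SimpleGraph.cycleGraph 5).loopless.irrefl _ h⟩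

/-- A graph is a bouquet if it arises from five isomorphic copies of some rooted tree `(T, r)`
by adding a 5-cycle on the roots. -/
def IsBouquet {W : Type u} (B : SimpleGraph W) : Prop :=
  ∃ (U : Type u) (T : SimpleGraph U) (r : U), T.IsTree ∧ Nonempty (B ≃g bouquet T r)

/-- Isomorphism of vertex-colored graphs. -/
def ColoredIso {V W C : Type*} (G : SimpleGraph V) (χ : V → C) (H : SimpleGraph W) (ψ : W → C) :
    Prop :=
  ∃ f : G ≃g H, ∀ v, ψ (f v) = χ v

/-- A vertex-colored graph is a bouquet forest if it is a disjoint union of vertex-colored trees and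
pairwise non-isomorphic vertex-colored bouquets. Trees and bouquets being connected, these are the
connected components. -/
def IsBouquetForest {V : Type u} {C : Type*} (F : SimpleGraph V) (χ : V → C) : Prop :=
  (∀ c : F.ConnectedComponent, (F.induce c.supp).IsTree ∨ IsBouquet (F.induce c.supp)) ∧
  ∀ c d : F.ConnectedComponent, c ≠ d →
    IsBouquet (F.induce c.supp) → IsBouquet (F.induce d.supp) →
    ¬ ColoredIso (F.induce c.supp) (fun v => χ v) (F.induce d.supp) (fun v => χ v)

end CountingLogic

namespace CountingLogic

open SimpleGraph

/-! ### Acyclic graphs -/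

/-! The statement reduces to rigidity: a colored graph is rigid if, up to color-preserving
isomorphism, it is the only graph with its numbers of neighbors of each color. Graphs with equal
color degrees satisfy the same two-variable sentences, by the bijective pebble game
(`Similar.sat_iff`); conversely, one sentence fixes the classes, their sizes and the degrees
(`exists_describing_sentence`). Hence `isIdentified_iff_rigid`. Complementing edges between classes
preserves equitability and rigidity (`rigid_flipBy_iff`), and the flip is sparse: in each class, a
vertex has at most as many neighbors as other non-neighbors (`sparse_flipBy_majorityPairs`). It
remains to show that a sparse, equitably colored graph is rigid if and only if it is a bouquet
forest.

Rigid graphs are bouquet forests. The edges between two classes of a rigid graph may be exchanged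
for any others with the same degrees, and any two such realizations differ by an automorphism of the
rest (`Rigid.exists_isAutOff_of_similarAt`). So an invariant count that distinguishes two
realizations is a contradiction. Complete blocks inside a realization (`Rigid.false_of_block`) show
that edges between two classes form stars, and that a class with inner degree `d ≥ 2` has `2 * d +
1` vertices; comparing a realization with its complement leaves `d = 2`, a 5-cycle
(`Rigid.colorDegree_eq_two`). The edges outside these 5-cycles form a forest
(`Rigid.isAcyclic_typeRestrict`): when pairs of classes are added one at a time, each new edge is
the only one leaving one of the two trees that it joins. Each of these trees meets the 5-cycles in
at most one vertex (`Rigid.eq_of_reachable`). Throughout, vertices of equal color in an equitable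
forest are related by automorphisms (`exists_isAut_of_isAcyclic`).

Bouquet forests are rigid. Classes of leaves can be stripped off until a core remains, and
isomorphisms extend from the core (`exists_isoOn_extending`). Sparseness and the non-isomorphism of
the bouquets make every core class a single 5-cycle (`IsBouquetForest.isFiveCycle_color`), which its
size and degree determine. -/

theorem subsingleton_of_isAcyclic {V : Type*} [Finite V] {G : SimpleGraph V} (hG : G.IsAcyclic)
    (h : ∀ u v, (∀ a b, G.Adj u a → G.Adj u b → a = b) → (∀ a b, G.Adj v a → G.Adj v b → a = b) →
      u = v) : Subsingleton V := by
  rcases isEmpty_or_nonempty V with hV | hV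
  · infer_instance
  -- Both ends of a longest path have at most one neighbor, so by `h` they coincide; then the
  -- longest path has length 0 and there are no edges.
  obtain ⟨u, v, p, hp, hmax⟩ := Walk.exists_isPath_forall_isPath_length_le_length G
  have hu : ∀ a, G.Adj u a → a = p.snd := by
    intro w hadj
    apply hG.eq_snd_of_adj_start hp hadj
    by_contra hw
    have h1 : (p.cons hadj.symm).IsPath := hp.cons hw
    have h2 := hmax _ _ _ h1
    simp at h2
  have hv : ∀ a, G.Adj v a → a = p.penultimate := by
    intro w hadj
    apply hG.eq_penultimate_of_adj_end hp hadj
    by_contra hw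
    have h1 : (p.concat hadj).IsPath := hp.concat hw hadj
    have h2 := hmax _ _ _ h1
    simp at h2
  have huv := h u v (fun a b ha hb => (hu a ha).trans (hu b hb).symm)
    (fun a b ha hb => (hv a ha).trans (hv b hb).symm)
  subst huv
  have hnil := hp.nil_iff_eq.mpr rfl
  have hlen : p.length = 0 := by
    cases hnil; rfl
  have hne : ∀ a b, ¬ G.Adj a b := by
    intro a b hab
    have h2 := hmax _ _ (Walk.cons hab .nil) (by simp [hab.ne])
    simp [hlen] at h2
  exact ⟨fun a b => h a b (fun x _ hx => (hne _ _ hx).elim) (fun x _ hx => (hne _ _ hx).elim)⟩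

/-- In the forest induced on `Y` only `r` can have degree at most one, while a finite forest with
several vertices has two such vertices. The exception `r` is meant for the root of a tree in a
bouquet, which has neighbors outside the tree. -/
theorem subset_singleton_of_isAcyclic {V : Type*} [Finite V] {G : SimpleGraph V}
    (hG : G.IsAcyclic) {Y : Set V} {r : V}
    (h : ∀ v ∈ Y, v ≠ r → ∃ a ∈ Y, ∃ b ∈ Y, a ≠ b ∧ G.Adj v a ∧ G.Adj v b) : ∀ v ∈ Y, v = r := by
  have key : Subsingleton Y := by
    apply subsingleton_of_isAcyclic (hG.induce Y)
    have bad : ∀ v : Y, (∀ a b, (G.induce Y).Adj v a → (G.induce Y).Adj v b → a = b) →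
        v.1 = r := by
      intro v hv
      by_contra hvr
      obtain ⟨a, ha, b, hb, hab, h1, h2⟩ := h v.1 v.2 hvr
      exact hab (congrArg Subtype.val (hv ⟨a, ha⟩ ⟨b, hb⟩ h1 h2))
    intro u v hu hv
    exact Subtype.ext ((bad u hu).trans (bad v hv).symm)
  intro v hv
  by_contra hvr
  obtain ⟨a, ha, b, hb, hab, -, -⟩ := h v hv hvr
  exact hab (congrArg Subtype.val (key.elim ⟨a, ha⟩ ⟨b, hb⟩))

theorem exists_leaf_of_isAcyclic {V : Type*} [Finite V] {G : SimpleGraph V}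
    (hG : G.IsAcyclic) {Y : Set V} (hY : Y.Nonempty) :
    ∃ v ∈ Y, ∀ a ∈ Y, ∀ b ∈ Y, G.Adj v a → G.Adj v b → a = b := by
  by_contra! hcon
  obtain ⟨r, hr⟩ := hY
  have h := subset_singleton_of_isAcyclic (r := r) hG (fun v hv _ => by
    obtain ⟨a, ha, b, hb, h1, h2, h3⟩ := hcon v hv
    exact ⟨a, ha, b, hb, h3, h1, h2⟩)
  obtain ⟨a, ha, b, hb, h1, h2, h3⟩ := hcon r hr
  exact h3 ((h a ha).trans (h b hb).symm)

/-! ### Permutations with prescribed behaviour -/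

theorem exists_equiv_of_ncard_fiber_eq {V W K : Type*} [Finite V] [Finite W] {h : V → K}
    {h' : W → K} (hc : ∀ k, {v | h v = k}.ncard = {w | h' w = k}.ncard) :
    ∃ g : V ≃ W, ∀ v, h' (g v) = h v := by
  have e : ∀ k, Nonempty ({v // h v = k} ≃ {w // h' w = k}) := by
    intro k
    exact Finite.card_eq.mp (hc k)
  refine ⟨(Equiv.sigmaFiberEquiv h).symm.trans
    ((Equiv.sigmaCongrRight fun k => (e k).some).trans (Equiv.sigmaFiberEquiv h')), ?_⟩
  intro v
  simp [Equiv.sigmaFiberEquiv]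
  exact ((e (h v)).some ⟨v, rfl⟩).2

/-- A permutation of the vertices that preserves the colors. -/
def ColorPreserving {V C : Type*} (χ : V → C) (f : Equiv.Perm V) : Prop :=
  ∀ v, χ (f v) = χ v

theorem ColorPreserving.symm {V C : Type*} {χ : V → C} {f : Equiv.Perm V}
    (hf : ColorPreserving χ f) : ColorPreserving χ f.symm := by
  intro v
  have := hf (f.symm v)
  simpa using this.symm

theorem ColorPreserving.trans {V C : Type*} {χ : V → C} {f g : Equiv.Perm V}
    (hf : ColorPreserving χ f) (hg : ColorPreserving χ g) : ColorPreserving χ (f.trans g) :=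
  fun v => (hg _).trans (hf v)

theorem ColorPreserving.refl {V C : Type*} (χ : V → C) :
    ColorPreserving χ (Equiv.refl V) := fun _ => rfl

open Classical in
theorem ColorPreserving.swap {V C : Type*} {χ : V → C} {x y : V} (h : χ x = χ y) :
    ColorPreserving χ (Equiv.swap x y) := by
  intro v
  unfold Equiv.swap
  simp only [Equiv.coe_fn_mk, Equiv.swapCore]
  split_ifs with h1 h2
  · rw [h1, h]
  · rw [h2, h]
  · rfl

theorem exists_colorPreserving_extending {V C : Type*} [Finite V] {χ : V → C} (s : Set V)
    (g : V → V) (hg : Set.InjOn g s) (hχ : ∀ v ∈ s, χ (g v) = χ v) :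
    ∃ σ : Equiv.Perm V, ColorPreserving χ σ ∧ ∀ v ∈ s, σ v = g v := by
  classical
  induction s, s.toFinite using Set.Finite.induction_on with
  | empty => exact ⟨Equiv.refl V, .refl χ, by simp⟩
  | @insert a s ha hs ih =>
    obtain ⟨σ, hσ, hσ'⟩ := ih (hg.mono (Set.subset_insert _ _))
      (fun v hv => hχ v (Set.mem_insert_of_mem _ hv))
    -- The swap corrects the value at `a`. By injectivity it moves none of the values already
    -- prescribed.
    refine ⟨σ.trans (Equiv.swap (σ a) (g a)), hσ.trans (.swap ?_), ?_⟩
    · rw [hσ, hχ a (Set.mem_insert _ _)]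
    · intro v hv
      rcases hv with rfl | hv
      · simp
      · have h1 : σ v ≠ σ a := fun h => ha (by rwa [← σ.injective h])
        have h2 : σ v ≠ g a := by
          rw [hσ' v hv]
          intro h
          have := hg (Set.mem_insert_of_mem _ hv) (Set.mem_insert _ _) h
          exact ha (this ▸ hv)
        simp only [Equiv.trans_apply]
        rw [Equiv.swap_apply_of_ne_of_ne h1 h2, hσ' v hv]

/-! ### Colored graphs -/

/-- The number of neighbors of color `q`. -/
noncomputable def colorDegree {V C : Type*} (χ : V → C) (F : SimpleGraph V) (v : V) (q : C) : ℕ :=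
  {w | F.Adj v w ∧ χ w = q}.ncard

/-- Vertices of the same color have the same number of neighbors of each color in both graphs.
In particular, the coloring is equitable for both graphs if there are two similar ones. -/
def Similar {V C : Type*} (χ : V → C) (F F' : SimpleGraph V) : Prop :=
  ∀ v w, χ v = χ w → ∀ q, colorDegree χ F v q = colorDegree χ F' w q

/-- Every vertex has at most as many neighbors as other non-neighbors in each color class. -/
def Sparse {V C : Type*} (χ : V → C) (F : SimpleGraph V) : Prop :=
  ∀ v q, {w | F.Adj v w ∧ χ w = q}.ncard ≤ {w | w ≠ v ∧ ¬ F.Adj v w ∧ χ w = q}.ncard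

/-- Up to color-preserving isomorphism, the graph is determined by the coloring and the color
degrees. -/
def Rigid {V C : Type*} (χ : V → C) (F : SimpleGraph V) : Prop :=
  ∀ F' : SimpleGraph V, Similar χ F F' →
    ∃ f : Equiv.Perm V, ColorPreserving χ f ∧ ∀ u v, F.Adj u v ↔ F'.Adj (f u) (f v)

section
variable {V C : Type*} {χ : V → C} {F F' : SimpleGraph V}

theorem Similar.symm (h : Similar χ F F') : Similar χ F' F :=
  fun v w hvw q => (h w v hvw.symm q).symm

theorem Similar.left (h : Similar χ F F') : Similar χ F F :=
  fun v w hvw q => (h v w hvw q).trans (h w w rfl q).symm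

theorem Similar.exists_adj [Finite V] (h : Similar χ F F') {v w u : V} (hvw : χ v = χ w)
    (hu : F.Adj v u) : ∃ u', F'.Adj w u' ∧ χ u' = χ u := by
  have h1 : 0 < colorDegree χ F v (χ u) := (Set.ncard_pos (Set.toFinite _)).mpr ⟨u, hu, rfl⟩
  rw [h v w hvw] at h1
  exact (Set.ncard_pos (Set.toFinite _)).mp h1

theorem Similar.exists_two_adj [Finite V] (h : Similar χ F F') {v w u₁ u₂ : V} (hvw : χ v = χ w)
    (hu₁ : F.Adj v u₁) (hu₂ : F.Adj v u₂) (hne : u₁ ≠ u₂) :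
    ∃ u₁' u₂', F'.Adj w u₁' ∧ F'.Adj w u₂' ∧ u₁' ≠ u₂' ∧ χ u₁' = χ u₁ ∧ χ u₂' = χ u₂ := by
  by_cases hc : χ u₁ = χ u₂
  · have h1 : 1 < colorDegree χ F v (χ u₁) :=
      (Set.one_lt_ncard_iff (Set.toFinite _)).mpr ⟨u₁, u₂, ⟨hu₁, rfl⟩, ⟨hu₂, hc.symm⟩, hne⟩
    rw [h v w hvw] at h1
    obtain ⟨a, b, ha, hb, hab⟩ := (Set.one_lt_ncard_iff (Set.toFinite _)).mp h1
    exact ⟨a, b, ha.1, hb.1, hab, ha.2, hb.2.trans hc⟩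
  · obtain ⟨a, ha, ha'⟩ := h.exists_adj hvw hu₁
    obtain ⟨b, hb, hb'⟩ := h.exists_adj hvw hu₂
    exact ⟨a, b, ha, hb, fun h => hc (by rw [← ha', ← hb', h]), ha', hb'⟩

end

/-! ### Two-variable types and equitable colorings -/

/-- Duplicator's answer in the bijective pebble game with pebbles on `a` and `b`: equal color
degrees make the neighbors, and also the non-neighbors, of each color equinumerous. -/
theorem Similar.exists_perm {V C : Type*} [Finite V] {χ : V → C} {G H : SimpleGraph V}
    (h : Similar χ G H) {a b : V} (hab : χ a = χ b) :
    ∃ σ : Equiv.Perm V, ColorPreserving χ σ ∧ σ a = b ∧ ∀ v, G.Adj a v ↔ H.Adj b (σ v) := by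
  classical
  have hcount : ∀ k : C × Prop, {v | (χ v, G.Adj a v) = k}.ncard =
      {v | (χ v, H.Adj b v) = k}.ncard := by
    rintro ⟨q, p⟩
    by_cases hp : p
    · have h1 := h a b hab q
      simp only [colorDegree] at h1
      simpa [hp, Prod.ext_iff, and_comm] using h1
    · have h1 := h a b hab q
      simp only [colorDegree] at h1
      have e : ∀ (K : SimpleGraph V) (c : V), {v | (χ v, K.Adj c v) = (q, p)} =
          {v | χ v = q} \ {w | K.Adj c w ∧ χ w = q} := by
        intro K c
        ext v
        simp [hp, Prod.ext_iff]
        tauto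
      rw [e, e, Set.ncard_sdiff (fun v hv => hv.2), Set.ncard_sdiff (fun v hv => hv.2), h1]
  obtain ⟨g, hg⟩ := exists_equiv_of_ncard_fiber_eq hcount
  have hg1 : ∀ v, χ (g v) = χ v := fun v => (Prod.ext_iff.mp (hg v)).1
  have hg2 : ∀ v, H.Adj b (g v) ↔ G.Adj a v := fun v => by
    have := (Prod.ext_iff.mp (hg v)).2
    simpa using this
  -- `g` need not send `a` to `b`. Since `g a` and `b` have the same color and neither is adjacent
  -- to `b` in `H`, exchanging them repairs this and keeps all adjacencies.
  refine ⟨g.trans (Equiv.swap (g a) b), fun v => ?_, by simp, fun v => ?_⟩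
  · exact (ColorPreserving.swap ((hg1 a).trans hab) _).trans (hg1 v)
  · have h1 : ¬ H.Adj b (g a) := by rw [hg2]; exact G.irrefl
    simp only [Equiv.trans_apply]
    rw [← hg2]
    by_cases e1 : g v = g a
    · rw [e1]; simp [h1]
    by_cases e2 : g v = b
    · rw [e2]; simp [h1]
    · rw [Equiv.swap_apply_of_ne_of_ne e1 e2]

/-- Two partial assignments satisfy the same conditions on colors, equality and adjacency. -/
def Compatible {V C : Type*} (χ : V → C) (G H : SimpleGraph V) (a b : Fin 2 → Option V) : Prop :=
  (∀ i, (a i).map χ = (b i).map χ) ∧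
    ∀ i j v w v' w', a i = some v → a j = some w → b i = some v' → b j = some w' →
      ((v = w ↔ v' = w') ∧ (G.Adj v w ↔ H.Adj v' w'))

theorem Compatible.exists_eq_some {V C : Type*} {χ : V → C} {G H : SimpleGraph V}
    {a b : Fin 2 → Option V} (h : Compatible χ G H a b) {i : Fin 2} {v : V} (hv : a i = some v) :
    ∃ w, b i = some w ∧ χ v = χ w := by
  have h1 := h.1 i
  rw [hv] at h1
  cases hb : b i with
  | none => simp [hb] at h1
  | some w => exact ⟨w, rfl, by simpa [hb] using h1⟩

theorem Compatible.symm {V C : Type*} {χ : V → C} {G H : SimpleGraph V}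
    {a b : Fin 2 → Option V} (h : Compatible χ G H a b) : Compatible χ H G b a :=
  ⟨fun i => (h.1 i).symm, fun i j v w v' w' hv hw hv' hw' =>
    ⟨(h.2 i j v' w' v w hv' hw' hv hw).1.symm, (h.2 i j v' w' v w hv' hw' hv hw).2.symm⟩⟩

theorem Compatible.update {V C : Type*} {χ : V → C} {G H : SimpleGraph V}
    {a b : Fin 2 → Option V} (h : Compatible χ G H a b) {i j : Fin 2} (hij : ∀ k, k = i ∨ k = j)
    (hji : j ≠ i) {v w : V} (hvw : χ v = χ w)
    (hj : ∀ x y, a j = some x → b j = some y → (x = v ↔ y = w) ∧ (G.Adj x v ↔ H.Adj y w)) :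
    Compatible χ G H (Function.update a i (some v)) (Function.update b i (some w)) := by
  refine ⟨fun k => ?_, fun k l => ?_⟩
  · rcases hij k with rfl | rfl
    · simp [hvw]
    · simpa [Function.update_of_ne hji] using h.1 k
  · rcases hij k with rfl | rfl <;> rcases hij l with rfl | rfl
    · intro v₁ w₁ v₂ w₂ h1 h2 h3 h4
      simp only [Function.update_self, Option.some.injEq] at h1 h2 h3 h4
      subst h1 h2 h3 h4
      simp
    · intro v₁ w₁ v₂ w₂ h1 h2 h3 h4
      simp only [Function.update_self, Option.some.injEq, Function.update_of_ne hji]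
        at h1 h2 h3 h4
      subst h1 h3
      have := hj _ _ h2 h4
      rw [G.adj_comm, H.adj_comm]
      exact ⟨by rw [eq_comm, this.1, eq_comm], this.2⟩
    · intro v₁ w₁ v₂ w₂ h1 h2 h3 h4
      simp only [Function.update_self, Option.some.injEq, Function.update_of_ne hji]
        at h1 h2 h3 h4
      subst h2 h4
      exact hj _ _ h1 h3
    · intro v₁ w₁ v₂ w₂ h1 h2 h3 h4
      simp only [Function.update_of_ne hji] at h1 h2 h3 h4
      exact h.2 _ _ _ _ _ _ h1 h2 h3 h4

/-- At a counting quantifier only the value of the other variable matters. The bijection answering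
that pebble maps the witnesses on one side onto the witnesses on the other, so their numbers agree.
-/
theorem Similar.sat_iff {V C : Type*} [Finite V] {χ : V → C} {G H : SimpleGraph V}
    (h : Similar χ G H) (φ : Formula 2) :
    ∀ a b, Compatible χ G H a b → (Sat G φ a ↔ Sat H φ b) := by
  induction φ with
  | eq i j =>
    have key : ∀ (G H : SimpleGraph V) a b, Compatible χ G H a b → Sat G (.eq i j) a →
        Sat H (.eq i j) b := by
      rintro G H a b hab ⟨v, h1, h2⟩
      obtain ⟨v₁, h3, -⟩ := hab.exists_eq_some h1
      obtain ⟨v₂, h4, -⟩ := hab.exists_eq_some h2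
      have := (hab.2 _ _ _ _ _ _ h1 h2 h3 h4).1.mp rfl
      exact ⟨v₁, h3, this ▸ h4⟩
    exact fun a b hab => ⟨key _ _ _ _ hab, key _ _ _ _ hab.symm⟩
  | adj i j =>
    have key : ∀ (G H : SimpleGraph V) a b, Compatible χ G H a b → Sat G (.adj i j) a →
        Sat H (.adj i j) b := by
      rintro G H a b hab ⟨v, w, h1, h2, hvw⟩
      obtain ⟨v₁, h3, -⟩ := hab.exists_eq_some h1
      obtain ⟨v₂, h4, -⟩ := hab.exists_eq_some h2
      exact ⟨v₁, v₂, h3, h4, (hab.2 _ _ _ _ _ _ h1 h2 h3 h4).2.mp hvw⟩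
    exact fun a b hab => ⟨key _ _ _ _ hab, key _ _ _ _ hab.symm⟩
  | neg φ ih => exact fun a b hab => not_congr (ih a b hab)
  | and φ ψ ih₁ ih₂ => exact fun a b hab => and_congr (ih₁ a b hab) (ih₂ a b hab)
  | existsGE t i φ ih =>
    intro a b hab
    obtain ⟨j, hij, hji⟩ : ∃ j : Fin 2, (∀ k, k = i ∨ k = j) ∧ j ≠ i := by
      revert i; decide
    obtain ⟨σ, hσ, hσ'⟩ : ∃ σ : Equiv.Perm V, ColorPreserving χ σ ∧
        ∀ x y, a j = some x → b j = some y → σ x = y ∧ ∀ v, G.Adj x v ↔ H.Adj y (σ v) := by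
      cases hx : a j with
      | none => exact ⟨.refl V, .refl χ, by simp⟩
      | some x =>
        obtain ⟨y, hy, hxy⟩ := hab.exists_eq_some hx
        obtain ⟨σ, h1, h2, h3⟩ := h.exists_perm hxy
        refine ⟨σ, h1, ?_⟩
        intro x' y' hx' hy'
        rw [hy] at hy'
        simp only [Option.some.injEq] at hx' hy'
        subst hx' hy'
        exact ⟨h2, h3⟩
    have key : ∀ v, Sat G φ (Function.update a i (some v)) ↔
        Sat H φ (Function.update b i (some (σ v))) := by
      intro v
      refine ih _ _ (hab.update hij hji (hσ v).symm fun x y hx hy => ?_)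
      obtain ⟨h1, h2⟩ := hσ' x y hx hy
      exact ⟨by rw [← h1, σ.injective.eq_iff], h2 v⟩
    have hset : {v | Sat H φ (Function.update b i (some v))} =
        σ '' {v | Sat G φ (Function.update a i (some v))} := by
      ext w
      obtain ⟨v, rfl⟩ := σ.surjective w
      simp [key]
    simp only [Sat]
    rw [hset, σ.injective.encard_image]

theorem Similar.c2Coloring_eq {V C : Type*} [Finite V] {χ : V → C} {G H : SimpleGraph V}
    (h : Similar χ G H) {v w : V} (hvw : χ v = χ w) : c2Coloring G v = c2Coloring H w := by
  ext ⟨i, φ⟩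
  simp only [c2Coloring, vertexType, Set.mem_ofPred_eq]
  refine and_congr_right fun _ => h.sat_iff φ _ _ ⟨fun j => ?_, fun j l => ?_⟩
  · by_cases hj : j = i
    · subst hj; simp [hvw]
    · simp [Function.update_of_ne hj]
  · intro v₁ w₁ v₂ w₂ h1 h2 h3 h4
    by_cases hj : j = i
    · subst hj
      by_cases hl : l = j
      · subst hl
        simp only [Function.update_self, Option.some.injEq] at h1 h2 h3 h4
        subst h1 h2 h3 h4
        simp
      · simp [Function.update_of_ne hl] at h2
    · simp [Function.update_of_ne hj] at h1

theorem sat_iso_iff {k : ℕ} {V W : Type*} {G : SimpleGraph V} {H : SimpleGraph W} (f : G ≃g H)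
    (φ : Formula k) : ∀ a, Sat G φ a ↔ Sat H φ (fun i => (a i).map f) := by
  induction φ with
  | eq i j =>
    intro a
    constructor
    · rintro ⟨v, h1, h2⟩
      exact ⟨f v, by simp [h1], by simp [h2]⟩
    · rintro ⟨v, h1, h2⟩
      simp only [Option.map_eq_some_iff] at h1 h2
      obtain ⟨x, hx, rfl⟩ := h1
      obtain ⟨y, hy, hxy⟩ := h2
      have := f.injective hxy
      exact ⟨x, hx, this ▸ hy⟩
  | adj i j =>
    intro a
    constructor
    · rintro ⟨v, w, h1, h2, h3⟩
      exact ⟨f v, f w, by simp [h1], by simp [h2], f.map_adj_iff.mpr h3⟩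
    · rintro ⟨v, w, h1, h2, h3⟩
      simp only [Option.map_eq_some_iff] at h1 h2
      obtain ⟨x, hx, rfl⟩ := h1
      obtain ⟨y, hy, rfl⟩ := h2
      exact ⟨x, y, hx, hy, f.map_adj_iff.mp h3⟩
  | neg φ ih => exact fun a => not_congr (ih a)
  | and φ ψ ih₁ ih₂ => exact fun a => and_congr (ih₁ a) (ih₂ a)
  | existsGE t i φ ih =>
    intro a
    have hset : {w | Sat H φ (Function.update (fun i => (a i).map f) i (some w))} =
        f '' {v | Sat G φ (Function.update a i (some v))} := by
      ext w
      obtain ⟨v, rfl⟩ := f.surjective w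
      have : Function.update (fun i => (a i).map f) i (some (f v)) =
          fun j => (Function.update a i (some v) j).map f := by
        ext j
        by_cases hj : j = i
        · subst hj; simp
        · simp [Function.update_of_ne hj]
      simp [this, ih]
    simp only [Sat]
    rw [hset, f.injective.encard_image]

theorem c2Coloring_iso {V W : Type*} {G : SimpleGraph V} {H : SimpleGraph W} (f : G ≃g H) (v : V) :
    c2Coloring H (f v) = c2Coloring G v := by
  ext ⟨i, φ⟩
  simp only [c2Coloring, vertexType, Set.mem_ofPred_eq]
  refine and_congr_right fun _ => ?_
  rw [sat_iso_iff f]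
  have : (fun j => (Function.update (fun _ => none) i (some v) j).map f) =
      Function.update (fun _ => none) i (some (f v)) := by
    ext j
    by_cases hj : j = i
    · subst hj; simp
    · simp [Function.update_of_ne hj]
  rw [this]

/-- A graph similar to `G` satisfies the identifying sentence and is therefore isomorphic to `G`.
The isomorphism preserves colors, because types are invariant under isomorphism and each vertex has
the same type in both graphs. -/
theorem IsIdentified.rigid {V : Type u} [Finite V] {G : SimpleGraph V} (hG : IsIdentified 2 G) :
    Rigid (c2Coloring G) G := by
  obtain ⟨φ, -, hφ, hid⟩ := hG
  intro F' hF'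
  have h1 : Models F' φ :=
    (hF'.sat_iff φ _ _ ⟨fun _ => rfl, fun i j v w v' w' h => by simp at h⟩).mp hφ
  obtain ⟨f⟩ := hid V F' h1
  refine ⟨f.symm.toEquiv, fun v => ?_, fun u v => f.symm.map_adj_iff.symm⟩
  have h2 := c2Coloring_iso f.symm v
  rw [← h2]
  exact hF'.c2Coloring_eq rfl

/-! ### Formulas -/

/-- Renaming of the variables. -/
def Formula.rename {k : ℕ} (e : Equiv.Perm (Fin k)) : Formula k → Formula k
  | .eq i j => .eq (e i) (e j)
  | .adj i j => .adj (e i) (e j)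
  | .neg φ => .neg (φ.rename e)
  | .and φ ψ => .and (φ.rename e) (ψ.rename e)
  | .existsGE t i φ => .existsGE t (e i) (φ.rename e)

theorem Formula.freeVars_rename {k : ℕ} (e : Equiv.Perm (Fin k)) (φ : Formula k) :
    (φ.rename e).freeVars = e '' φ.freeVars := by
  induction φ with
  | eq i j => simp [Formula.rename, Formula.freeVars, Set.image_insert_eq]
  | adj i j => simp [Formula.rename, Formula.freeVars, Set.image_insert_eq]
  | neg φ ih => simpa [Formula.rename, Formula.freeVars] using ih
  | and φ ψ ih₁ ih₂ => simp [Formula.rename, Formula.freeVars, ih₁, ih₂, Set.image_union]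
  | existsGE t i φ ih =>
    simp [Formula.rename, Formula.freeVars, ih, Set.image_sdiff e.injective]

theorem sat_rename {k : ℕ} {V : Type*} (G : SimpleGraph V) (e : Equiv.Perm (Fin k))
    (φ : Formula k) : ∀ a, Sat G (φ.rename e) a ↔ Sat G φ (a ∘ e) := by
  induction φ with
  | eq i j => exact fun a => Iff.rfl
  | adj i j => exact fun a => Iff.rfl
  | neg φ ih => exact fun a => not_congr (ih a)
  | and φ ψ ih₁ ih₂ => exact fun a => and_congr (ih₁ a) (ih₂ a)
  | existsGE t i φ ih =>
    intro a
    simp only [Sat, Formula.rename]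
    have : ∀ v, Function.update a (e i) (some v) ∘ e = Function.update (a ∘ e) i (some v) := by
      intro v
      rw [Function.update_comp_eq_of_injective _ e.injective]
    simp only [ih, this]

theorem sat_congr {k : ℕ} {V : Type*} (G : SimpleGraph V) (φ : Formula k) :
    ∀ a b, (∀ i ∈ φ.freeVars, a i = b i) → (Sat G φ a ↔ Sat G φ b) := by
  induction φ with
  | eq i j =>
    intro a b h
    simp [Sat, h i (by simp [Formula.freeVars]), h j (by simp [Formula.freeVars])]
  | adj i j =>
    intro a b h
    simp [Sat, h i (by simp [Formula.freeVars]), h j (by simp [Formula.freeVars])]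
  | neg φ ih => exact fun a b h => not_congr (ih a b h)
  | and φ ψ ih₁ ih₂ =>
    exact fun a b h => and_congr (ih₁ a b fun i hi => h i (Or.inl hi))
      (ih₂ a b fun i hi => h i (Or.inr hi))
  | existsGE t i φ ih =>
    intro a b h
    have : ∀ v, Sat G φ (Function.update a i (some v)) ↔ Sat G φ (Function.update b i (some v)) := by
      intro v
      refine ih _ _ fun j hj => ?_
      by_cases hji : j = i
      · subst hji; simp
      · simp [Function.update_of_ne hji, h j ⟨hj, hji⟩]
    simp [Sat, this]

/-- The conjunction of a list of formulas. -/
def Formula.conj : List (Formula 2) → Formula 2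
  | [] => .existsGE 0 0 (.eq 0 0)
  | φ :: l => .and φ (Formula.conj l)

theorem sat_conj {V : Type*} (G : SimpleGraph V) (l : List (Formula 2)) (a : Fin 2 → Option V) :
    Sat G (Formula.conj l) a ↔ ∀ φ ∈ l, Sat G φ a := by
  induction l with
  | nil => simp [Formula.conj, Sat]
  | cons φ l ih => simp [Formula.conj, Sat, ih]

theorem Formula.freeVars_conj {l : List (Formula 2)} {s : Set (Fin 2)}
    (h : ∀ φ ∈ l, φ.freeVars ⊆ s) : (Formula.conj l).freeVars ⊆ s := by
  induction l with
  | nil => simp [Formula.conj, Formula.freeVars]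
  | cons φ l ih =>
    simp only [List.mem_cons, forall_eq_or_imp] at h
    exact Set.union_subset h.1 (ih h.2)

/-- There are exactly `n` values of the variable `i`. -/
def Formula.exactly {k : ℕ} (n : ℕ) (i : Fin k) (φ : Formula k) : Formula k :=
  .and (.existsGE n i φ) (.neg (.existsGE (n + 1) i φ))

theorem Formula.freeVars_exactly {k : ℕ} (n : ℕ) (i : Fin k) (φ : Formula k) :
    (Formula.exactly n i φ).freeVars = φ.freeVars \ {i} := by
  simp [Formula.exactly, Formula.freeVars]

theorem sat_exactly {k : ℕ} {V : Type*} [Finite V] (G : SimpleGraph V) (n : ℕ) (i : Fin k)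
    (φ : Formula k) (a : Fin k → Option V) : Sat G (Formula.exactly n i φ) a ↔
      {v | Sat G φ (Function.update a i (some v))}.ncard = n := by
  simp only [Formula.exactly, Sat]
  rw [← Set.Finite.cast_ncard_eq (Set.toFinite _)]
  norm_cast
  omega

/-- No value of the variable `i` satisfies the formula. -/
def Formula.none {k : ℕ} (i : Fin k) (φ : Formula k) : Formula k :=
  .neg (.existsGE 1 i φ)

theorem Formula.freeVars_none {k : ℕ} (i : Fin k) (φ : Formula k) :
    (Formula.none i φ).freeVars = φ.freeVars \ {i} := rfl

theorem sat_none {k : ℕ} {V : Type*} (G : SimpleGraph V) (i : Fin k)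
    (φ : Formula k) (a : Fin k → Option V) : Sat G (Formula.none i φ) a ↔
      ∀ v, ¬ Sat G φ (Function.update a i (some v)) := by
  simp only [Formula.none, Sat]
  simp [Set.one_le_encard_iff_nonempty, Set.Nonempty]

/-! ### Definability of the color classes -/

/-- The assignment of the vertex `v` to the variable `i`. -/
def single {V : Type*} (i : Fin 2) (v : V) : Fin 2 → Option V :=
  Function.update (fun _ => none) i (some v)

theorem sat_single {V : Type*} (G : SimpleGraph V) {φ : Formula 2} {i : Fin 2}
    (hφ : φ.freeVars ⊆ {i}) (a : Fin 2 → Option V) (v : V) :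
    Sat G φ (Function.update a i (some v)) ↔ Sat G φ (single i v) := by
  refine sat_congr G φ _ _ fun j hj => ?_
  obtain rfl : j = i := hφ hj
  simp [single]

theorem sat_rename_single {V : Type*} (G : SimpleGraph V) (φ : Formula 2) (e : Equiv.Perm (Fin 2))
    (i : Fin 2) (v : V) : Sat G (φ.rename e) (single (e i) v) ↔ Sat G φ (single i v) := by
  rw [sat_rename]
  simp only [single]
  rw [Function.update_comp_eq_of_injective _ e.injective]
  rfl

theorem mem_c2Coloring_iff {V : Type*} {G : SimpleGraph V} {v : V} {i : Fin 2} {φ : Formula 2} :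
    (i, φ) ∈ c2Coloring G v ↔ φ.freeVars ⊆ {i} ∧ Sat G φ (single i v) := Iff.rfl

theorem exists_formula_separating {V : Type*} {G : SimpleGraph V} {v w : V}
    (h : c2Coloring G v ≠ c2Coloring G w) :
    ∃ φ : Formula 2, φ.freeVars ⊆ {0} ∧ Sat G φ (single 0 v) ∧ ¬ Sat G φ (single 0 w) := by
  have h1 : ∃ i φ, φ.freeVars ⊆ {i} ∧ ¬ (Sat G φ (single i v) ↔ Sat G φ (single i w)) := by
    by_contra! hcon
    refine h (Set.ext fun ⟨i, φ⟩ => ?_)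
    rw [mem_c2Coloring_iff, mem_c2Coloring_iff]
    exact and_congr_right fun hi => hcon i φ hi
  obtain ⟨i, φ, hi, hφ⟩ := h1
  have h2 : ∃ φ : Formula 2, φ.freeVars ⊆ {0} ∧
      ¬ (Sat G φ (single 0 v) ↔ Sat G φ (single 0 w)) := by
    refine ⟨φ.rename (Equiv.swap i 0), ?_, ?_⟩
    · rw [Formula.freeVars_rename]
      rintro _ ⟨j, hj, rfl⟩
      obtain rfl : j = i := hi hj
      simp
    · have h3 := fun v => sat_rename_single G φ (Equiv.swap i 0) i v
      simp only [Equiv.swap_apply_left] at h3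
      rwa [h3, h3]
  obtain ⟨φ, hi, hφ⟩ := h2
  by_cases hv : Sat G φ (single 0 v)
  · exact ⟨φ, hi, hv, fun hw => hφ ⟨fun _ => hw, fun _ => hv⟩⟩
  · refine ⟨.neg φ, hi, hv, fun hw => hφ ⟨fun h => (hv h).elim, fun h => (hw h).elim⟩⟩

/-- As `V` is finite, the conjunction over all `w` of a formula separating `v` from `w` defines the
class of `v`. -/
theorem exists_formula_defining {V : Type*} [Finite V] (G : SimpleGraph V) (v : V) :
    ∃ φ : Formula 2, φ.freeVars ⊆ {0} ∧
      ∀ w, Sat G φ (single 0 w) ↔ c2Coloring G w = c2Coloring G v := by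
  classical
  have := Fintype.ofFinite V
  have h1 : ∀ w, ∃ φ : Formula 2, φ.freeVars ⊆ {0} ∧ Sat G φ (single 0 v) ∧
      (c2Coloring G v ≠ c2Coloring G w → ¬ Sat G φ (single 0 w)) := by
    intro w
    by_cases h : c2Coloring G v = c2Coloring G w
    · refine ⟨Formula.conj [], ?_, ?_, fun h' => (h' h).elim⟩
      · exact Formula.freeVars_conj (by simp)
      · rw [sat_conj]; simp
    · obtain ⟨φ, h1, h2, h3⟩ := exists_formula_separating h
      exact ⟨φ, h1, h2, fun _ => h3⟩
  choose ψ h1 h2 h3 using h1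
  refine ⟨Formula.conj ((Finset.univ.toList).map ψ), ?_, fun w => ?_⟩
  · refine Formula.freeVars_conj fun φ hφ => ?_
    obtain ⟨w, -, rfl⟩ := List.mem_map.mp hφ
    exact h1 w
  · have key : ∀ w, Sat G (Formula.conj ((Finset.univ.toList).map ψ)) (single 0 w) ↔
        ∀ x, Sat G (ψ x) (single 0 w) := by
      intro w
      rw [sat_conj]
      simp
    constructor
    · intro h
      by_contra hne
      exact h3 w (Ne.symm hne) ((key w).mp h w)
    · intro h
      have hv : ((0 : Fin 2), Formula.conj ((Finset.univ.toList).map ψ)) ∈ c2Coloring G v := by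
        refine mem_c2Coloring_iff.mpr ⟨?_, (key v).mpr h2⟩
        refine Formula.freeVars_conj fun φ hφ => ?_
        obtain ⟨w, -, rfl⟩ := List.mem_map.mp hφ
        exact h1 w
      rw [← h] at hv
      exact (mem_c2Coloring_iff.mp hv).2

/-- A choice of a formula in the variable `0` that defines the color class of `v`. -/
noncomputable def classFormula {V : Type*} [Finite V] (G : SimpleGraph V) (v : V) : Formula 2 :=
  (exists_formula_defining G v).choose

theorem freeVars_classFormula {V : Type*} [Finite V] (G : SimpleGraph V) (v : V) :
    (classFormula G v).freeVars ⊆ {0} :=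
  (exists_formula_defining G v).choose_spec.1

theorem sat_classFormula {V : Type*} [Finite V] (G : SimpleGraph V) (v w : V) :
    Sat G (classFormula G v) (single 0 w) ↔ c2Coloring G w = c2Coloring G v :=
  (exists_formula_defining G v).choose_spec.2 w

/-- The variable `1` denotes a neighbor of the variable `0` in the color class of `v`. -/
noncomputable def neighborFormula {V : Type*} [Finite V] (G : SimpleGraph V) (v : V) : Formula 2 :=
  .and (.adj 0 1) ((classFormula G v).rename (Equiv.swap 0 1))

theorem freeVars_neighborFormula_diff {V : Type*} [Finite V] (G : SimpleGraph V) (v : V) :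
    (neighborFormula G v).freeVars \ {1} ⊆ {0} := by
  rintro i ⟨-, hi⟩
  revert i
  decide

theorem sat_neighborFormula {V W : Type*} [Finite V] (G : SimpleGraph V) (v : V)
    (H : SimpleGraph W) (y z : W) (a : Fin 2 → Option W) :
    Sat H (neighborFormula G v) (Function.update (Function.update a 0 (some y)) 1 (some z)) ↔
      H.Adj y z ∧ Sat H (classFormula G v) (single 0 z) := by
  simp only [neighborFormula, Sat]
  refine and_congr (by simp) ?_
  rw [sat_single H (i := 1)]
  · exact sat_rename_single H (classFormula G v) (Equiv.swap 0 1) 0 z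
  · rw [Formula.freeVars_rename]
    rintro _ ⟨j, hj, rfl⟩
    obtain rfl : j = 0 := freeVars_classFormula G v hj
    simp

/-- The number of neighbors in a definable class is expressible with two variables, so it belongs to
the type of the vertex. A color that does not occur contributes degree 0 everywhere. -/
theorem similar_c2Coloring {V : Type*} [Finite V] (G : SimpleGraph V) :
    Similar (c2Coloring G) G G := by
  intro v w hvw q
  by_cases hq : ∃ u, c2Coloring G u = q
  · obtain ⟨u, rfl⟩ := hq
    have key : ∀ x n, ((0 : Fin 2), Formula.exactly n 1 (neighborFormula G u)) ∈ c2Coloring G x ↔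
        colorDegree (c2Coloring G) G x (c2Coloring G u) = n := by
      intro x n
      rw [mem_c2Coloring_iff, Formula.freeVars_exactly, sat_exactly]
      simp only [freeVars_neighborFormula_diff, true_and, colorDegree, single,
        sat_neighborFormula]
      have := sat_classFormula G u
      simp only [single] at this
      simp only [this]
    have h1 := (key v _).mpr rfl
    rw [hvw] at h1
    exact ((key w _).mp h1).symm
  · have : ∀ x, {y | G.Adj x y ∧ c2Coloring G y = q} = ∅ := by
      intro x
      ext y
      simp only [Set.mem_ofPred_eq, Set.mem_empty_iff_false, iff_false, not_and]
      exact fun _ h => hq ⟨y, h⟩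
    simp [colorDegree, this]

/-- The sentence describing the color classes, their sizes and the color degrees. -/
theorem exists_describing_sentence {V : Type*} [Finite V] (G : SimpleGraph V) :
    ∃ φ : Formula 2, φ.IsSentence ∧ ∀ {W : Type*} [Finite W] (H : SimpleGraph W),
      Models H φ ↔
        (∀ y, ∃ v, Sat H (classFormula G v) (single 0 y)) ∧
        (∀ u v, (c2Coloring G u = c2Coloring G v) → ∀ y, Sat H (classFormula G u) (single 0 y) →
          Sat H (classFormula G v) (single 0 y)) ∧
        (∀ u v, (c2Coloring G u ≠ c2Coloring G v) → ∀ y, Sat H (classFormula G u) (single 0 y) →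
          ¬ Sat H (classFormula G v) (single 0 y)) ∧
        (∀ v, {y | Sat H (classFormula G v) (single 0 y)}.ncard =
          {w | c2Coloring G w = c2Coloring G v}.ncard) ∧
        (∀ u v y, Sat H (classFormula G u) (single 0 y) →
          {z | H.Adj y z ∧ Sat H (classFormula G v) (single 0 z)}.ncard =
            colorDegree (c2Coloring G) G u (c2Coloring G v)) := by
  classical
  have := Fintype.ofFinite V
  let χ := c2Coloring G
  let ψ := classFormula G
  -- `φ₁` says that the class formulas cover the graph, `φ₂` that they depend on the color only,
  -- `φ₃` that different colors exclude each other; `φ₄` gives the sizes and `φ₅` the degrees. The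
  -- empty conjunction is the true formula, used for pairs with nothing to require.
  let φ₁ : Formula 2 := .none 0 (.conj ((Finset.univ.toList).map fun v => .neg (ψ v)))
  let φ₂ : V → V → Formula 2 := fun u v =>
    if χ u = χ v then .none 0 (.and (ψ u) (.neg (ψ v))) else .conj []
  let φ₃ : V → V → Formula 2 := fun u v =>
    if χ u ≠ χ v then .none 0 (.and (ψ u) (ψ v)) else .conj []
  let φ₄ : V → Formula 2 := fun v => .exactly {w | χ w = χ v}.ncard 0 (ψ v)
  let φ₅ : V → V → Formula 2 := fun u v =>
    .none 0 (.and (ψ u) (.neg (.exactly (colorDegree χ G u (χ v)) 1 (neighborFormula G v))))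
  let l₂ := (Finset.univ : Finset (V × V)).toList
  let l₁ := (Finset.univ : Finset V).toList
  have hψ : ∀ v, (ψ v).freeVars ⊆ {0} := freeVars_classFormula G
  have hdiff : ∀ s : Set (Fin 2), s ⊆ {0} → s \ {0} ⊆ ∅ := fun s hs i hi => hi.2 (hs hi.1)
  have h0 : (Formula.conj []).freeVars ⊆ ∅ := Formula.freeVars_conj (by simp)
  refine ⟨.and φ₁ (.and (.conj (l₂.map fun p => φ₂ p.1 p.2)) (.and
    (.conj (l₂.map fun p => φ₃ p.1 p.2)) (.and (.conj (l₁.map φ₄))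
      (.conj (l₂.map fun p => φ₅ p.1 p.2))))), ?_, ?_⟩
  · refine Set.subset_empty_iff.mp (Set.union_subset ?_ (Set.union_subset ?_ (Set.union_subset ?_
      (Set.union_subset ?_ ?_))))
    · rw [Formula.freeVars_none]
      refine hdiff _ (Formula.freeVars_conj fun φ hφ => ?_)
      obtain ⟨w, -, rfl⟩ := List.mem_map.mp hφ
      exact hψ w
    · refine Formula.freeVars_conj fun φ hφ => ?_
      obtain ⟨⟨u, v⟩, -, rfl⟩ := List.mem_map.mp hφ
      simp only [φ₂]
      split_ifs
      · exact hdiff _ (Set.union_subset (hψ u) (hψ v))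
      · exact h0
    · refine Formula.freeVars_conj fun φ hφ => ?_
      obtain ⟨⟨u, v⟩, -, rfl⟩ := List.mem_map.mp hφ
      simp only [φ₃]
      split_ifs
      · exact hdiff _ (Set.union_subset (hψ u) (hψ v))
      · exact h0
    · refine Formula.freeVars_conj fun φ hφ => ?_
      obtain ⟨v, -, rfl⟩ := List.mem_map.mp hφ
      simp only [φ₄]
      rw [Formula.freeVars_exactly]
      exact hdiff _ (hψ v)
    · refine Formula.freeVars_conj fun φ hφ => ?_
      obtain ⟨⟨u, v⟩, -, rfl⟩ := List.mem_map.mp hφ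
      simp only [φ₅]
      refine hdiff _ (Set.union_subset (hψ u) ?_)
      simp only [Formula.freeVars]
      rw [Formula.freeVars_exactly]
      exact freeVars_neighborFormula_diff G v
  · intro W _ H
    have hs : ∀ v (y : W), Sat H (ψ v) (Function.update (fun _ => none) 0 (some y)) ↔
        Sat H (classFormula G v) (single 0 y) := fun v y => Iff.rfl
    have hl : ∀ (f : V → V → Formula 2) (a : Fin 2 → Option W),
        Sat H (.conj (l₂.map fun p => f p.1 p.2)) a ↔ ∀ u v, Sat H (f u v) a := by
      intro f a
      rw [sat_conj]
      refine ⟨fun h u v => h _ (List.mem_map.mpr ⟨(u, v), by simp [l₂], rfl⟩), fun h φ hφ => ?_⟩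
      obtain ⟨⟨u, v⟩, -, rfl⟩ := List.mem_map.mp hφ
      exact h u v
    simp only [Models, Sat]
    refine and_congr ?_ (and_congr ?_ (and_congr ?_ (and_congr ?_ ?_)))
    · simp only [φ₁, sat_none, sat_conj, List.mem_map, Finset.mem_toList, Finset.mem_univ, true_and,
        forall_exists_index, forall_apply_eq_imp_iff, Sat, hs]
      push Not
      rfl
    · rw [hl]
      refine forall_congr' fun u => forall_congr' fun v => ?_
      simp only [φ₂]
      split_ifs with h
      · simp only [sat_none, Sat, hs, not_and, not_not]
        exact ⟨fun h' _ => h', fun h' => h' h⟩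
      · rw [sat_conj]; simp only [List.not_mem_nil, false_imp_iff, implies_true, true_iff]
        exact fun h' => (h h').elim
    · rw [hl]
      refine forall_congr' fun u => forall_congr' fun v => ?_
      simp only [φ₃]
      split_ifs with h
      · simp only [sat_none, Sat, hs, not_and]
        exact ⟨fun h' _ => h', fun h' => h' h⟩
      · rw [sat_conj]; simp only [List.not_mem_nil, false_imp_iff, implies_true, true_iff]
        exact fun h' => (h h').elim
    · rw [sat_conj]
      simp only [l₁, List.mem_map, Finset.mem_toList, Finset.mem_univ, true_and,
        forall_exists_index, forall_apply_eq_imp_iff, φ₄, sat_exactly, hs]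
      rfl
    · rw [hl]
      simp only [φ₅, sat_none, Sat, hs, sat_exactly, sat_neighborFormula, not_and, not_not]
      rfl

/-- In a model `H` of the describing sentence, the class formulas define a coloring with the class
sizes of `G`. A bijection respecting the colors pulls `H` back to a graph on `V` similar to `G`, and
rigidity applies to it. -/
theorem Rigid.isIdentified {V : Type u} [Finite V] {G : SimpleGraph V}
    (hG : Rigid (c2Coloring G) G) : IsIdentified 2 G := by
  obtain ⟨φ, hφ, hmod⟩ := exists_describing_sentence.{u, u} G
  refine ⟨φ, hφ, ?_, ?_⟩
  · rw [hmod]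
    simp only [sat_classFormula]
    refine ⟨fun y => ⟨y, rfl⟩, fun u v huv y hy => hy.trans huv,
      fun u v huv y hy hy' => huv (hy.symm.trans hy'), fun v => trivial, fun u v y hy => ?_⟩
    exact similar_c2Coloring G _ _ hy _
  · intro W _ H hH
    obtain ⟨h1, h2, h3, h4, h5⟩ := (hmod H).mp hH
    choose r hr using h1
    have hr' : ∀ v y, Sat H (classFormula G v) (single 0 y) ↔
        c2Coloring G (r y) = c2Coloring G v := by
      intro v y
      constructor
      · intro h
        by_contra hne
        exact h3 _ _ hne y (hr y) h
      · exact fun h => h2 _ _ h y (hr y)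
    have hcount : ∀ k, {v | c2Coloring G v = k}.ncard = {y | c2Coloring G (r y) = k}.ncard := by
      intro k
      by_cases hk : ∃ v, c2Coloring G v = k
      · obtain ⟨v, rfl⟩ := hk
        rw [← h4 v]
        simp only [hr']
      · push Not at hk
        simp [hk]
    obtain ⟨e, he⟩ := exists_equiv_of_ncard_fiber_eq hcount
    have hsim : Similar (c2Coloring G) G (H.comap e) := by
      intro v w hvw q
      by_cases hq : ∃ u, c2Coloring G u = q
      · obtain ⟨u, rfl⟩ := hq
        rw [← h5 v u (e w) ((hr' _ _).mpr ((he w).trans hvw.symm))]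
        simp only [hr', colorDegree, comap_adj]
        have : {z | H.Adj (e w) z ∧ c2Coloring G (r z) = c2Coloring G u} =
            e '' {x | H.Adj (e w) (e x) ∧ c2Coloring G x = c2Coloring G u} := by
          ext z
          obtain ⟨x, rfl⟩ := e.surjective z
          simp [he]
        rw [this, Set.ncard_image_of_injective _ e.injective]
      · push Not at hq
        simp [colorDegree, hq]
    obtain ⟨f, -, hf⟩ := hG _ hsim
    exact ⟨(⟨f.trans e, by intro a b; exact (hf a b).symm⟩ : G ≃g H).symm⟩

theorem isIdentified_iff_rigid {V : Type u} [Finite V] {G : SimpleGraph V} :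
    IsIdentified 2 G ↔ Rigid (c2Coloring G) G :=
  ⟨IsIdentified.rigid, Rigid.isIdentified⟩

/-! ### Flips -/

/-- The graph obtained by complementing the edges between the color classes related by `M`. -/
def flipBy {V C : Type*} (χ : V → C) (M : Set (Sym2 C)) (F : SimpleGraph V) : SimpleGraph V where
  Adj v w := v ≠ w ∧ Xor (F.Adj v w) (s(χ v, χ w) ∈ M)
  symm := ⟨fun v w h => ⟨h.1.symm, by rw [F.adj_comm, Sym2.eq_swap]; exact h.2⟩⟩
  loopless := ⟨fun _ h => h.1 rfl⟩

section
variable {V C : Type*} {χ : V → C} {M : Set (Sym2 C)} {F F' : SimpleGraph V}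

theorem flipBy_adj {v w : V} :
    (flipBy χ M F).Adj v w ↔ v ≠ w ∧ Xor (F.Adj v w) (s(χ v, χ w) ∈ M) := Iff.rfl

theorem flipBy_flipBy : flipBy χ M (flipBy χ M F) = F := by
  ext v w
  simp only [flipBy_adj]
  have := @SimpleGraph.Adj.ne _ F v w
  unfold Xor
  tauto

theorem flipBy_iso {f : Equiv.Perm V} (hf : ColorPreserving χ f)
    (h : ∀ u v, F.Adj u v ↔ F'.Adj (f u) (f v)) (u v : V) :
    (flipBy χ M F).Adj u v ↔ (flipBy χ M F').Adj (f u) (f v) := by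
  simp only [flipBy_adj, h u v, hf u, hf v, ne_eq, f.injective.eq_iff]

theorem ncard_class_diff_singleton [Finite V] (v w : V) (hvw : χ v = χ w) (q : C) :
    ({x | χ x = q} \ {v}).ncard = ({x | χ x = q} \ {w}).ncard := by
  by_cases hq : χ v = q
  · rw [Set.ncard_sdiff_singleton_of_mem (s := {x | χ x = q}) hq,
      Set.ncard_sdiff_singleton_of_mem (s := {x | χ x = q}) (hvw.symm.trans hq)]
  · rw [Set.sdiff_singleton_eq_self (s := {x | χ x = q}) hq,
      Set.sdiff_singleton_eq_self (s := {x | χ x = q}) (fun h => hq (hvw.trans h))]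

theorem ncard_nonadj [Finite V] (F : SimpleGraph V) (v : V) (q : C) :
    {w | w ≠ v ∧ ¬ F.Adj v w ∧ χ w = q}.ncard =
      ({x | χ x = q} \ {v}).ncard - colorDegree χ F v q := by
  rw [colorDegree, ← Set.ncard_sdiff]
  · congr 1
    ext w
    simp only [Set.mem_ofPred_eq, Set.mem_sdiff, Set.mem_singleton_iff]
    tauto
  · intro w hw
    exact ⟨hw.2, hw.1.ne'⟩

theorem Similar.ncard_nonadj_eq [Finite V] (h : Similar χ F F') {v w : V} (hvw : χ v = χ w)
    (q : C) : {x | x ≠ v ∧ ¬ F.Adj v x ∧ χ x = q}.ncard =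
      {x | x ≠ w ∧ ¬ F'.Adj w x ∧ χ x = q}.ncard := by
  rw [ncard_nonadj, ncard_nonadj, h v w hvw, ncard_class_diff_singleton v w hvw]

theorem colorDegree_flipBy_of_mem {v : V} {q : C} (h : s(χ v, q) ∈ M) :
    colorDegree χ (flipBy χ M F) v q = {w | w ≠ v ∧ ¬ F.Adj v w ∧ χ w = q}.ncard := by
  unfold colorDegree
  congr 1
  ext w
  simp only [Set.mem_ofPred_eq, flipBy_adj, Xor]
  constructor
  · rintro ⟨⟨h1, h2⟩, rfl⟩
    exact ⟨h1.symm, by tauto, rfl⟩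
  · rintro ⟨h1, h2, rfl⟩
    exact ⟨⟨h1.symm, by tauto⟩, rfl⟩

theorem colorDegree_flipBy_of_notMem {v : V} {q : C} (h : s(χ v, q) ∉ M) :
    colorDegree χ (flipBy χ M F) v q = colorDegree χ F v q := by
  unfold colorDegree
  congr 1
  ext w
  simp only [Set.mem_ofPred_eq, flipBy_adj, Xor]
  constructor
  · rintro ⟨⟨h1, h2⟩, rfl⟩
    exact ⟨by tauto, rfl⟩
  · rintro ⟨h1, rfl⟩
    exact ⟨⟨h1.ne, by tauto⟩, rfl⟩

/-- A flip exchanges a degree for the number of other non-neighbors, which is determined by the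
degree and the class size. -/
theorem Similar.flipBy [Finite V] (h : Similar χ F F') (M : Set (Sym2 C)) :
    Similar χ (flipBy χ M F) (flipBy χ M F') := by
  intro v w hvw q
  by_cases hq : s(χ v, q) ∈ M
  · rw [colorDegree_flipBy_of_mem hq, colorDegree_flipBy_of_mem (hvw ▸ hq),
      h.ncard_nonadj_eq hvw]
  · rw [colorDegree_flipBy_of_notMem hq, colorDegree_flipBy_of_notMem (hvw ▸ hq), h v w hvw]

/-- Flipping is an involution, preserves similarity, and commutes with color-preserving
isomorphisms. -/
theorem Rigid.flipBy [Finite V] (h : Rigid χ F) (M : Set (Sym2 C)) :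
    Rigid χ (flipBy χ M F) := by
  intro F' hF'
  have h1 := hF'.flipBy M
  rw [flipBy_flipBy] at h1
  obtain ⟨f, hf, hf'⟩ := h _ h1
  refine ⟨f, hf, ?_⟩
  have h2 := flipBy_iso (M := M) hf hf'
  rwa [flipBy_flipBy] at h2

theorem rigid_flipBy_iff [Finite V] : Rigid χ (flipBy χ M F) ↔ Rigid χ F :=
  ⟨fun h => by simpa [flipBy_flipBy] using h.flipBy M, fun h => h.flipBy M⟩

end

/-! ### Counting pairs between color classes -/

theorem ncard_eq_mul_of_fiber {V W : Type*} [Finite V] [Finite W] {S : Set (V × W)} {P : Set V}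
    {d : ℕ} (hS : ∀ x ∈ S, x.1 ∈ P) (hd : ∀ v ∈ P, {w | (v, w) ∈ S}.ncard = d) :
    S.ncard = P.ncard * d := by
  classical
  have := Fintype.ofFinite V
  have := Fintype.ofFinite W
  rw [Set.ncard_eq_toFinset_card _ (Set.toFinite S), Set.ncard_eq_toFinset_card _ (Set.toFinite P),
    Finset.card_eq_sum_card_fiberwise (f := Prod.fst) (t := (Set.toFinite P).toFinset)
      (fun x hx => by simpa using hS x (by simpa using hx))]
  refine Finset.sum_const_nat fun v hv => ?_
  rw [← hd v (by simpa using hv), ← Set.ncard_coe_finset]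
  refine (Set.ncard_congr (fun w _ => (v, w)) ?_ ?_ ?_).symm
  · intro w hw
    simpa using hw
  · intro a b _ _ h
    exact (Prod.ext_iff.mp h).2
  · rintro ⟨a, b⟩ h
    simp only [Finset.coe_filter, Set.Finite.mem_toFinset, Set.mem_ofPred_eq] at h
    obtain ⟨h, rfl⟩ := h
    exact ⟨b, h, rfl⟩

open Classical in
/-- The number of unordered pairs in terms of the number of ordered pairs. -/
theorem ncard_pairs_mul {V C : Type*} [Finite V] (χ : V → C) (p q : C) (R : V → V → Prop)
    (hR : ∀ v w, R v w → R w v) :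
    {e | ∃ v w, χ v = p ∧ χ w = q ∧ v ≠ w ∧ R v w ∧ e = s(v, w)}.ncard *
      (if p = q then 2 else 1) =
        {x : V × V | χ x.1 = p ∧ χ x.2 = q ∧ x.1 ≠ x.2 ∧ R x.1 x.2}.ncard := by
  have h1 : {x : V × V | χ x.1 = p ∧ χ x.2 = q ∧ x.1 ≠ x.2 ∧ R x.1 x.2}.ncard =
      {x : Sym2 V × (V × V) | (χ x.2.1 = p ∧ χ x.2.2 = q ∧ x.2.1 ≠ x.2.2 ∧ R x.2.1 x.2.2) ∧
        x.1 = s(x.2.1, x.2.2)}.ncard := by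
    refine Set.ncard_congr (fun x _ => (s(x.1, x.2), x)) (fun x hx => ⟨hx, rfl⟩)
      (fun a b _ _ h => (Prod.ext_iff.mp h).2) ?_
    rintro ⟨e, x⟩ ⟨hx, he⟩
    exact ⟨x, hx, by simp only at he; rw [he]⟩
  rw [h1, ncard_eq_mul_of_fiber
    (P := {e | ∃ v w, χ v = p ∧ χ w = q ∧ v ≠ w ∧ R v w ∧ e = s(v, w)})]
  · rintro ⟨e, v, w⟩ ⟨⟨h1, h2, h3, h4⟩, h5⟩
    exact ⟨v, w, h1, h2, h3, h4, h5⟩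
  · rintro e ⟨v, w, h1, h2, h3, h4, rfl⟩
    split_ifs with hpq
    · subst hpq
      rw [Set.ncard_eq_two]
      refine ⟨(v, w), (w, v), fun h => h3 (Prod.ext_iff.mp h).1, ?_⟩
      ext ⟨a, b⟩
      simp only [Set.mem_ofPred_eq, Set.mem_insert_iff, Set.mem_singleton_iff, Prod.mk.injEq,
        Sym2.eq_iff]
      constructor
      · rintro ⟨-, ⟨rfl, rfl⟩ | ⟨rfl, rfl⟩⟩ <;> simp
      · rintro (⟨rfl, rfl⟩ | ⟨rfl, rfl⟩)
        · exact ⟨⟨h1, h2, h3, h4⟩, by simp⟩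
        · exact ⟨⟨h2, h1, h3.symm, hR _ _ h4⟩, by simp⟩
    · rw [Set.ncard_eq_one]
      refine ⟨(v, w), ?_⟩
      ext ⟨a, b⟩
      simp only [Set.mem_ofPred_eq, Set.mem_singleton_iff, Prod.mk.injEq, Sym2.eq_iff]
      constructor
      · rintro ⟨⟨ha, hb, -⟩, ⟨rfl, rfl⟩ | ⟨rfl, rfl⟩⟩
        · simp
        · exact (hpq (h1.symm.trans hb)).elim
      · rintro ⟨rfl, rfl⟩
        exact ⟨⟨h1, h2, h3, h4⟩, by simp⟩

/-- The pairs of colors for which the edges outnumber the non-edges. -/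
def majorityPairs {V C : Type*} (χ : V → C) (G : SimpleGraph V) : Set (Sym2 C) :=
  {m | ∃ p q, m = s(p, q) ∧
    (pairsBetween {v | χ v = p} {v | χ v = q} \ G.edgeSet).encard <
      (pairsBetween {v | χ v = p} {v | χ v = q} ∩ G.edgeSet).encard}

theorem pairsBetween_comm {V : Type*} (P Q : Set V) : pairsBetween P Q = pairsBetween Q P := by
  ext e
  constructor <;> rintro ⟨v, hv, w, hw, hne, rfl⟩ <;> exact ⟨w, hw, v, hv, hne.symm, Sym2.eq_swap⟩

theorem mem_majorityPairs {V C : Type*} {χ : V → C} {G : SimpleGraph V} {p q : C} :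
    s(p, q) ∈ majorityPairs χ G ↔
      (pairsBetween {v | χ v = p} {v | χ v = q} \ G.edgeSet).encard <
        (pairsBetween {v | χ v = p} {v | χ v = q} ∩ G.edgeSet).encard := by
  constructor
  · rintro ⟨p', q', h1, h2⟩
    rcases Sym2.eq_iff.mp h1 with ⟨rfl, rfl⟩ | ⟨rfl, rfl⟩
    · exact h2
    · rwa [pairsBetween_comm] at h2
  · exact fun h => ⟨p, q, rfl, h⟩

theorem mem_c2Partition {V : Type*} {G : SimpleGraph V} {P : Set V} :
    P ∈ c2Partition G ↔ ∃ v, P = {w | c2Coloring G w = c2Coloring G v} := Iff.rfl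

/-- As `pairsBetween` is symmetric and the classes are disjoint, whether a pair of vertices is
complemented depends only on its unordered pair of colors. -/
theorem flipGraph_eq_flipBy {V : Type*} (G : SimpleGraph V) :
    flipGraph G = flipBy (c2Coloring G) (majorityPairs (c2Coloring G) G) G := by
  ext v w
  simp only [flipGraph, fromEdgeSet_adj, flipBy_adj]
  rw [and_comm]
  refine and_congr_right fun hne => ?_
  have key : s(v, w) ∈ flippedPairs G ↔
      s(c2Coloring G v, c2Coloring G w) ∈ majorityPairs (c2Coloring G) G := by
    constructor
    · rintro ⟨P, hP, Q, hQ, hlt, a, ha, b, hb, hab, he⟩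
      obtain ⟨x, rfl⟩ := mem_c2Partition.mp hP
      obtain ⟨y, rfl⟩ := mem_c2Partition.mp hQ
      simp only [Set.mem_ofPred_eq] at ha hb
      rw [← ha, ← hb] at hlt
      rcases Sym2.eq_iff.mp he with ⟨rfl, rfl⟩ | ⟨rfl, rfl⟩
      · exact mem_majorityPairs.mpr hlt
      · rw [Sym2.eq_swap]
        exact mem_majorityPairs.mpr hlt
    · intro h
      exact ⟨_, mem_c2Partition.mpr ⟨v, rfl⟩, _, mem_c2Partition.mpr ⟨w, rfl⟩,
        mem_majorityPairs.mp h, v, rfl, w, rfl, hne, rfl⟩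
  rw [Set.mem_symmDiff, key, mem_edgeSet]
  rfl

/-- By equitability, all vertices of a class have the same numbers of neighbors and of other
non-neighbors in a given class. Hence the majority between two classes is the majority at every
single vertex. -/
theorem sparse_flipBy_majorityPairs {V C : Type*} [Finite V] {χ : V → C} {G : SimpleGraph V}
    (h : Similar χ G G) : Sparse χ (flipBy χ (majorityPairs χ G) G) := by
  intro v q
  classical
  have hcount := ncard_pairs_mul χ (χ v) q
  -- Ordered pairs count every unordered pair twice exactly when the two classes coincide. The
  -- factor cancels in the comparison.
  set c := if χ v = q then 2 else 1 with hcdef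
  have hc : 0 < c := by rw [hcdef]; split_ifs <;> simp
  have h1 := hcount G.Adj (fun _ _ h => h.symm)
  have h2 := hcount (fun a b => ¬ G.Adj a b) (fun _ _ h => by rwa [G.adj_comm])
  have e1 : {x : V × V | χ x.1 = χ v ∧ χ x.2 = q ∧ x.1 ≠ x.2 ∧ G.Adj x.1 x.2}.ncard =
      {x | χ x = χ v}.ncard * colorDegree χ G v q := by
    refine ncard_eq_mul_of_fiber (fun x hx => hx.1) fun w hw => ?_
    rw [← h w v hw q, colorDegree]
    congr 1
    ext x
    simp only [Set.mem_ofPred_eq] at hw ⊢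
    exact ⟨fun h => ⟨h.2.2.2, h.2.1⟩, fun h => ⟨hw, h.2, h.1.ne, h.1⟩⟩
  have e2 : {x : V × V | χ x.1 = χ v ∧ χ x.2 = q ∧ x.1 ≠ x.2 ∧ ¬ G.Adj x.1 x.2}.ncard =
      {x | χ x = χ v}.ncard * {w | w ≠ v ∧ ¬ G.Adj v w ∧ χ w = q}.ncard := by
    refine ncard_eq_mul_of_fiber (fun x hx => hx.1) fun w hw => ?_
    rw [← h.ncard_nonadj_eq hw]
    congr 1
    ext x
    simp only [Set.mem_ofPred_eq] at hw ⊢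
    exact ⟨fun h => ⟨h.2.2.1.symm, h.2.2.2, h.2.1⟩, fun h => ⟨hw, h.2.2, h.1.symm, h.2.1⟩⟩
  have p1 : pairsBetween {w | χ w = χ v} {w | χ w = q} ∩ G.edgeSet =
      {e | ∃ a b, χ a = χ v ∧ χ b = q ∧ a ≠ b ∧ G.Adj a b ∧ e = s(a, b)} := by
    ext e
    constructor
    · rintro ⟨⟨a, ha, b, hb, hab, rfl⟩, he⟩
      exact ⟨a, b, ha, hb, hab, he, rfl⟩
    · rintro ⟨a, b, ha, hb, hab, he, rfl⟩
      exact ⟨⟨a, ha, b, hb, hab, rfl⟩, he⟩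
  have p2 : pairsBetween {w | χ w = χ v} {w | χ w = q} \ G.edgeSet =
      {e | ∃ a b, χ a = χ v ∧ χ b = q ∧ a ≠ b ∧ ¬ G.Adj a b ∧ e = s(a, b)} := by
    ext e
    constructor
    · rintro ⟨⟨a, ha, b, hb, hab, rfl⟩, he⟩
      exact ⟨a, b, ha, hb, hab, he, rfl⟩
    · rintro ⟨a, b, ha, hb, hab, he, rfl⟩
      exact ⟨⟨a, ha, b, hb, hab, rfl⟩, he⟩
  have hpos : 0 < {x | χ x = χ v}.ncard := (Set.ncard_pos (Set.toFinite _)).mpr ⟨v, rfl⟩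
  have hM : s(χ v, q) ∈ majorityPairs χ G ↔
      {w | w ≠ v ∧ ¬ G.Adj v w ∧ χ w = q}.ncard < colorDegree χ G v q := by
    rw [mem_majorityPairs, p1, p2, ← Set.Finite.cast_ncard_eq (Set.toFinite _),
      ← Set.Finite.cast_ncard_eq (Set.toFinite _), Nat.cast_lt,
      ← Nat.mul_lt_mul_right hc, h1, h2, e1, e2, Nat.mul_lt_mul_left hpos]
  by_cases hm : s(χ v, q) ∈ majorityPairs χ G
  · have d1 := colorDegree_flipBy_of_mem (F := G) hm
    have d2 := colorDegree_flipBy_of_mem (F := flipBy χ (majorityPairs χ G) G) hm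
    rw [flipBy_flipBy] at d2
    rw [← d2]
    exact (hM.mp hm).le.trans' d1.le
  · have d1 := colorDegree_flipBy_of_notMem (F := G) hm
    rw [← colorDegree, d1, ncard_nonadj, d1, ← ncard_nonadj]
    exact not_lt.mp fun h => hm (hM.mpr h)

/-! ### Extending isomorphisms to leaf classes -/

/-- A color-preserving permutation that is an isomorphism on the vertices with color in `A`. -/
def IsoOn {V C : Type*} (χ : V → C) (A : Set C) (F F' : SimpleGraph V) (f : Equiv.Perm V) : Prop :=
  ColorPreserving χ f ∧ ∀ u v, χ u ∈ A → χ v ∈ A → (F.Adj u v ↔ F'.Adj (f u) (f v))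

/-- Vertices of color `p` have at most one neighbor with color in `A`. -/
def LeafClass {V C : Type*} (χ : V → C) (A : Set C) (F : SimpleGraph V) (p : C) : Prop :=
  ∀ v a b, χ v = p → χ a ∈ A → χ b ∈ A → F.Adj v a → F.Adj v b → a = b

section
variable {V C : Type*} {χ : V → C} {A : Set C} {F F' : SimpleGraph V}

theorem IsoOn.trans {F'' : SimpleGraph V} {f g : Equiv.Perm V} (hf : IsoOn χ A F F' f)
    (hg : IsoOn χ A F' F'' g) : IsoOn χ A F F'' (f.trans g) :=
  ⟨hf.1.trans hg.1, fun u v hu hv => (hf.2 u v hu hv).trans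
    (hg.2 _ _ (by rwa [hf.1]) (by rwa [hf.1]))⟩

theorem isoOn_refl (A : Set C) (F : SimpleGraph V) : IsoOn χ A F F (Equiv.refl V) :=
  ⟨.refl χ, fun _ _ _ _ => Iff.rfl⟩

theorem isoOn_of_involutive {f : Equiv.Perm V} (hf : ColorPreserving χ f) (hinv : ∀ v, f (f v) = v)
    (h : ∀ u v, χ u ∈ A → χ v ∈ A → F.Adj u v → F.Adj (f u) (f v)) : IsoOn χ A F F f := by
  refine ⟨hf, fun u v hu hv => ⟨h u v hu hv, fun h' => ?_⟩⟩
  have := h _ _ (by rwa [hf]) (by rwa [hf]) h'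
  rwa [hinv, hinv] at this

end

section
variable {V C : Type*} [Finite V] {χ : V → C} {A : Set C} {p : C} {F F' : SimpleGraph V}

theorem LeafClass.of_similar (hp : LeafClass χ A F p) (h : Similar χ F F') :
    LeafClass χ A F' p := by
  intro v a b hv ha hb hva hvb
  by_contra hne
  obtain ⟨a', b', h1, h2, h3, h4, h5⟩ := h.symm.exists_two_adj rfl hva hvb hne
  exact h3 (hp v a' b' hv (h4 ▸ ha) (h5 ▸ hb) h1 h2)

/-- Each vertex `v` of color `p` has exactly one neighbor `π v` with color in `insert p A`, and this
parent has the color of `u`. Equal degrees give a parent and its image under `f₀` equally many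
leaves, so the leaves can be mapped parent by parent. -/
theorem IsoOn.extend_of_parent (h : Similar χ F F') (hpA : p ∉ A)
    (hp : LeafClass χ (insert p A) F p) {f₀ : Equiv.Perm V} (hf₀ : IsoOn χ A F F' f₀)
    {l u : V} (hl : χ l = p) (hu : χ u ∈ A) (hlu : F.Adj l u) :
    ∃ f, IsoOn χ (insert p A) F F' f ∧ ∀ v, χ v ≠ p → f v = f₀ v := by
  classical
  have hp' := hp.of_similar h
  have hup : χ u ≠ p := fun h => hpA (h ▸ hu)
  have h1 : ∀ v, ∃ w, χ v = p → F.Adj v w ∧ χ w = χ u := fun v => by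
    by_cases hv : χ v = p
    · obtain ⟨w, hw⟩ := h.left.exists_adj (hl.trans hv.symm) hlu
      exact ⟨w, fun _ => hw⟩
    · exact ⟨v, fun h => (hv h).elim⟩
  have h2 : ∀ v, ∃ w, χ v = p → F'.Adj v w ∧ χ w = χ u := fun v => by
    by_cases hv : χ v = p
    · obtain ⟨w, hw⟩ := h.exists_adj (hl.trans hv.symm) hlu
      exact ⟨w, fun _ => hw⟩
    · exact ⟨v, fun h => (hv h).elim⟩
  choose π hπ using h1
  choose π' hπ' using h2
  have huniq : ∀ v w, χ v = p → χ w ∈ insert p A → (F.Adj v w ↔ w = π v) := fun v w hv hw =>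
    ⟨fun h => hp v w (π v) hv hw (Or.inr ((hπ v hv).2 ▸ hu)) h (hπ v hv).1,
      fun h => h ▸ (hπ v hv).1⟩
  have huniq' : ∀ v w, χ v = p → χ w ∈ insert p A → (F'.Adj v w ↔ w = π' v) := fun v w hv hw =>
    ⟨fun h => hp' v w (π' v) hv hw (Or.inr ((hπ' v hv).2 ▸ hu)) h (hπ' v hv).1,
      fun h => h ▸ (hπ' v hv).1⟩
  -- Leaves are sorted by the image of their parent. `Sum.inr` puts every other vertex into a fiber
  -- of its own, which forces the bijection to be `f₀` there.
  have hcount : ∀ k : V ⊕ V,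
      {v | (if χ v = p then Sum.inl (f₀ (π v)) else Sum.inr (f₀ v)) = k}.ncard =
      {v | (if χ v = p then Sum.inl (π' v) else Sum.inr v) = k}.ncard := by
    rintro (w | w)
    · by_cases hw : χ w = χ u
      · have hw' : χ (f₀.symm w) = χ u := by rw [hf₀.1.symm, hw]
        have e1 : {v | (if χ v = p then Sum.inl (f₀ (π v)) else Sum.inr (f₀ v)) =
            (Sum.inl w : V ⊕ V)} = {v | F.Adj (f₀.symm w) v ∧ χ v = p} := by
          ext v
          by_cases hv : χ v = p
          · simp only [Set.mem_ofPred_eq, hv, if_true, Sum.inl.injEq, and_true]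
            rw [F.adj_comm, huniq v _ hv (Or.inr (hw' ▸ hu)), Equiv.symm_apply_eq, eq_comm]
          · simp [hv]
        have e2 : {v | (if χ v = p then Sum.inl (π' v) else Sum.inr v) =
            (Sum.inl w : V ⊕ V)} = {v | F'.Adj w v ∧ χ v = p} := by
          ext v
          by_cases hv : χ v = p
          · simp only [Set.mem_ofPred_eq, hv, if_true, Sum.inl.injEq, and_true]
            rw [F'.adj_comm, huniq' v _ hv (Or.inr (hw ▸ hu)), eq_comm]
          · simp [hv]
        rw [e1, e2]
        exact h _ _ (hw'.trans hw.symm) p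
      · have e1 : {v | (if χ v = p then Sum.inl (f₀ (π v)) else Sum.inr (f₀ v)) =
            (Sum.inl w : V ⊕ V)} = ∅ := by
          ext v
          by_cases hv : χ v = p
          · simp only [Set.mem_ofPred_eq, hv, if_true, Sum.inl.injEq, Set.mem_empty_iff_false,
              iff_false]
            rintro rfl
            exact hw (by rw [hf₀.1, (hπ v hv).2])
          · simp [hv]
        have e2 : {v | (if χ v = p then Sum.inl (π' v) else Sum.inr v) =
            (Sum.inl w : V ⊕ V)} = ∅ := by
          ext v
          by_cases hv : χ v = p
          · simp only [Set.mem_ofPred_eq, hv, if_true, Sum.inl.injEq, Set.mem_empty_iff_false,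
              iff_false]
            rintro rfl
            exact hw (hπ' v hv).2
          · simp [hv]
        rw [e1, e2]
    · refine Set.ncard_congr (fun v _ => f₀ v) ?_ (fun a b _ _ h => f₀.injective h) ?_
      · intro v hv
        by_cases hvp : χ v = p
        · simp [hvp] at hv
        · simp only [Set.mem_ofPred_eq, hvp, if_false, hf₀.1 v] at hv ⊢
          exact hv
      · intro v hv
        refine ⟨f₀.symm v, ?_, by simp⟩
        by_cases hvp : χ v = p
        · simp [hvp] at hv
        · simp only [Set.mem_ofPred_eq, hvp, if_false, hf₀.1.symm v] at hv ⊢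
          simpa using hv
  obtain ⟨g, hg⟩ := exists_equiv_of_ncard_fiber_eq hcount
  have hg1 : ∀ v, χ v ≠ p → g v = f₀ v := by
    intro v hv
    have := hg v
    by_cases hgv : χ (g v) = p
    · simp [hv, hgv] at this
    · simpa [hv, hgv] using this
  have hg2 : ∀ v, χ v = p → χ (g v) = p ∧ π' (g v) = f₀ (π v) := by
    intro v hv
    have := hg v
    by_cases hgv : χ (g v) = p
    · exact ⟨hgv, by simpa [hv, hgv] using this⟩
    · simp [hv, hgv] at this
  have hgc : ColorPreserving χ g := by
    intro v
    by_cases hv : χ v = p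
    · rw [(hg2 v hv).1, hv]
    · rw [hg1 v hv, hf₀.1]
  have hmem : ∀ v, χ v ∈ insert p A → χ v ≠ p → χ v ∈ A := fun v h h' => h.resolve_left h'
  have key : ∀ v w, χ v = p → χ w ∈ insert p A → (F.Adj v w ↔ F'.Adj (g v) (g w)) := by
    intro v w hv hw
    rw [huniq v w hv hw, huniq' _ _ ((hgc v).trans hv) (by rwa [hgc]), (hg2 v hv).2]
    have hπp : χ (π v) ≠ p := by rw [(hπ v hv).2]; exact hup
    rw [← hg1 _ hπp, g.injective.eq_iff]
  refine ⟨g, ⟨hgc, fun v w hv hw => ?_⟩, hg1⟩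
  by_cases hvp : χ v = p
  · exact key v w hvp hw
  by_cases hwp : χ w = p
  · rw [F.adj_comm, F'.adj_comm]
    exact key w v hwp hv
  rw [hg1 v hvp, hg1 w hwp]
  exact hf₀.2 v w (hmem v hv hvp) (hmem w hw hwp)

/-- Both maps are products of disjoint transpositions with the same support, so they have the same
cycle type. -/
theorem exists_conj_of_involutive {P : Set V} {μ μ' : V → V} (h1 : ∀ v, μ (μ v) = v)
    (h2 : ∀ v, μ' (μ' v) = v) (h3 : ∀ v, μ v ≠ v ↔ v ∈ P) (h4 : ∀ v, μ' v ≠ v ↔ v ∈ P) :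
    ∃ g : Equiv.Perm V, ∀ v, g (μ v) = μ' (g v) := by
  classical
  have := Fintype.ofFinite V
  let m : Equiv.Perm V := Function.Involutive.toPerm μ h1
  let m' : Equiv.Perm V := Function.Involutive.toPerm μ' h2
  have hm : ∀ v, m v = μ v := fun v => rfl
  have hm' : ∀ v, m' v = μ' v := fun v => rfl
  have hsupp : m.support = m'.support := by
    ext v
    rw [Equiv.Perm.mem_support, Equiv.Perm.mem_support, hm, hm', h3, h4]
  have key : ∀ σ : Equiv.Perm V, σ ^ 2 = 1 → ∃ n, σ.cycleType = Multiset.replicate n 2 := by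
    intro σ hσ
    refine ⟨_, Multiset.eq_replicate_card.mpr fun n hn => ?_⟩
    have h5 := Equiv.Perm.dvd_of_mem_cycleType hn
    have h6 := Equiv.Perm.two_le_of_mem_cycleType hn
    have h7 := h5.trans (orderOf_dvd_of_pow_eq_one hσ)
    have := Nat.le_of_dvd (by norm_num) h7
    omega
  obtain ⟨n, hn⟩ := key m (by ext v; simp [sq, hm, h1])
  obtain ⟨n', hn'⟩ := key m' (by ext v; simp [sq, hm', h2])
  have hc := m.sum_cycleType
  have hc' := m'.sum_cycleType
  rw [hn, Multiset.sum_replicate, smul_eq_mul] at hc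
  rw [hn', Multiset.sum_replicate, ← hsupp, ← hc, smul_eq_mul] at hc'
  have hnn : n' = n := by omega
  have hconj : IsConj m m' := Equiv.Perm.isConj_iff_cycleType_eq.mpr (by rw [hn, hn', hnn])
  obtain ⟨g, hg⟩ := isConj_iff.mp hconj
  refine ⟨g, fun v => ?_⟩
  have := congrArg (fun σ : Equiv.Perm V => σ (g v)) hg
  simpa [hm, hm'] using this

/-- Here color `p` carries a perfect matching in both graphs. The two involutions exchanging
partners are conjugate, and a conjugating permutation, which maps the class to itself, is glued to
`f₀`. -/
theorem IsoOn.extend_of_matching (h : Similar χ F F')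
    (hp : LeafClass χ (insert p A) F p) {f₀ : Equiv.Perm V} (hf₀ : IsoOn χ A F F' f₀)
    {l u : V} (hl : χ l = p) (hu : χ u = p) (hlu : F.Adj l u) :
    ∃ f, IsoOn χ (insert p A) F F' f ∧ ∀ v, χ v ≠ p → f v = f₀ v := by
  classical
  have hp' := hp.of_similar h
  have main : ∀ K : SimpleGraph V, Similar χ F K → ∃ μ : V → V, (∀ v, μ (μ v) = v) ∧
      (∀ v, μ v ≠ v ↔ v ∈ {v | χ v = p}) ∧
      ∀ v w, χ v = p → χ w ∈ insert p A → (K.Adj v w ↔ w = μ v) := by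
    intro K hK
    have h1 : ∀ v, ∃ w, (χ v = p → K.Adj v w ∧ χ w = p) ∧ (χ v ≠ p → w = v) := fun v => by
      by_cases hv : χ v = p
      · obtain ⟨w, hw⟩ := hK.exists_adj (hl.trans hv.symm) hlu
        exact ⟨w, fun _ => ⟨hw.1, hw.2.trans hu⟩, fun h => (h hv).elim⟩
      · exact ⟨v, fun h => (hv h).elim, fun _ => rfl⟩
    choose μ h1 h2 using h1
    have huniq : ∀ v w, χ v = p → χ w ∈ insert p A → (K.Adj v w ↔ w = μ v) := fun v w hv hw =>
      ⟨fun h => (hp.of_similar hK) v w (μ v) hv hw (Or.inl (h1 v hv).2) h (h1 v hv).1,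
        fun h => h ▸ (h1 v hv).1⟩
    refine ⟨μ, fun v => ?_, fun v => ?_, huniq⟩
    · by_cases hv : χ v = p
      · exact ((huniq (μ v) v (h1 v hv).2 (Or.inl hv)).mp (h1 v hv).1.symm).symm
      · rw [h2 v hv, h2 v hv]
    · constructor
      · intro hne
        by_contra hv
        exact hne (h2 v hv)
      · exact fun hv => (h1 v hv).1.ne'
  obtain ⟨μ, m1, m2, m3⟩ := main F h.left
  obtain ⟨μ', m1', m2', m3'⟩ := main F' h
  obtain ⟨g, hg⟩ := exists_conj_of_involutive m1 m1' m2 m2'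
  have hgp : ∀ v, χ (g v) = p ↔ χ v = p := by
    intro v
    have e1 := m2 v
    have e2 := m2' (g v)
    simp only [Set.mem_ofPred_eq] at e1 e2
    rw [← e1, ← e2, ← hg, ne_eq, ne_eq, g.injective.eq_iff]
  have hinj : Function.Injective fun v => if χ v = p then g v else f₀ v := by
    intro a b hab
    simp only at hab
    split_ifs at hab with ha hb hb
    · exact g.injective hab
    · have := congrArg χ hab
      rw [(hgp a).mpr ha, hf₀.1] at this
      exact (hb this.symm).elim
    · have := congrArg χ hab
      rw [(hgp b).mpr hb, hf₀.1] at this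
      exact (ha this).elim
    · exact f₀.injective hab
  let f : Equiv.Perm V := Equiv.ofBijective _ (Finite.injective_iff_bijective.mp hinj)
  have hf1 : ∀ v, χ v = p → f v = g v := fun v hv => if_pos hv
  have hf2 : ∀ v, χ v ≠ p → f v = f₀ v := fun v hv => if_neg hv
  have hfc : ColorPreserving χ f := by
    intro v
    by_cases hv : χ v = p
    · rw [hf1 v hv, (hgp v).mpr hv, hv]
    · rw [hf2 v hv, hf₀.1]
  have hmem : ∀ v, χ v ∈ insert p A → χ v ≠ p → χ v ∈ A := fun v h h' => h.resolve_left h'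
  have key : ∀ v w, χ v = p → χ w ∈ insert p A → (F.Adj v w ↔ F'.Adj (f v) (f w)) := by
    intro v w hv hw
    rw [m3 v w hv hw, m3' _ _ ((hfc v).trans hv) (by rwa [hfc]), hf1 v hv, ← hg]
    have : χ (μ v) = p := (m2 _).mp (by rw [m1]; exact ((m2 v).mpr hv).symm)
    rw [← hf1 _ this, f.injective.eq_iff]
  refine ⟨f, ⟨hfc, fun v w hv hw => ?_⟩, hf2⟩
  by_cases hvp : χ v = p
  · exact key v w hvp hw
  by_cases hwp : χ w = p
  · rw [F.adj_comm, F'.adj_comm]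
    exact key w v hwp hv
  rw [hf2 v hvp, hf2 w hwp]
  exact hf₀.2 v w (hmem v hv hvp) (hmem w hw hwp)

theorem IsoOn.extend (h : Similar χ F F') (hpA : p ∉ A)
    (hp : LeafClass χ (insert p A) F p) {f₀ : Equiv.Perm V} (hf₀ : IsoOn χ A F F' f₀) :
    ∃ f, IsoOn χ (insert p A) F F' f ∧ ∀ v, χ v ≠ p → f v = f₀ v := by
  by_cases h1 : ∃ l u, χ l = p ∧ χ u ∈ insert p A ∧ F.Adj l u
  · obtain ⟨l, u, hl, hu | hu, hlu⟩ := h1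
    · exact hf₀.extend_of_matching h hp hl hu hlu
    · exact hf₀.extend_of_parent h hpA hp hl hu hlu
  · push Not at h1
    have h2 : ∀ l u, χ l = p → χ u ∈ insert p A → ¬ F'.Adj l u := by
      intro l u hl hu hlu
      obtain ⟨u', h3, h4⟩ := h.symm.exists_adj rfl hlu
      exact h1 l u' hl (h4 ▸ hu) h3
    refine ⟨f₀, ⟨hf₀.1, fun u v hu hv => ?_⟩, fun _ _ => rfl⟩
    rcases hu with hu | hu
    · exact iff_of_false (h1 u v hu hv) (h2 _ _ ((hf₀.1 u).trans hu) (by rwa [hf₀.1]))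
    rcases hv with hv | hv
    · rw [F.adj_comm, F'.adj_comm]
      exact iff_of_false (h1 v u hv (Or.inr hu))
        (h2 _ _ ((hf₀.1 v).trans hv) (by rw [hf₀.1]; exact Or.inr hu))
    · exact hf₀.2 u v hu hv

/-- Leaves of the same color with the same neighbors outside their class can be exchanged. -/
theorem exists_isoOn_apply_eq (h : Similar χ F F)
    (hp : LeafClass χ (insert p A) F p) {x y : V} (hx : χ x = p) (hy : χ y = p)
    (hxy : ∀ u, χ u ∈ A → (F.Adj x u ↔ F.Adj y u)) :
    ∃ f, IsoOn χ (insert p A) F F f ∧ (∀ v, χ v ≠ p → f v = v) ∧ f x = y := by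
  classical
  by_cases hex : ∃ x', χ x' = p ∧ F.Adj x x'
  -- In a matching class the partners have to be exchanged along with `x` and `y`. The cases `y = x`
  -- and `y = x'` are degenerate.
  · obtain ⟨x', hx', hxx'⟩ := hex
    obtain ⟨y', hyy', hy'⟩ := h.exists_adj (hx.trans hy.symm) hxx'
    rw [hx'] at hy'
    have ux : ∀ u, χ u ∈ insert p A → F.Adj x u → u = x' :=
      fun u hu hxu => hp x u x' hx hu (Or.inl hx') hxu hxx'
    have ux' : ∀ u, χ u ∈ insert p A → F.Adj x' u → u = x :=
      fun u hu hxu => hp x' u x hx' hu (Or.inl hx) hxu hxx'.symm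
    have uy : ∀ u, χ u ∈ insert p A → F.Adj y u → u = y' :=
      fun u hu hxu => hp y u y' hy hu (Or.inl hy') hxu hyy'
    have uy' : ∀ u, χ u ∈ insert p A → F.Adj y' u → u = y :=
      fun u hu hxu => hp y' u y hy' hu (Or.inl hy) hxu hyy'.symm
    have hne1 := hxx'.ne
    have hne2 := hyy'.ne
    by_cases e1 : y = x
    · subst e1
      exact ⟨Equiv.refl V, isoOn_refl _ _, fun _ _ => rfl, rfl⟩
    by_cases e2 : y = x'
    · subst e2
      have e3 : y' = x := ux' y' (Or.inl hy') hyy'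
      subst e3
      refine ⟨Equiv.swap y' y, isoOn_of_involutive (.swap (hx.trans hy.symm)) (by simp) ?_, ?_,
        by simp⟩
      · intro u v hu hv huv
        have a1 := ux u hu
        have a2 := ux' u hu
        have a3 := ux v hv
        have a4 := ux' v hv
        have := huv.symm
        simp only [Equiv.swap_apply_def]
        split_ifs <;> grind
      · intro v hv
        exact Equiv.swap_apply_of_ne_of_ne (fun h => hv (h ▸ hx)) (fun h => hv (h ▸ hy))
    · have e3 : y' ≠ x := by
        rintro rfl
        exact e2 (ux y (Or.inl hy) hyy'.symm)
      have e4 : y' ≠ x' := by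
        rintro rfl
        exact e1 (ux' y (Or.inl hy) hyy'.symm)
      have hval : ∀ v, (Equiv.swap x' y').trans (Equiv.swap x y) v =
          if v = x then y else if v = y then x else if v = x' then y' else
            if v = y' then x' else v := by
        intro v
        simp only [Equiv.trans_apply, Equiv.swap_apply_def]
        split_ifs <;> grind
      refine ⟨(Equiv.swap x' y').trans (Equiv.swap x y), isoOn_of_involutive
        ((ColorPreserving.swap (hx'.trans hy'.symm)).trans (.swap (hx.trans hy.symm))) ?_ ?_,
        ?_, ?_⟩
      · intro v
        simp only [hval]
        split_ifs <;> grind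
      · intro u v hu hv huv
        have a1 := ux u hu
        have a2 := ux' u hu
        have a3 := ux v hv
        have a4 := ux' v hv
        have b1 := uy u hu
        have b2 := uy' u hu
        have b3 := uy v hv
        have b4 := uy' v hv
        have := huv.symm
        have := hyy'.symm
        have := hxx'.symm
        simp only [hval]
        split_ifs <;> grind
      · intro v hv
        rw [hval]
        grind
      · simp [hval]
  · push Not at hex
    have hey : ∀ y', χ y' = p → ¬ F.Adj y y' := by
      intro y' hy' hyy'
      obtain ⟨x', h1, h2⟩ := h.exists_adj (hy.trans hx.symm) hyy'
      exact hex x' (h2.trans hy') h1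
    refine ⟨Equiv.swap x y, isoOn_of_involutive (.swap (hx.trans hy.symm)) (by simp) ?_, ?_,
      by simp⟩
    · have hall : ∀ u, χ u ∈ insert p A → (F.Adj x u ↔ F.Adj y u) := by
        rintro u (hu | hu)
        · exact iff_of_false (hex u hu) (hey u hu)
        · exact hxy u hu
      intro u v hu hv huv
      have a1 := hall u hu
      have a2 := hall v hv
      have c1 := huv.symm
      have b1 := hex u
      have b2 := hex v
      have b3 := hey u
      have b4 := hey v
      simp only [Equiv.swap_apply_def]
      split_ifs <;> grind [SimpleGraph.adj_comm]
    · intro v hv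
      exact Equiv.swap_apply_of_ne_of_ne (fun h => hv (h ▸ hx)) (fun h => hv (h ▸ hy))

end

/-! ### Stripping off leaf classes; orbits of equitable forests -/

section
variable {V C : Type*} [Finite V] {χ : V → C} {F F' : SimpleGraph V}

/-- By equitability a single leaf makes its whole color class consist of leaves. -/
theorem LeafClass.of_leaf (h : Similar χ F F) {A : Set C} {v : V}
    (hv : ∀ a b, χ a ∈ A → χ b ∈ A → F.Adj v a → F.Adj v b → a = b) :
    LeafClass χ A F (χ v) := by
  intro w a b hw ha hb hwa hwb
  by_contra hne
  obtain ⟨a', b', h1, h2, h3, h4, h5⟩ := h.exists_two_adj hw hwa hwb hne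
  exact h3 (hv a' b' (h4 ▸ ha) (h5 ▸ hb) h1 h2)

theorem ncard_colors_diff_lt {A : Set C} {v : V} (hv : χ v ∈ A) :
    {w | χ w ∈ A \ {χ v}}.ncard < {w | χ w ∈ A}.ncard := by
  refine Set.ncard_lt_ncard ⟨fun w hw => hw.1, fun h => ?_⟩ (Set.toFinite _)
  exact (h (show v ∈ {w | χ w ∈ A} from hv)).2 rfl

/-- An isomorphism on a set of color classes extends if all other classes can be removed
successively as classes of leaves. -/
theorem exists_isoOn_extending (h : Similar χ F F') {A₀ : Set C}
    (hpeel : ∀ A, A₀ ⊆ A → (∃ v, χ v ∈ A \ A₀) → ∃ v, χ v ∈ A \ A₀ ∧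
      ∀ a b, χ a ∈ A → χ b ∈ A → F.Adj v a → F.Adj v b → a = b)
    {f₀ : Equiv.Perm V} (hf₀ : IsoOn χ A₀ F F' f₀) :
    ∀ A, A₀ ⊆ A → ∃ f, IsoOn χ A F F' f ∧ ∀ v, χ v ∈ A₀ → f v = f₀ v := by
  intro A
  induction hn : {w | χ w ∈ A}.ncard using Nat.strong_induction_on generalizing A with
  | _ n ih =>
  intro hA
  by_cases hex : ∃ v, χ v ∈ A \ A₀
  · obtain ⟨v, hv, hleaf⟩ := hpeel A hA hex
    have hsub : A₀ ⊆ A \ {χ v} := fun c hc => ⟨hA hc, fun h => hv.2 (h ▸ hc)⟩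
    obtain ⟨f, hf, hf'⟩ := ih _ (hn ▸ ncard_colors_diff_lt hv.1) (A \ {χ v}) rfl hsub
    have hins : insert (χ v) (A \ {χ v}) = A := by
      rw [Set.insert_sdiff_singleton, Set.insert_eq_of_mem hv.1]
    obtain ⟨g, hg, hg'⟩ := hf.extend h (p := χ v) (fun h => h.2 rfl)
      (by rw [hins]; exact .of_leaf h.left hleaf)
    rw [hins] at hg
    refine ⟨g, hg, fun w hw => ?_⟩
    rw [hg' w (fun h => hv.2 (h ▸ hw)), hf' w hw]
  · push Not at hex
    refine ⟨f₀, ⟨hf₀.1, fun u v hu hv => hf₀.2 u v ?_ ?_⟩, fun _ _ => rfl⟩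
    · by_contra hc; exact hex u ⟨hu, hc⟩
    · by_contra hc; exact hex v ⟨hv, hc⟩

/-- Induction on the number of vertices with color in `A`, removing a leaf class. If `x` and `y` lie
outside it, the isomorphism found for the rest extends. If they are leaves with parents, an
isomorphism takes parent to parent, and leaves at one parent can be exchanged; leaves without
parents are exchanged directly. -/
theorem exists_isoOn_of_isAcyclic (hF : F.IsAcyclic) (h : Similar χ F F) :
    ∀ (A : Set C) x y, χ x = χ y → χ x ∈ A → ∃ f, IsoOn χ A F F f ∧ f x = y := by
  intro A
  induction hn : {w | χ w ∈ A}.ncard using Nat.strong_induction_on generalizing A with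
  | _ n ih =>
  intro x y hxy hxA
  obtain ⟨v, hv, hleaf⟩ := exists_leaf_of_isAcyclic hF (Y := {w | χ w ∈ A}) ⟨x, hxA⟩
  have hleaf' : LeafClass χ A F (χ v) := .of_leaf h fun a b ha hb => hleaf a ha b hb
  change χ v ∈ A at hv
  have hins : insert (χ v) (A \ {χ v}) = A := by
    rw [Set.insert_sdiff_singleton, Set.insert_eq_of_mem hv]
  have IH := ih _ (hn ▸ ncard_colors_diff_lt hv) (A \ {χ v}) rfl
  have hnot : χ v ∉ A \ {χ v} := fun h => h.2 rfl
  have hleaf'' : LeafClass χ (insert (χ v) (A \ {χ v})) F (χ v) := by rwa [hins]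
  by_cases hxv : χ x = χ v
  · by_cases hu : ∃ u, χ u ∈ A \ {χ v} ∧ F.Adj x u
    · obtain ⟨u, hu, hxu⟩ := hu
      obtain ⟨u', hyu', hu'⟩ := h.exists_adj hxy hxu
      obtain ⟨f₀, hf₀, hf₀u⟩ := IH u u' hu'.symm hu
      obtain ⟨f, hf, hff⟩ := hf₀.extend h hnot hleaf''
      have hfu : f u = u' := by rw [hff u (fun h => hu.2 h), hf₀u]
      have hfx : F.Adj (f x) u' := by
        rw [← hfu]
        exact (hf.2 x u (Or.inl hxv) (Or.inr hu)).mp hxu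
      have hfxc : χ (f x) = χ v := (hf.1 x).trans hxv
      obtain ⟨g, hg, -, hgx⟩ := exists_isoOn_apply_eq h hleaf'' hfxc (hxy.symm.trans hxv)
        (by
          intro w hw
          constructor
          · intro hw'
            rw [hleaf'' _ w u' hfxc (Or.inr hw) (Or.inr (hu' ▸ hu)) hw' hfx]
            exact hyu'
          · intro hw'
            rw [hleaf'' _ w u' (hxy.symm.trans hxv) (Or.inr hw) (Or.inr (hu' ▸ hu)) hw' hyu']
            exact hfx)
      rw [hins] at hf hg
      exact ⟨f.trans g, hf.trans hg, hgx⟩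
    · push Not at hu
      obtain ⟨g, hg, -, hgx⟩ := exists_isoOn_apply_eq h hleaf'' hxv (hxy.symm.trans hxv)
        (by
          intro w hw
          refine iff_of_false (hu w hw) fun hyw => ?_
          obtain ⟨w', h1, h2⟩ := h.exists_adj hxy.symm hyw
          exact hu w' (h2 ▸ hw) h1)
      rw [hins] at hg
      exact ⟨g, hg, hgx⟩
  · obtain ⟨f₀, hf₀, hf₀x⟩ := IH x y hxy ⟨hxA, hxv⟩
    obtain ⟨f, hf, hff⟩ := hf₀.extend h hnot hleaf''
    rw [hins] at hf
    exact ⟨f, hf, by rw [hff x hxv, hf₀x]⟩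

/-- A color-preserving automorphism. -/
def IsAut {V C : Type*} (χ : V → C) (F : SimpleGraph V) (f : Equiv.Perm V) : Prop :=
  ColorPreserving χ f ∧ ∀ u v, F.Adj u v ↔ F.Adj (f u) (f v)

theorem exists_isAut_of_isAcyclic (hF : F.IsAcyclic) (h : Similar χ F F) {x y : V}
    (hxy : χ x = χ y) : ∃ f, IsAut χ F f ∧ f x = y := by
  obtain ⟨f, hf, hfx⟩ := exists_isoOn_of_isAcyclic hF h Set.univ x y hxy trivial
  exact ⟨f, ⟨hf.1, fun u v => hf.2 u v trivial trivial⟩, hfx⟩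

end

theorem IsAut.reachable_iff {V C : Type*} {χ : V → C} {F : SimpleGraph V} {f : Equiv.Perm V}
    (hf : IsAut χ F f) {u v : V} : F.Reachable (f u) (f v) ↔ F.Reachable u v :=
  Iso.reachable_iff (φ := (⟨f, fun {a b} => (hf.2 a b).symm⟩ : F ≃g F))

theorem mem_of_reachable {V : Type*} {G : SimpleGraph V} {S : Set V}
    (hS : ∀ u v, u ∈ S → G.Adj u v → v ∈ S) {u v : V} (h : G.Reachable u v) (hu : u ∈ S) :
    v ∈ S := by
  obtain ⟨p⟩ := h
  induction p with
  | nil => exact hu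
  | cons hadj _ ih => exact ih (hS _ _ hu hadj)

/-- Adding edges that are the only connections of some set to the rest preserves acyclicity. -/
theorem isAcyclic_of_pendant {V : Type*} {H K : SimpleGraph V} (hH : H.IsAcyclic)
    (hpend : ∀ x u, K.Adj x u → ¬ H.Adj x u → ∃ S : Set V, ∃ y z, s(y, z) = s(x, u) ∧ y ∈ S ∧
      z ∉ S ∧ ∀ a b, K.Adj a b → a ∈ S → b ∉ S → s(a, b) = s(x, u)) : K.IsAcyclic := by
  intro v c hc
  by_cases hall : ∀ e ∈ c.edges, e ∈ H.edgeSet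
  · exact hH _ (hc.transfer hall)
  push Not at hall
  obtain ⟨e, he, heH⟩ := hall
  induction e with
  | h x u =>
  have hadj : K.Adj x u := c.adj_of_mem_edges he
  obtain ⟨S, y, z, hyz, hy, hz, hS⟩ := hpend x u hadj heH
  -- A new edge is the only edge of `K` leaving `S`. It is therefore a bridge and lies on no cycle.
  have hb : K.IsBridge s(y, z) := by
    rw [isBridge_iff]
    intro hr
    refine hz (mem_of_reachable (S := S) (fun a b ha hab => ?_) hr hy)
    by_contra hb
    rw [deleteEdges_adj] at hab
    exact hab.2 (by rw [hyz]; exact hS a b hab.1 ha hb)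
  exact hb.notMem_edges_of_isCycle hc (hyz ▸ he)

/-- The edges between vertices with colors in `A`. -/
def colorRestrict {V C : Type*} (χ : V → C) (A : Set C) (F : SimpleGraph V) : SimpleGraph V where
  Adj v w := F.Adj v w ∧ χ v ∈ A ∧ χ w ∈ A
  symm := ⟨fun _ _ h => ⟨h.1.symm, h.2.2, h.2.1⟩⟩
  loopless := ⟨fun _ h => F.irrefl h.1⟩

/-! ### Sparse equitable forests -/

section
variable {V C : Type*} [Finite V] {χ : V → C} {F : SimpleGraph V}

theorem Sparse.exists_ne (h : Sparse χ F) {v a : V} (hva : F.Adj v a) :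
    ∃ w, w ≠ v ∧ ¬ F.Adj v w ∧ χ w = χ a := by
  have h1 : 0 < {w | F.Adj v w ∧ χ w = χ a}.ncard :=
    (Set.ncard_pos (Set.toFinite _)).mpr ⟨a, hva, rfl⟩
  exact (Set.ncard_pos (Set.toFinite _)).mp (h1.trans_le (h v (χ a)))

theorem Sparse.exists_ne_same_color (h : Sparse χ F) {v a : V} (hva : F.Adj v a) :
    ∃ w, w ≠ v ∧ χ w = χ v := by
  obtain ⟨w, -, h1, h2⟩ := h.exists_ne hva.symm
  exact ⟨w, fun h => h1 (h ▸ hva.symm), h2⟩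

/-- A connected union of classes stays connected when a leaf class is removed: the map `ret`
retracts leaves to their parents. Once a single class is left, connectedness allows only one vertex
or one edge, and sparseness excludes both. -/
theorem false_of_preconnected_colorRestrict (hF : F.IsAcyclic) (h : Similar χ F F)
    (hs : Sparse χ F) :
    ∀ A : Set C, (∃ v, χ v ∈ A) → (∀ v, χ v ∈ A → ∃ w, F.Adj v w) →
      (∀ u v, χ u ∈ A → χ v ∈ A → (colorRestrict χ A F).Reachable u v) → False := by
  intro A
  induction hn : {w | χ w ∈ A}.ncard using Nat.strong_induction_on generalizing A with
  | _ n ih =>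
  intro hA hdeg hconn
  obtain ⟨v, hv, hleaf⟩ := exists_leaf_of_isAcyclic hF (Y := {w | χ w ∈ A}) hA
  change χ v ∈ A at hv
  have hleaf' : LeafClass χ A F (χ v) := .of_leaf h fun a b ha hb => hleaf a ha b hb
  by_cases hall : ∃ u₀, χ u₀ ∈ A ∧ χ u₀ ≠ χ v
  · obtain ⟨u₀, hu₀, hu₀v⟩ := hall
    have hcross : ∃ l u, χ l = χ v ∧ F.Adj l u ∧ χ u ∈ A ∧ χ u ≠ χ v := by
      by_contra! hcon
      refine hu₀v (mem_of_reachable (S := {w | χ w = χ v}) (fun a b ha hab => ?_)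
        (hconn v u₀ hv hu₀) rfl)
      exact hcon a b ha hab.1 hab.2.2
    obtain ⟨l, u, hl, hlu, huA, huv⟩ := hcross
    have hpar : ∀ w, ∃ w', χ w = χ v → F.Adj w w' ∧ χ w' = χ u := by
      intro w
      by_cases hw : χ w = χ v
      · obtain ⟨w', hw'⟩ := h.exists_adj (hl.trans hw.symm) hlu
        exact ⟨w', fun _ => hw'⟩
      · exact ⟨w, fun h => (hw h).elim⟩
    classical
    choose π hπ using hpar
    let ret : V → V := fun w => if χ w = χ v then π w else w
    have hret : ∀ w, χ w ≠ χ v → ret w = w := fun w hw => if_neg hw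
    have hret' : ∀ a b, (colorRestrict χ A F).Adj a b → χ a = χ v → ret a = b ∧ χ b ≠ χ v := by
      intro a b hab ha
      have : π a = b := hleaf' a _ _ ha ((hπ a ha).2 ▸ huA) hab.2.2 (hπ a ha).1 hab.1
      refine ⟨(if_pos ha).trans this, ?_⟩
      rw [← this, (hπ a ha).2]
      exact huv
    refine ih _ (hn ▸ ncard_colors_diff_lt hv) (A \ {χ v}) rfl ⟨u₀, hu₀, hu₀v⟩
      (fun w hw => hdeg w hw.1) fun a b ha hb => ?_
    have hstep : ∀ a b, (colorRestrict χ A F).Adj a b →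
        (colorRestrict χ (A \ {χ v}) F).Reachable (ret a) (ret b) := by
      intro a b hab
      by_cases hac : χ a = χ v
      · obtain ⟨h1, h2⟩ := hret' a b hab hac
        rw [h1, hret b h2]
      by_cases hbc : χ b = χ v
      · obtain ⟨h1, h2⟩ := hret' b a hab.symm hbc
        rw [h1, hret a h2]
      rw [hret a hac, hret b hbc]
      exact (show (colorRestrict χ (A \ {χ v}) F).Adj a b from
        ⟨hab.1, ⟨hab.2.1, hac⟩, ⟨hab.2.2, hbc⟩⟩).reachable
    have := mem_of_reachable
      (S := {x | (colorRestrict χ (A \ {χ v}) F).Reachable (ret a) (ret x)})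
      (fun x y hx hxy => Reachable.trans hx (hstep x y hxy)) (hconn a b ha.1 hb.1)
      (Reachable.refl _)
    rw [Set.mem_ofPred_eq, hret a ha.2, hret b hb.2] at this
    exact this
  · push Not at hall
    by_cases hnb : ∃ a, χ a ∈ A ∧ F.Adj v a
    · obtain ⟨a, ha, hva⟩ := hnb
      obtain ⟨w, hw1, hw2, hw3⟩ := hs.exists_ne hva
      have hw : w ∈ ({v, a} : Set V) := by
        refine mem_of_reachable (fun x y hx hxy => ?_)
          (hconn v w hv (by rw [hw3]; exact ha)) (Set.mem_insert _ _)
        rcases hx with rfl | rfl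
        · exact Or.inr (hleaf y hxy.2.2 a ha hxy.1 hva)
        · exact Or.inl (hleaf' x y v (hall x ha) hxy.2.2 hv hxy.1 hva.symm)
      rcases hw with rfl | rfl
      · exact hw1 rfl
      · exact hw2 hva
    -- Now `v` is isolated within `A`, but it has a neighbor elsewhere, so sparseness yields a
    -- second vertex of its color.
    · push Not at hnb
      obtain ⟨u, hvu⟩ := hdeg v hv
      obtain ⟨w, hw1, hw2⟩ := hs.exists_ne_same_color hvu
      have hw : w ∈ ({v} : Set V) := by
        refine mem_of_reachable (fun x y hx hxy => ?_)
          (hconn v w hv (by rw [hw2]; exact hv)) rfl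
        obtain rfl : x = v := hx
        exact (hnb y hxy.2.2 hxy.1).elim
      exact hw1 hw

/-- In a sparse equitable forest, no component contains a color class with several vertices. -/
theorem exists_not_reachable (hF : F.IsAcyclic) (h : Similar χ F F) (hs : Sparse χ F) {x y : V}
    (hxy : χ y = χ x) (hne : y ≠ x) : ∃ z, χ z = χ x ∧ ¬ F.Reachable x z := by
  by_contra! hcon
  -- The component of `x` would be a union of color classes: an automorphism taking `u` to `v` moves
  -- `x` to a vertex of the same color, which `hcon` places in the component.
  have hclosed : ∀ u v, F.Reachable x u → χ v = χ u → F.Reachable x v := by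
    intro u v hu hvu
    obtain ⟨f, hf, rfl⟩ := exists_isAut_of_isAcyclic hF h hvu.symm
    have h1 : F.Reachable (f x) (f u) := hf.reachable_iff.mpr hu
    exact (hcon (f x) (hf.1 x)).trans h1
  have hmem : ∀ v, χ v ∈ χ '' {u | F.Reachable x u} → F.Reachable x v := by
    rintro v ⟨u, hu, huv⟩
    exact hclosed u v hu huv.symm
  refine false_of_preconnected_colorRestrict hF h hs (χ '' {u | F.Reachable x u})
    ⟨x, x, Reachable.refl _, rfl⟩ ?_ ?_
  · intro v hv
    have h1 := hmem v hv
    by_contra! hcon'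
    have h2 : ∀ w, F.Reachable v w → w = v := fun w hw => mem_of_reachable (S := {v})
      (fun a b ha hab => ((hcon' b) ((show a = v from ha) ▸ hab)).elim) hw rfl
    have h3 := h2 x h1.symm
    have h4 := h2 y (h1.symm.trans (hcon y hxy))
    exact hne (h4.trans h3.symm)
  · intro u v hu hv
    have key : ∀ w, F.Reachable x w →
        (colorRestrict χ (χ '' {u | F.Reachable x u}) F).Reachable x w := by
      intro w hw
      have := mem_of_reachable (S := {w | F.Reachable x w ∧
        (colorRestrict χ (χ '' {u | F.Reachable x u}) F).Reachable x w}) (fun a b ha hab => ?_)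
        hw ⟨Reachable.refl _, Reachable.refl _⟩
      · exact this.2
      · have hb := ha.1.trans hab.reachable
        exact ⟨hb, ha.2.trans (Adj.reachable ⟨hab, ⟨a, ha.1, rfl⟩, ⟨b, hb, rfl⟩⟩)⟩
    exact (key u (hmem u hu)).symm.trans (key v (hmem v hv))

end

/-! ### Replacing the edges between two color classes -/

open Classical in
/-- The graph that agrees with `R` between the two color classes given by `t` and with `F`
elsewhere. -/
def replaceAt {V C : Type*} (χ : V → C) (t : Sym2 C) (F R : SimpleGraph V) : SimpleGraph V where
  Adj u v := if s(χ u, χ v) = t then R.Adj u v else F.Adj u v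
  symm := ⟨fun u v h => by
    rw [Sym2.eq_swap, R.adj_comm, F.adj_comm]; exact h⟩
  loopless := ⟨fun v h => by
    split_ifs at h
    · exact R.irrefl h
    · exact F.irrefl h⟩

/-- The graphs `F` and `R` have the same degrees between the two color classes given by `t`. -/
def SimilarAt {V C : Type*} (χ : V → C) (t : Sym2 C) (F R : SimpleGraph V) : Prop :=
  ∀ v w q, χ v = χ w → s(χ v, q) = t → colorDegree χ F v q = colorDegree χ R w q

section
variable {V C : Type*} {χ : V → C} {t : Sym2 C} {F R R' : SimpleGraph V}

theorem SimilarAt.similar (h : Similar χ F F) (hR : SimilarAt χ t F R) :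
    Similar χ F (replaceAt χ t F R) := by
  intro v w hvw q
  by_cases hq : s(χ v, q) = t
  · rw [hR v w q hvw hq]
    unfold colorDegree
    congr 1
    ext x
    refine and_congr_left fun hx => ?_
    simp only [replaceAt]
    rw [if_pos (by rw [hx, ← hvw, hq])]
  · rw [h v w hvw q]
    unfold colorDegree
    congr 1
    ext x
    refine and_congr_left fun hx => ?_
    simp only [replaceAt]
    rw [if_neg (by rw [hx, ← hvw]; exact hq)]

/-- Automorphisms of the edges not between the two color classes given by `t`. -/
def IsAutOff {V C : Type*} (χ : V → C) (t : Sym2 C) (F : SimpleGraph V) (f : Equiv.Perm V) : Prop :=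
  ColorPreserving χ f ∧ ∀ u v, s(χ u, χ v) ≠ t → (F.Adj u v ↔ F.Adj (f u) (f v))

theorem IsAutOff.symm {f : Equiv.Perm V} (hf : IsAutOff χ t F f) : IsAutOff χ t F f.symm := by
  refine ⟨hf.1.symm, fun u v h => ?_⟩
  have := hf.2 (f.symm u) (f.symm v) (by rwa [hf.1.symm, hf.1.symm])
  simpa using this.symm

theorem IsAutOff.trans {f g : Equiv.Perm V} (hf : IsAutOff χ t F f) (hg : IsAutOff χ t F g) :
    IsAutOff χ t F (f.trans g) :=
  ⟨hf.1.trans hg.1, fun u v h => (hf.2 u v h).trans (hg.2 _ _ (by rwa [hf.1, hf.1]))⟩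

theorem Rigid.exists_isAutOff (hr : Rigid χ F) (h : Similar χ F F) (hR : SimilarAt χ t F R) :
    ∃ f, IsAutOff χ t F f ∧ ∀ u v, s(χ u, χ v) = t → (F.Adj u v ↔ R.Adj (f u) (f v)) := by
  obtain ⟨f, hf, hf'⟩ := hr _ (hR.similar h)
  refine ⟨f, ⟨hf, fun u v huv => ?_⟩, fun u v huv => ?_⟩
  · rw [hf' u v]
    simp only [replaceAt]
    rw [if_neg (by rwa [hf, hf])]
  · rw [hf' u v]
    simp only [replaceAt]
    rw [if_pos (by rwa [hf, hf])]

/-- Inserted into `F`, both realizations give graphs similar to `F` and hence isomorphic to it.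
Later arguments use rigidity in this form: no count invariant under automorphisms of the rest can
distinguish `R` from `R'`. -/
theorem Rigid.exists_isAutOff_of_similarAt (hr : Rigid χ F) (h : Similar χ F F)
    (hR : SimilarAt χ t F R) (hR' : SimilarAt χ t F R') :
    ∃ f, IsAutOff χ t F f ∧ ∀ u v, s(χ u, χ v) = t → (R.Adj u v ↔ R'.Adj (f u) (f v)) := by
  obtain ⟨f, hf, hf'⟩ := hr.exists_isAutOff h hR
  obtain ⟨g, hg, hg'⟩ := hr.exists_isAutOff h hR'
  refine ⟨f.symm.trans g, hf.symm.trans hg, fun u v huv => ?_⟩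
  have h1 := hf' (f.symm u) (f.symm v) (by rwa [hf.1.symm, hf.1.symm])
  have h2 := hg' (f.symm u) (f.symm v) (by rwa [hf.1.symm, hf.1.symm])
  simp only [Equiv.apply_symm_apply] at h1
  exact h1.symm.trans h2

/-- Replace the edges `xu`, `yv` by the edges `xv`, `yu`. -/
def switch {V : Type*} (R : SimpleGraph V) (x u y v : V) : SimpleGraph V :=
  fromEdgeSet ((R.edgeSet \ {s(x, u), s(y, v)}) ∪ {s(x, v), s(y, u)})

theorem switch_adj {R : SimpleGraph V} {x u y v a b : V} :
    (switch R x u y v).Adj a b ↔ ((R.Adj a b ∧ s(a, b) ≠ s(x, u) ∧ s(a, b) ≠ s(y, v)) ∨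
      s(a, b) = s(x, v) ∨ s(a, b) = s(y, u)) ∧ a ≠ b := by
  simp only [switch, fromEdgeSet_adj, Set.mem_union, Set.mem_sdiff, mem_edgeSet,
    Set.mem_insert_iff, Set.mem_singleton_iff, not_or, ne_eq]

theorem colorDegree_switch [Finite V] {R : SimpleGraph V} {x u y v : V} (hxu : R.Adj x u)
    (hyv : R.Adj y v) (hxv : ¬ R.Adj x v) (hyu : ¬ R.Adj y u) (h1 : x ≠ v) (h2 : y ≠ u)
    (hxy : χ x = χ y) (huv : χ u = χ v) (a : V) (q : C) :
    colorDegree χ (switch R x u y v) a q = colorDegree χ R a q := by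
  classical
  have hxu' := hxu.symm
  have hyv' := hyv.symm
  have hxv' : ¬ R.Adj v x := fun h => hxv h.symm
  have hyu' : ¬ R.Adj u y := fun h => hyu h.symm
  have n1 := hxu.ne
  have n2 := hyv.ne
  -- The new neighborhood of `a` is the old one with two vertices of equal color exchanged, namely
  -- `u, v` if `a` is `x` or `y`, and `x, y` if `a` is `u` or `v`.
  have key : ∃ τ : Equiv.Perm V, ColorPreserving χ τ ∧
      ∀ b, (switch R x u y v).Adj a b ↔ R.Adj a (τ b) := by
    by_cases c1 : a = x ∨ a = y
    · refine ⟨Equiv.swap u v, .swap huv, fun b => ?_⟩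
      rw [switch_adj]
      simp only [ne_eq, Sym2.eq_iff, Equiv.swap_apply_def]
      have := R.irrefl (v := a)
      split_ifs <;> grind
    by_cases c2 : a = u ∨ a = v
    · refine ⟨Equiv.swap x y, .swap hxy, fun b => ?_⟩
      rw [switch_adj]
      simp only [ne_eq, Sym2.eq_iff, Equiv.swap_apply_def]
      have := R.irrefl (v := a)
      split_ifs <;> grind
    · refine ⟨Equiv.refl V, .refl χ, fun b => ?_⟩
      rw [switch_adj]
      simp only [ne_eq, Sym2.eq_iff, Equiv.refl_apply]
      have := R.irrefl (v := a)
      grind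
  obtain ⟨τ, hτ, hτ'⟩ := key
  refine Set.ncard_congr (fun b _ => τ b) ?_ (fun b c _ _ h => τ.injective h) ?_
  · intro b hb
    exact ⟨(hτ' b).mp hb.1, (hτ b).trans hb.2⟩
  · intro b hb
    exact ⟨τ.symm b, ⟨(hτ' _).mpr (by simpa using hb.1), (hτ.symm b).trans hb.2⟩, by simp⟩

/-- Two vertices of color `p` that have the same other neighbors of color `q`. -/
def TwinsAt {V C : Type*} (χ : V → C) (p q : C) (R : SimpleGraph V) (y y' : V) : Prop :=
  χ y = p ∧ χ y' = p ∧ y ≠ y' ∧ ∀ w, χ w = q → w ≠ y → w ≠ y' → (R.Adj y w ↔ R.Adj y' w)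

theorem TwinsAt.symm {p q : C} {y y' : V} (h : TwinsAt χ p q R y y') : TwinsAt χ p q R y' y :=
  ⟨h.2.1, h.1, h.2.2.1.symm, fun w hw h1 h2 => (h.2.2.2 w hw h2 h1).symm⟩

/-- A rigid graph has no realization with a complete component between two classes
and an edge outside. -/
theorem Rigid.false_of_block [Finite V] (hr : Rigid χ F) (h : Similar χ F F) {p q : C}
    (hR : SimilarAt χ s(p, q) F R) {K : Set V}
    (hK : ∀ y w, χ y = p → χ w = q → y ∈ K → w ∈ K → y ≠ w → R.Adj y w)
    (hK' : ∀ y w, χ y = p → χ w = q → R.Adj y w → (y ∈ K ↔ w ∈ K)) {x x' u u' y v : V}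
    (hx : χ x = p) (hx' : χ x' = p) (hu : χ u = q) (hu' : χ u' = q) (hxK : x ∈ K) (hxK' : x' ∈ K)
    (huK : u ∈ K) (huK' : u' ∈ K) (n1 : x ≠ x') (n2 : u ≠ u') (n3 : x ≠ u) (n4 : x ≠ u')
    (hy : χ y = p) (hv : χ v = q) (hyK : y ∉ K) (hvK : v ∉ K) (hyv : R.Adj y v) :
    False := by
  have hxu : R.Adj x u := hK x u hx hu hxK huK n3
  have hxv : ¬ R.Adj x v := fun h => hvK ((hK' x v hx hv h).mp hxK)
  have hyu : ¬ R.Adj y u := fun h => hyK ((hK' y u hy hu h).mpr huK)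
  have n6 : x ≠ v := fun h => hvK (h ▸ hxK)
  have n7 : y ≠ u := fun h => hyK (h ▸ huK)
  have n8 := hyv.ne
  -- Trading the block edge `xu` and the outer edge `yv` for `xv` and `yu` gives another
  -- realization. It turns out to have fewer pairs of twins.
  have hsw : SimilarAt χ s(p, q) F (switch R x u y v) := by
    intro a b c hab hc
    rw [colorDegree_switch hxu hyv hxv hyu n6 n7 (hx.trans hy.symm) (hu.trans hv.symm)]
    exact hR a b c hab hc
  set R₁ := switch R x u y v with hR₁
  have adj : ∀ a b, R₁.Adj a b ↔ ((R.Adj a b ∧ ¬ (a = x ∧ b = u ∨ a = u ∧ b = x) ∧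
      ¬ (a = y ∧ b = v ∨ a = v ∧ b = y)) ∨ (a = x ∧ b = v ∨ a = v ∧ b = x) ∨
        (a = y ∧ b = u ∨ a = u ∧ b = y)) := by
    intro a b
    rw [hR₁, switch_adj]
    simp only [ne_eq, Sym2.eq_iff]
    have := R.irrefl (v := a)
    grind
  have hcross : ∀ a b, χ a = p → χ b = q → a ∈ K → b ∉ K → ¬ R.Adj a b :=
    fun a b ha hb haK hbK hab => hbK ((hK' a b ha hb hab).mp haK)
  have hcross' : ∀ a b, χ a = p → χ b = q → a ∉ K → b ∈ K → ¬ R.Adj a b :=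
    fun a b ha hb haK hbK hab => haK ((hK' a b ha hb hab).mpr hbK)
  -- None of the four switched vertices has a twin in `R₁`. A candidate on the same side of `K` is
  -- refuted by the new edge across the border, a candidate on the other side by a further vertex of
  -- `K`.
  have tx : ∀ z, ¬ TwinsAt χ p q R₁ x z := by
    rintro z ⟨-, hz, hne, htw⟩
    by_cases hzK : z ∈ K
    · have h1 := htw v hv n6.symm (fun h => hvK (h ▸ hzK))
      have h2 := hcross z v hz hv hzK hvK
      rw [adj, adj] at h1
      grind
    · have h1 := htw u' hu' n4.symm (fun h => hzK (h ▸ huK'))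
      have h2 := hcross' z u' hz hu' hzK huK'
      have h3 := hK x u' hx hu' hxK huK' n4
      rw [adj, adj] at h1
      grind
  have tu : ∀ z, ¬ TwinsAt χ p q R₁ u z := by
    rintro z ⟨hup, hz, hne, htw⟩
    have hpq : p = q := hup.symm.trans hu
    by_cases hzK : z ∈ K
    · have h1 := htw y (hy.trans hpq) n7 (fun h => hyK (h ▸ hzK))
      have h2 := hcross z y hz (hy.trans hpq) hzK hyK
      rw [adj, adj] at h1
      grind
    · have h1 := htw u' hu' n2.symm (fun h => hzK (h ▸ huK'))
      have h2 := hcross' z u' hz hu' hzK huK'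
      have h3 := hK u u' hup hu' huK huK' n2
      rw [adj, adj] at h1
      grind
  have ty : ∀ z, ¬ TwinsAt χ p q R₁ y z := by
    intro z htz
    have hzx : z ≠ x := fun h => tx y (h ▸ htz.symm)
    have hzu : z ≠ u := fun h => tu y (h ▸ htz.symm)
    obtain ⟨-, hz, hne, htw⟩ := htz
    by_cases hzK : z ∈ K
    · obtain ⟨w, hw, hwK, hwu, hwz⟩ : ∃ w, χ w = q ∧ w ∈ K ∧ w ≠ u ∧ w ≠ z := by
        by_cases hzu' : z = u'
        · exact ⟨x, by rw [hx, ← hz, hzu', hu'], hxK, n3, by rw [hzu']; exact n4⟩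
        · exact ⟨u', hu', huK', n2.symm, fun h => hzu' h.symm⟩
      have h1 := htw w hw (fun h => hyK (h ▸ hwK)) hwz
      have h2 := hcross' y w hy hw hyK hwK
      have h3 := hK z w hz hw hzK hwK hwz.symm
      rw [adj, adj] at h1
      grind
    · have h1 := htw u hu n7.symm (fun h => hzK (h ▸ huK))
      have h2 := hcross' z u hz hu hzK huK
      rw [adj, adj] at h1
      grind
  have tv : ∀ z, ¬ TwinsAt χ p q R₁ v z := by
    intro z htz
    have hzx : z ≠ x := fun h => tx v (h ▸ htz.symm)
    have hzu : z ≠ u := fun h => tu v (h ▸ htz.symm)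
    obtain ⟨hvp, hz, hne, htw⟩ := htz
    have hpq : p = q := hvp.symm.trans hv
    by_cases hzK : z ∈ K
    · obtain ⟨w, hw, hwK, hwx, hwz⟩ : ∃ w, χ w = q ∧ w ∈ K ∧ w ≠ x ∧ w ≠ z := by
        by_cases hzu' : z = u'
        · exact ⟨u, hu, huK, n3.symm, by rw [hzu']; exact n2⟩
        · exact ⟨u', hu', huK', n4.symm, fun h => hzu' h.symm⟩
      have h1 := htw w hw (fun h => hvK (h ▸ hwK)) hwz
      have h2 := hcross' v w hvp hw hvK hwK
      have h3 := hK z w hz hw hzK hwK hwz.symm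
      rw [adj, adj] at h1
      grind
    · have h1 := htw x (hx.trans hpq) n6 (fun h => hzK (h ▸ hxK))
      have h2 := hcross' z x hz (hx.trans hpq) hzK hxK
      rw [adj, adj] at h1
      grind
  have hout : ∀ a b, a ≠ x → a ≠ u → a ≠ y → a ≠ v → (R₁.Adj a b ↔ R.Adj a b) := by
    intro a b h1 h2 h3 h4
    rw [adj]
    grind
  -- Twin pairs of `R₁` avoid the four vertices, and away from these nothing has changed. The pair
  -- `(x, x')` is lost, as both vertices belong to the block.
  have hsub : {z : V × V | TwinsAt χ p q R₁ z.1 z.2} ⊂ {z : V × V | TwinsAt χ p q R z.1 z.2} := by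
    refine ⟨?_, fun hcon => ?_⟩
    · rintro ⟨a, b⟩ hab
      have ha : ∀ a b, TwinsAt χ p q R₁ a b → ∀ w, R₁.Adj a w ↔ R.Adj a w :=
        fun a b hab w => hout a w (fun h => tx b (h ▸ hab)) (fun h => tu b (h ▸ hab))
          (fun h => ty b (h ▸ hab)) (fun h => tv b (h ▸ hab))
      refine ⟨hab.1, hab.2.1, hab.2.2.1, fun w hw h1 h2 => ?_⟩
      rw [← ha a b hab, ← ha b a hab.symm]
      exact hab.2.2.2 w hw h1 h2
    · refine tx x' (hcon (a := (x, x')) ⟨hx, hx', n1, fun w hw h1 h2 => ?_⟩)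
      by_cases hwK : w ∈ K
      · exact iff_of_true (hK x w hx hw hxK hwK h1.symm) (hK x' w hx' hw hxK' hwK h2.symm)
      · exact iff_of_false (hcross x w hx hw hxK hwK) (hcross x' w hx' hw hxK' hwK)
  obtain ⟨f, hf, hf'⟩ := hr.exists_isAutOff_of_similarAt h hR hsw
  have hiff : ∀ a b, TwinsAt χ p q R a b → TwinsAt χ p q R₁ (f a) (f b) := by
    rintro a b ⟨h1, h2, h3, h4⟩
    refine ⟨(hf.1 a).trans h1, (hf.1 b).trans h2, fun h => h3 (f.injective h), fun w hw e1 e2 => ?_⟩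
    have h5 := h4 (f.symm w) ((hf.1.symm w).trans hw) (fun h => e1 (by rw [← h]; simp))
      (fun h => e2 (by rw [← h]; simp))
    rw [hf' _ _ (by rw [h1, hf.1.symm, hw]), hf' _ _ (by rw [h2, hf.1.symm, hw])] at h5
    simpa using h5
  have hle : {z : V × V | TwinsAt χ p q R z.1 z.2}.ncard ≤
      {z : V × V | TwinsAt χ p q R₁ z.1 z.2}.ncard := by
    refine Set.ncard_le_ncard_of_injOn (fun z => (f z.1, f z.2)) (fun z hz => hiff _ _ hz) ?_
    rintro ⟨a, b⟩ _ ⟨c, d⟩ _ hab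
    simp only [Prod.mk.injEq, f.injective.eq_iff] at hab
    simp [hab]
  exact absurd hle (not_le.mpr (Set.ncard_lt_ncard hsub (Set.toFinite _)))

end

/-! ### Biregular and regular relations -/

theorem exists_bijOn_Iio {V : Type*} [Finite V] (S : Set V) :
    ∃ e : V → ℕ, Set.BijOn e S (Set.Iio S.ncard) := by
  classical
  have e : S ≃ Fin S.ncard := Finite.equivFinOfCardEq rfl
  refine ⟨fun v => if h : v ∈ S then e ⟨v, h⟩ else 0, ?_, ?_, ?_⟩
  · intro v hv
    simp [hv]
  · intro v hv w hw h
    simp only [hv, hw, dif_pos] at h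
    have := e.injective (Fin.ext h)
    exact congrArg Subtype.val this
  · intro i hi
    refine ⟨e.symm ⟨i, hi⟩, (e.symm ⟨i, hi⟩).2, ?_⟩
    simp

theorem ncard_of_bijOn {V : Type*} {S : Set V} {n : ℕ} {e : V → ℕ} (he : Set.BijOn e S (Set.Iio n))
    (P : ℕ → Prop) : {w | w ∈ S ∧ P (e w)}.ncard = {j | j < n ∧ P j}.ncard := by
  refine Set.ncard_congr (fun w _ => e w) ?_ ?_ ?_
  · intro w hw
    exact ⟨he.mapsTo hw.1, hw.2⟩
  · intro a b ha hb h
    exact he.injOn ha.1 hb.1 h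
  · intro j hj
    obtain ⟨w, hw, rfl⟩ := he.surjOn hj.1
    exact ⟨w, ⟨hw, hj.2⟩, rfl⟩

/-- Row `i` occupies the `a` consecutive positions from `a * i` on, around a circle of length `n`;
they are distinct because `a ≤ n`. -/
theorem ncard_circular_row {n a i : ℕ} (han : a ≤ n) :
    {j | j < n ∧ ∃ s < a, ∃ r, a * i + s = n * r + j}.ncard = a := by
  have h : {j | j < n ∧ ∃ s < a, ∃ r, a * i + s = n * r + j} =
      ((Finset.range a).image fun s => (a * i + s) % n : Finset ℕ) := by
    ext j
    simp only [Set.mem_ofPred_eq, Finset.coe_image, Finset.coe_range, Set.mem_image, Set.mem_Iio]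
    constructor
    · rintro ⟨hj, s, hs, r, h⟩
      exact ⟨s, hs, by rw [h, Nat.mul_add_mod, Nat.mod_eq_of_lt hj]⟩
    · rintro ⟨s, hs, rfl⟩
      exact ⟨Nat.mod_lt _ (by omega), s, hs, (a * i + s) / n, (Nat.div_add_mod _ _).symm⟩
  rw [h, Set.ncard_coe_finset, Finset.card_image_of_injOn, Finset.card_range]
  intro s hs s' hs' hss
  simp only [Finset.coe_range, Set.mem_Iio] at hs hs'
  have h1 : s ≡ s' [MOD n] := Nat.ModEq.add_left_cancel' (a * i) hss
  exact Nat.ModEq.eq_of_lt_of_lt h1 (by omega) (by omega)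

/-- The numbers `a * i + s` run once through all numbers below `m * a = n * b`. The residue `j`
occurs among them `b` times, as `n * r + j`, and two occurrences are at least `n ≥ a` apart, hence
in different rows. -/
theorem ncard_circular_column {m n a b : ℕ} (hmn : m * a = n * b) (ha : 0 < a) (han : a ≤ n)
    {j : ℕ} (hj : j < n) : {i | i < m ∧ ∃ s < a, ∃ r, a * i + s = n * r + j}.ncard = b := by
  have h : {i | i < m ∧ ∃ s < a, ∃ r, a * i + s = n * r + j} =
      ((Finset.range b).image fun r => (n * r + j) / a : Finset ℕ) := by
    ext i
    simp only [Set.mem_ofPred_eq, Finset.coe_image, Finset.coe_range, Set.mem_image, Set.mem_Iio]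
    constructor
    · rintro ⟨hi, s, hs, r, h⟩
      refine ⟨r, ?_, ?_⟩
      · have h1 : a * i + s < n * b := by
          rw [← hmn]
          nlinarith
        by_contra hr
        have : n * b ≤ n * r := Nat.mul_le_mul_left n (not_lt.mp hr)
        omega
      · rw [← h, Nat.mul_add_div ha, Nat.div_eq_of_lt hs, add_zero]
    · rintro ⟨r, hr, rfl⟩
      refine ⟨?_, (n * r + j) % a, Nat.mod_lt _ ha, r, Nat.div_add_mod _ _⟩
      rw [Nat.div_lt_iff_lt_mul ha, hmn]
      nlinarith
  rw [h, Set.ncard_coe_finset, Finset.card_image_of_injOn, Finset.card_range]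
  have key : ∀ r r', r < r' → (n * r + j) / a < (n * r' + j) / a := by
    intro r r' hrr
    have h1 : n * r + j + a ≤ n * r' + j := by nlinarith
    calc (n * r + j) / a < (n * r + j) / a + 1 := Nat.lt_succ_self _
      _ = (n * r + j + a) / a := (Nat.add_div_right _ ha).symm
      _ ≤ _ := Nat.div_le_div_right h1
  intro r _ r' _ hrr
  simp only at hrr
  rcases lt_trichotomy r r' with h | h | h
  · exact absurd hrr (key _ _ h).ne
  · exact h
  · exact absurd hrr (key _ _ h).ne'

theorem exists_biregular {V : Type*} [Finite V] {P Q : Set V} {a b : ℕ}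
    (hPQ : P.ncard * a = Q.ncard * b) (ha : 0 < a) (haQ : a ≤ Q.ncard) :
    ∃ E : V → V → Prop, (∀ x ∈ P, {w | w ∈ Q ∧ E x w}.ncard = a) ∧
      ∀ w ∈ Q, {x | x ∈ P ∧ E x w}.ncard = b := by
  obtain ⟨e, he⟩ := exists_bijOn_Iio P
  obtain ⟨e', he'⟩ := exists_bijOn_Iio Q
  refine ⟨fun x w => ∃ s < a, ∃ r, a * e x + s = Q.ncard * r + e' w, fun x hx => ?_,
    fun w hw => ?_⟩
  · rw [ncard_of_bijOn he' (fun j => ∃ s < a, ∃ r, a * e x + s = Q.ncard * r + j)]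
    exact ncard_circular_row haQ
  · rw [ncard_of_bijOn he (fun i => ∃ s < a, ∃ r, a * i + s = Q.ncard * r + e' w)]
    exact ncard_circular_column hPQ ha haQ (he'.mapsTo hw)

/-- Connection sets of circulant graphs, enlarged by pairs `x, -x`. For odd `d` the construction
starts with `N / 2`, its own negative, which is available because `N` is then even. -/
theorem exists_neg_closed (N : ℕ) [NeZero N] (d : ℕ) (hd : d < N) (hN : Even (N * d)) :
    ∃ T : Finset (ZMod N), T.card = d ∧ 0 ∉ T ∧ ∀ x ∈ T, -x ∈ T := by
  induction d using Nat.strong_induction_on with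
  | _ d ih =>
  rcases d with _ | _ | d
  · exact ⟨∅, by simp⟩
  · obtain ⟨k, hk⟩ : Even N := by simpa using hN
    have hk0 : (k : ZMod N) ≠ 0 := by
      intro h
      rw [ZMod.natCast_eq_zero_iff] at h
      have := Nat.le_of_dvd (by omega) h
      omega
    refine ⟨{(k : ZMod N)}, by simp, by simpa using hk0.symm, fun x hx => ?_⟩
    rw [Finset.mem_singleton] at hx ⊢
    rw [hx, neg_eq_iff_add_eq_zero, ← Nat.cast_add, ← hk, ZMod.natCast_self]
  · obtain ⟨T, hT, h0, hneg⟩ := ih d (by omega) (by omega) (by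
      have : N * (d + 1 + 1) = N * d + N * 2 := by ring
      rw [this, Nat.even_add] at hN
      exact hN.mpr (by simp))
    -- Two unused non-zero residues suffice, since at most one non-zero residue is its own negative.
    have hcard : 2 ≤ ((Finset.univ \ insert 0 T : Finset (ZMod N))).card := by
      rw [Finset.card_sdiff_of_subset (Finset.subset_univ _), Finset.card_insert_of_notMem h0, hT,
        Finset.card_univ, ZMod.card]
      omega
    have hex : ∃ x : ZMod N, x ∉ insert 0 T ∧ -x ≠ x := by
      obtain ⟨x, hx, y, hy, hxy⟩ := Finset.one_lt_card.mp hcard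
      simp only [Finset.mem_sdiff, Finset.mem_univ, true_and] at hx hy
      by_contra! hcon
      have h1 := ZMod.neg_eq_self_iff x |>.mp (hcon x hx)
      have h2 := ZMod.neg_eq_self_iff y |>.mp (hcon y hy)
      rcases h1 with h1 | h1
      · exact hx (by simp [h1])
      rcases h2 with h2 | h2
      · exact hy (by simp [h2])
      exact hxy (ZMod.val_injective N (by omega))
    obtain ⟨x, hx, hxx⟩ := hex
    rw [Finset.mem_insert, not_or] at hx
    have hx' : -x ∉ T := fun h => hx.2 (by simpa using hneg _ h)
    refine ⟨insert x (insert (-x) T), ?_, ?_, ?_⟩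
    · rw [Finset.card_insert_of_notMem, Finset.card_insert_of_notMem hx', hT]
      rw [Finset.mem_insert, not_or]
      exact ⟨hxx.symm, hx.2⟩
    · simp only [Finset.mem_insert, not_or]
      exact ⟨fun h => hx.1 h.symm, fun h => hx.1 (by simpa using h.symm), h0⟩
    · intro y hy
      simp only [Finset.mem_insert] at hy ⊢
      rcases hy with rfl | rfl | hy
      · simp
      · simp
      · exact Or.inr (Or.inr (hneg y hy))

theorem exists_regular {V : Type*} [Finite V] {S : Set V} {d : ℕ} (hd : d < S.ncard)
    (hS : Even (S.ncard * d)) :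
    ∃ E : V → V → Prop, (∀ x y, E x y → E y x) ∧ (∀ x, ¬ E x x) ∧
      ∀ x ∈ S, {w | w ∈ S ∧ E x w}.ncard = d := by
  have : NeZero S.ncard := ⟨by omega⟩
  obtain ⟨T, hT, h0, hneg⟩ := exists_neg_closed S.ncard d hd hS
  obtain ⟨e, he⟩ := exists_bijOn_Iio S
  refine ⟨fun x y => ((e x : ZMod S.ncard) - (e y : ZMod S.ncard)) ∈ T, fun x y h => ?_,
    fun x h => ?_, fun x hx => ?_⟩
  · have := hneg _ h
    simpa using this
  · simp only [sub_self] at h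
    exact h0 h
  · rw [ncard_of_bijOn he (fun j => ((e x : ZMod S.ncard) - (j : ZMod S.ncard)) ∈ T), ← hT,
      ← Set.ncard_coe_finset]
    refine Set.ncard_congr (fun j _ => (e x : ZMod S.ncard) - (j : ZMod S.ncard)) ?_ ?_ ?_
    · exact fun j hj => hj.2
    · intro i j hi hj h
      have h1 : (i : ZMod S.ncard) = j := sub_right_injective h
      rw [ZMod.natCast_eq_natCast_iff] at h1
      exact Nat.ModEq.eq_of_lt_of_lt h1 hi.1 hj.1
    · intro z hz
      refine ⟨((e x : ZMod S.ncard) - z).val, ⟨ZMod.val_lt _, ?_⟩, ?_⟩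
      · simpa using hz
      · simp

/-! ### Degrees between the classes of a sparse rigid graph -/

section
variable {V C : Type*} [Finite V] {χ : V → C} {F : SimpleGraph V}

theorem Similar.ncard_mul_colorDegree (h : Similar χ F F) (v w : V) :
    {x | χ x = χ v}.ncard * colorDegree χ F v (χ w) =
      {x | χ x = χ w}.ncard * colorDegree χ F w (χ v) := by
  have key : ∀ v w, {x : V × V | χ x.1 = χ v ∧ χ x.2 = χ w ∧ F.Adj x.1 x.2}.ncard =
      {x | χ x = χ v}.ncard * colorDegree χ F v (χ w) := by
    intro v w
    refine ncard_eq_mul_of_fiber (fun x hx => hx.1) fun y hy => ?_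
    rw [← h y v hy, colorDegree]
    congr 1
    ext z
    simp only [Set.mem_ofPred_eq] at hy ⊢
    tauto
  rw [← key, ← key]
  refine Set.ncard_congr (fun x _ => x.swap) (fun x hx => ⟨hx.2.1, hx.1, hx.2.2.symm⟩)
    (fun x y _ _ h => Prod.swap_injective h) (fun x hx =>
      ⟨x.swap, ⟨hx.2.1, hx.1, hx.2.2.symm⟩, by simp⟩)

theorem Similar.even_ncard_mul_colorDegree (h : Similar χ F F) (v : V) :
    Even ({x | χ x = χ v}.ncard * colorDegree χ F v (χ v)) := by
  have h1 := ncard_pairs_mul χ (χ v) (χ v) F.Adj (fun _ _ h => h.symm)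
  rw [if_pos rfl] at h1
  have h2 : {x : V × V | χ x.1 = χ v ∧ χ x.2 = χ v ∧ x.1 ≠ x.2 ∧ F.Adj x.1 x.2}.ncard =
      {x | χ x = χ v}.ncard * colorDegree χ F v (χ v) := by
    refine ncard_eq_mul_of_fiber (fun x hx => hx.1) fun y hy => ?_
    rw [← h y v hy, colorDegree]
    congr 1
    ext z
    simp only [Set.mem_ofPred_eq] at hy ⊢
    exact ⟨fun h => ⟨h.2.2.2, h.2.1⟩, fun h => ⟨hy, h.2, h.1.ne, h.1⟩⟩
  rw [← h2, ← h1]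
  simp

theorem Sparse.two_mul_colorDegree_le (hs : Sparse χ F) {v : V} {q : C} (hq : χ v ≠ q) :
    2 * colorDegree χ F v q ≤ {x | χ x = q}.ncard := by
  have h1 := hs v q
  rw [ncard_nonadj, Set.sdiff_singleton_eq_self (s := {x | χ x = q}) hq] at h1
  have h2 : colorDegree χ F v q ≤ {x | χ x = q}.ncard :=
    Set.ncard_le_ncard (fun x hx => hx.2) (Set.toFinite _)
  change colorDegree χ F v q ≤ _ at h1
  omega

theorem Sparse.two_mul_colorDegree_lt (hs : Sparse χ F) (v : V) :
    2 * colorDegree χ F v (χ v) < {x | χ x = χ v}.ncard := by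
  have h1 := hs v (χ v)
  rw [ncard_nonadj, Set.ncard_sdiff_singleton_of_mem (s := {x | χ x = χ v}) rfl] at h1
  have h2 : colorDegree χ F v (χ v) < {x | χ x = χ v}.ncard :=
    Set.ncard_lt_ncard ⟨fun x hx => hx.2, fun h => F.irrefl (h (a := v) rfl).1⟩ (Set.toFinite _)
  change colorDegree χ F v (χ v) ≤ _ at h1
  omega

/-- Between two different classes of a rigid graph, the edges form stars. -/
theorem Rigid.colorDegree_le_one (hr : Rigid χ F) (h : Similar χ F F) (hs : Sparse χ F) {v w : V}
    (hvw : χ v ≠ χ w) : colorDegree χ F v (χ w) ≤ 1 ∨ colorDegree χ F w (χ v) ≤ 1 := by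
  by_contra! hcon
  obtain ⟨ha, hb⟩ := hcon
  have hmn := h.ncard_mul_colorDegree v w
  have h2a := hs.two_mul_colorDegree_le hvw
  have h2b := hs.two_mul_colorDegree_le hvw.symm
  set a := colorDegree χ F v (χ w) with hadef
  set b := colorDegree χ F w (χ v) with hbdef
  -- A complete bipartite block on `b` vertices of color `χ v` and `a` vertices of color `χ w` has
  -- the required degrees. Sparseness leaves enough vertices for a biregular graph on the remainder.
  obtain ⟨A, hAP, hA⟩ := Set.exists_subset_card_eq (s := {x | χ x = χ v}) (n := b) (by omega)
  obtain ⟨B, hBQ, hB⟩ := Set.exists_subset_card_eq (s := {x | χ x = χ w}) (n := a) (by omega)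
  have hA' := Set.ncard_sdiff hAP
  have hB' := Set.ncard_sdiff hBQ
  rw [hA] at hA'
  rw [hB] at hB'
  obtain ⟨E, hE1, hE2⟩ := exists_biregular (P := {x | χ x = χ v} \ A) (Q := {x | χ x = χ w} \ B)
    (a := a) (b := b) (by rw [hA', hB', Nat.sub_mul, Nat.sub_mul, hmn, mul_comm a b])
    (by omega) (by omega)
  let D : V → V → Prop := fun x y => χ x = χ v ∧ χ y = χ w ∧
    ((x ∈ A ∧ y ∈ B) ∨ (x ∉ A ∧ y ∉ B ∧ E x y))
  let R : SimpleGraph V :=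
    { Adj := fun x y => D x y ∨ D y x
      symm := ⟨fun _ _ h => h.symm⟩
      loopless := ⟨fun x hx => by
        rcases hx with hx | hx <;> exact hvw (hx.1.symm.trans hx.2.1)⟩ }
  have hRv : ∀ x y, χ x = χ v → (R.Adj x y ↔ D x y) := by
    intro x y hx
    refine ⟨fun h => h.resolve_right fun h => hvw (hx.symm.trans h.2.1), Or.inl⟩
  have hRw : ∀ x y, χ x = χ w → (R.Adj x y ↔ D y x) := by
    intro x y hx
    refine ⟨fun h => h.resolve_left fun h => hvw (h.1.symm.trans hx), Or.inr⟩
  have hdv : ∀ x, χ x = χ v → colorDegree χ R x (χ w) = a := by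
    intro x hx
    by_cases hxA : x ∈ A
    · rw [← hB]
      unfold colorDegree
      congr 1
      ext y
      simp only [Set.mem_ofPred_eq, hRv x y hx, D]
      exact ⟨fun h => (h.1.2.2.resolve_right fun h => h.1 hxA).2,
        fun h => ⟨⟨hx, hBQ h, Or.inl ⟨hxA, h⟩⟩, hBQ h⟩⟩
    · rw [← hE1 x ⟨hx, hxA⟩]
      unfold colorDegree
      congr 1
      ext y
      simp only [Set.mem_ofPred_eq, hRv x y hx, D, Set.mem_sdiff]
      tauto
  have hdw : ∀ x, χ x = χ w → colorDegree χ R x (χ v) = b := by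
    intro x hx
    by_cases hxA : x ∈ B
    · rw [← hA]
      unfold colorDegree
      congr 1
      ext y
      simp only [Set.mem_ofPred_eq, hRw x y hx, D]
      exact ⟨fun h => (h.1.2.2.resolve_right fun h => h.2.1 hxA).1,
        fun h => ⟨⟨hAP h, hx, Or.inl ⟨h, hxA⟩⟩, hAP h⟩⟩
    · rw [← hE2 x ⟨hx, hxA⟩]
      unfold colorDegree
      congr 1
      ext y
      simp only [Set.mem_ofPred_eq, hRw x y hx, D, Set.mem_sdiff]
      tauto
  have hR : SimilarAt χ s(χ v, χ w) F R := by
    intro x y c hxy hc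
    rcases Sym2.eq_iff.mp hc with ⟨h1, rfl⟩ | ⟨h1, rfl⟩
    · rw [h x v h1, hdv y (hxy.symm.trans h1)]
    · rw [h x w h1, hdw y (hxy.symm.trans h1)]
  obtain ⟨x, x', hx, hx', hxx⟩ := (Set.one_lt_ncard_iff (Set.toFinite A)).mp (by omega)
  obtain ⟨u, u', hu, hu', huu⟩ := (Set.one_lt_ncard_iff (Set.toFinite B)).mp (by omega)
  obtain ⟨y, hy⟩ := (Set.ncard_pos (Set.toFinite ({x | χ x = χ v} \ A))).mp (by omega)
  obtain ⟨z, hz⟩ := (Set.ncard_pos (Set.toFinite _)).mp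
    (show 0 < {z | z ∈ {x | χ x = χ w} \ B ∧ E y z}.ncard by rw [hE1 y hy]; omega)
  have hPA : ∀ x, χ x = χ v → (x ∈ A ∪ B ↔ x ∈ A) := fun x hx =>
    ⟨fun h => h.resolve_right fun h => hvw (hx.symm.trans (hBQ h)), Or.inl⟩
  have hPB : ∀ x, χ x = χ w → (x ∈ A ∪ B ↔ x ∈ B) := fun x hx =>
    ⟨fun h => h.resolve_left fun h => hvw ((hAP h).symm.trans hx), Or.inr⟩
  refine hr.false_of_block h hR (K := A ∪ B) ?_ ?_ (hAP hx) (hAP hx') (hBQ hu) (hBQ hu')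
    (Or.inl hx) (Or.inl hx') (Or.inr hu) (Or.inr hu') hxx huu ?_ ?_ hy.1 hz.1.1
    (fun h => hy.2 ((hPA y hy.1).mp h)) (fun h => hz.1.2 ((hPB z hz.1.1).mp h))
    (Or.inl ⟨hy.1, hz.1.1, Or.inr ⟨hy.2, hz.1.2, hz.2⟩⟩)
  · intro x y hx hy hxK hyK _
    exact Or.inl ⟨hx, hy, Or.inl ⟨(hPA x hx).mp hxK, (hPB y hy).mp hyK⟩⟩
  · intro x y hx hy hxy
    rw [hRv x y hx] at hxy
    rw [hPA x hx, hPB y hy]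
    have := hxy.2.2
    tauto
  · rintro rfl
    exact hvw ((hAP hx).symm.trans (hBQ hu))
  · rintro rfl
    exact hvw ((hAP hx).symm.trans (hBQ hu'))

/-- Sparseness gives at least `2 * d + 1` vertices. With more, a complete graph on `d + 1` of them
and a `d`-regular graph on the others would form a realization excluded by `Rigid.false_of_block`.
-/
theorem Rigid.ncard_eq_of_two_le (hr : Rigid χ F) (h : Similar χ F F) (hs : Sparse χ F) {v : V}
    (hd : 2 ≤ colorDegree χ F v (χ v)) :
    {x | χ x = χ v}.ncard = 2 * colorDegree χ F v (χ v) + 1 := by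
  have hlt := hs.two_mul_colorDegree_lt v
  have heven := h.even_ncard_mul_colorDegree v
  set d := colorDegree χ F v (χ v) with hdef
  by_contra hne
  obtain ⟨A, hAP, hA⟩ := Set.exists_subset_card_eq (s := {x | χ x = χ v}) (n := d + 1) (by omega)
  have hA' := Set.ncard_sdiff hAP
  rw [hA] at hA'
  obtain ⟨E, hE1, hE2, hE3⟩ := exists_regular (S := {x | χ x = χ v} \ A) (d := d) (by omega) (by
    rw [hA', Nat.sub_mul, Nat.even_sub (Nat.mul_le_mul_right _ (by omega))]
    -- The block takes away `(d + 1) * d`, which is even.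
    refine iff_of_true heven ?_
    rw [mul_comm]
    exact Nat.even_mul_succ_self d)
  let R : SimpleGraph V :=
    { Adj := fun x y => x ≠ y ∧ χ x = χ v ∧ χ y = χ v ∧
        ((x ∈ A ∧ y ∈ A) ∨ (x ∉ A ∧ y ∉ A ∧ E x y))
      symm := ⟨fun x y h => ⟨h.1.symm, h.2.2.1, h.2.1, h.2.2.2.imp And.symm
        fun h => ⟨h.2.1, h.1, hE1 _ _ h.2.2⟩⟩⟩
      loopless := ⟨fun x hx => hx.1 rfl⟩ }
  have hadj : ∀ x y, R.Adj x y ↔ x ≠ y ∧ χ x = χ v ∧ χ y = χ v ∧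
        ((x ∈ A ∧ y ∈ A) ∨ (x ∉ A ∧ y ∉ A ∧ E x y)) := fun x y => Iff.rfl
  have hdv : ∀ x, χ x = χ v → colorDegree χ R x (χ v) = d := by
    intro x hx
    by_cases hxA : x ∈ A
    · have : (A \ {x}).ncard = d := by
        rw [Set.ncard_sdiff_singleton_of_mem hxA, hA]; omega
      rw [← this]
      unfold colorDegree
      congr 1
      ext y
      simp only [Set.mem_ofPred_eq, hadj, Set.mem_sdiff, Set.mem_singleton_iff]
      have := @hAP y
      simp only [Set.mem_ofPred_eq] at this
      grind
    · rw [← hE3 x ⟨hx, hxA⟩]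
      unfold colorDegree
      congr 1
      ext y
      simp only [Set.mem_ofPred_eq, hadj, Set.mem_sdiff]
      have := hE2 x
      grind
  have hR : SimilarAt χ s(χ v, χ v) F R := by
    intro x y c hxy hc
    have : χ x = χ v ∧ c = χ v := by
      rcases Sym2.eq_iff.mp hc with h1 | h1 <;> exact h1
    obtain ⟨h1, rfl⟩ := this
    rw [h x v h1, hdv y (hxy.symm.trans h1)]
  obtain ⟨x, x', u', hx, hx', hu', n1, n2, n3⟩ := (Set.two_lt_ncard_iff (Set.toFinite A)).mp (by omega)
  obtain ⟨y, hy⟩ := (Set.ncard_pos (Set.toFinite ({x | χ x = χ v} \ A))).mp (by omega)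
  obtain ⟨z, hz⟩ := (Set.ncard_pos (Set.toFinite _)).mp
    (show 0 < {z | z ∈ {x | χ x = χ v} \ A ∧ E y z}.ncard by rw [hE3 y hy]; omega)
  -- With only one class involved, three vertices of `A` fill the four roles in the block: `x'` also
  -- serves as `u`.
  refine hr.false_of_block h hR (K := A) ?_ ?_ (hAP hx) (hAP hx') (hAP hx') (hAP hu')
    hx hx' hx' hu' n1 n3 n1 n2 hy.1 hz.1.1 hy.2 hz.1.2
    ⟨fun h => hE2 _ (h ▸ hz.2), hy.1, hz.1.1, Or.inr ⟨hy.2, hz.1.2, hz.2⟩⟩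
  · intro x y hx hy hxK hyK hne
    exact ⟨hne, hx, hy, Or.inl ⟨hxK, hyK⟩⟩
  · intro x y hx hy hxy
    have := hxy.2.2.2
    tauto

end

/-! ### Loop classes of degree at least two -/

/-- A regular relation on `2 * d + 1` vertices without 4-clique and with a large independent set. -/
def cliqueFreeRel (d i j : ℕ) : Prop :=
  (i < d ∧ d ≤ j ∧ j ≠ i + d) ∨ (j < d ∧ d ≤ i ∧ i ≠ j + d) ∨
    (d ≤ i ∧ d ≤ j ∧ i < 2 * d ∧ j < 2 * d ∧ i ≠ j ∧ i / 2 = j / 2)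

/-- A vertex `i < d` sees the `d + 1` upper vertices except `i + d`. The vertices from `d` to `2 * d
- 1` miss one lower vertex each and are matched in consecutive pairs, which needs `d` even; `2 * d`
sees precisely the lower vertices. -/
theorem ncard_cliqueFreeRel {d i : ℕ} (hd : Even d) (hi : i < 2 * d + 1) :
    {j | j < 2 * d + 1 ∧ cliqueFreeRel d i j}.ncard = d := by
  obtain ⟨k, rfl⟩ := hd
  rcases lt_or_ge i (k + k) with h1 | h1
  · have : {j | j < 2 * (k + k) + 1 ∧ cliqueFreeRel (k + k) i j} =
        ((Finset.Icc (k + k) (2 * (k + k))).erase (i + (k + k)) : Finset ℕ) := by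
      ext j
      simp only [cliqueFreeRel, Set.mem_ofPred_eq, Finset.coe_erase, Finset.coe_Icc, Set.mem_sdiff,
        Set.mem_Icc, Set.mem_singleton_iff]
      omega
    rw [this, Set.ncard_coe_finset, Finset.card_erase_of_mem (by rw [Finset.mem_Icc]; omega),
      Nat.card_Icc]
    omega
  rcases eq_or_ne i (2 * (k + k)) with h2 | h2
  · have : {j | j < 2 * (k + k) + 1 ∧ cliqueFreeRel (k + k) i j} =
        (Finset.range (k + k) : Finset ℕ) := by
      ext j
      simp only [cliqueFreeRel, Set.mem_ofPred_eq, Finset.coe_range, Set.mem_Iio]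
      omega
    rw [this, Set.ncard_coe_finset, Finset.card_range]
  · have : {j | j < 2 * (k + k) + 1 ∧ cliqueFreeRel (k + k) i j} =
        (insert (if i % 2 = 0 then i + 1 else i - 1)
          ((Finset.range (k + k)).erase (i - (k + k))) : Finset ℕ) := by
      ext j
      simp only [cliqueFreeRel, Set.mem_ofPred_eq, Finset.coe_insert, Finset.coe_erase,
        Finset.coe_range, Set.mem_insert_iff, Set.mem_sdiff, Set.mem_Iio, Set.mem_singleton_iff]
      split_ifs <;> omega
    rw [this, Set.ncard_coe_finset, Finset.card_insert_of_notMem (by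
      rw [Finset.mem_erase, Finset.mem_range]; split_ifs <;> omega),
      Finset.card_erase_of_mem (by rw [Finset.mem_range]; omega), Finset.card_range]
    omega

/-- A clique contains at most one vertex below `d` and at most two others. -/
theorem cliqueFreeRel_clique {d a b i j : ℕ} (h1 : cliqueFreeRel d a b) (h2 : cliqueFreeRel d a i)
    (h3 : cliqueFreeRel d a j) (h4 : cliqueFreeRel d b i) (h5 : cliqueFreeRel d b j)
    (h6 : cliqueFreeRel d i j) : False := by
  have low : ∀ i j, cliqueFreeRel d i j → i < d → d ≤ j := by
    unfold cliqueFreeRel; omega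
  have low' : ∀ i j, cliqueFreeRel d i j → j < d → d ≤ i := by
    unfold cliqueFreeRel; omega
  have high : ∀ i j, cliqueFreeRel d i j → d ≤ i → d ≤ j → i ≠ j ∧ i / 2 = j / 2 := by
    unfold cliqueFreeRel; omega
  have tri : ∀ i j k, cliqueFreeRel d i j → cliqueFreeRel d i k → cliqueFreeRel d j k →
      d ≤ i → d ≤ j → d ≤ k → False := by
    intro i j k h1 h2 h3 e1 e2 e3
    have := high _ _ h1 e1 e2
    have := high _ _ h2 e1 e3
    have := high _ _ h3 e2 e3
    omega
  rcases lt_or_ge a d with ha | ha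
  · exact tri b i j h4 h5 h6 (low _ _ h1 ha) (low _ _ h2 ha) (low _ _ h3 ha)
  rcases lt_or_ge b d with hb | hb
  · exact tri a i j h2 h3 h6 ha (low _ _ h4 hb) (low _ _ h5 hb)
  rcases lt_or_ge i d with hi | hi
  · exact tri a b j h1 h3 h5 ha hb (low _ _ h6 hi)
  · exact tri a b i h1 h2 h4 ha hb hi

section
variable {V C : Type*} [Finite V] {χ : V → C} {F : SimpleGraph V}

/-- On `2 * d + 1` vertices `d` must be even, and the complement of a `d`-regular graph is again
`d`-regular. For `d ≥ 4` the realization without 4-cliques is not isomorphic to its complement,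
where the `d` independent vertices become a clique. -/
theorem Rigid.colorDegree_eq_two (hr : Rigid χ F) (h : Similar χ F F) (hs : Sparse χ F) {v : V}
    (hd : 2 ≤ colorDegree χ F v (χ v)) :
    colorDegree χ F v (χ v) = 2 ∧ {x | χ x = χ v}.ncard = 5 := by
  have hn := hr.ncard_eq_of_two_le h hs hd
  have heven := h.even_ncard_mul_colorDegree v
  set d := colorDegree χ F v (χ v) with hdef
  have hde : Even d := by
    rw [hn, Nat.even_mul] at heven
    refine heven.resolve_left ?_
    simp
  by_cases hd2 : d = 2
  · exact ⟨hd2, by omega⟩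
  exfalso
  have hd4 : 4 ≤ d := by
    obtain ⟨k, hk⟩ := hde
    omega
  obtain ⟨e, he⟩ := exists_bijOn_Iio {x | χ x = χ v}
  rw [hn] at he
  let R : SimpleGraph V :=
    { Adj := fun x y => χ x = χ v ∧ χ y = χ v ∧ cliqueFreeRel d (e x) (e y)
      symm := ⟨fun x y h => ⟨h.2.1, h.1, by have := h.2.2; unfold cliqueFreeRel at *; omega⟩⟩
      loopless := ⟨fun x hx => by have := hx.2.2; unfold cliqueFreeRel at this; omega⟩ }
  let R' : SimpleGraph V :=
    { Adj := fun x y => χ x = χ v ∧ χ y = χ v ∧ x ≠ y ∧ ¬ R.Adj x y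
      symm := ⟨fun x y h => ⟨h.2.1, h.1, h.2.2.1.symm, fun h' => h.2.2.2 h'.symm⟩⟩
      loopless := ⟨fun x hx => hx.2.2.1 rfl⟩ }
  have hR : ∀ x, χ x = χ v → colorDegree χ R x (χ v) = d := by
    intro x hx
    rw [← ncard_cliqueFreeRel hde (he.mapsTo hx), ← ncard_of_bijOn he (cliqueFreeRel d (e x))]
    unfold colorDegree
    congr 1
    ext y
    simp only [Set.mem_ofPred_eq, R]
    tauto
  have hR' : ∀ x, χ x = χ v → colorDegree χ R' x (χ v) = d := by
    intro x hx
    have h1 : {w | R'.Adj x w ∧ χ w = χ v} =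
        ({y | χ y = χ v} \ {x}) \ {w | R.Adj x w ∧ χ w = χ v} := by
      ext y
      simp only [Set.mem_ofPred_eq, R', Set.mem_sdiff, Set.mem_singleton_iff]
      have : x ≠ y ↔ ¬ y = x := ne_comm
      tauto
    have h2 : {w | R.Adj x w ∧ χ w = χ v} ⊆ {y | χ y = χ v} \ {x} :=
      fun y hy => ⟨hy.2, fun h => hy.1.ne (Set.mem_singleton_iff.mp h).symm⟩
    rw [colorDegree, h1, Set.ncard_sdiff h2,
      Set.ncard_sdiff_singleton_of_mem (s := {x | χ x = χ v}) hx, hn]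
    have := hR x hx
    rw [colorDegree] at this
    omega
  have hsim : ∀ K : SimpleGraph V, (∀ x, χ x = χ v → colorDegree χ K x (χ v) = d) →
      SimilarAt χ s(χ v, χ v) F K := by
    intro K hK x y c hxy hc
    have : χ x = χ v ∧ c = χ v := by
      rcases Sym2.eq_iff.mp hc with h1 | h1 <;> exact h1
    obtain ⟨h1, rfl⟩ := this
    rw [h x v h1, hK y (hxy.symm.trans h1)]
  obtain ⟨f, hf, hf'⟩ := hr.exists_isAutOff_of_similarAt h (hsim R hR) (hsim R' hR')
  have hex : ∀ i, i < d → ∃ x, χ x = χ v ∧ e (f x) = i := by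
    intro i hi
    obtain ⟨x, hx, rfl⟩ := he.surjOn (show i ∈ Set.Iio (2 * d + 1) from (by
      rw [Set.mem_Iio]; omega))
    exact ⟨f.symm x, (hf.1.symm x).trans hx, by simp⟩
  have hadj : ∀ x y, χ x = χ v → χ y = χ v → e (f x) < d → e (f y) < d → e (f x) ≠ e (f y) →
      cliqueFreeRel d (e x) (e y) := by
    intro x y hx hy hxd hyd hne
    refine ((hf' x y (by rw [hx, hy])).mpr ⟨(hf.1 x).trans hx, (hf.1 y).trans hy,
      fun h => hne (by rw [h]), fun h => ?_⟩).2.2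
    have := h.2.2
    unfold cliqueFreeRel at this
    omega
  obtain ⟨a, ha, ha'⟩ := hex 0 (by omega)
  obtain ⟨b, hb, hb'⟩ := hex 1 (by omega)
  obtain ⟨x, hx, hx'⟩ := hex 2 (by omega)
  obtain ⟨y, hy, hy'⟩ := hex 3 (by omega)
  exact cliqueFreeRel_clique (hadj a b ha hb (by omega) (by omega) (by omega))
    (hadj a x ha hx (by omega) (by omega) (by omega))
    (hadj a y ha hy (by omega) (by omega) (by omega))
    (hadj b x hb hx (by omega) (by omega) (by omega))
    (hadj b y hb hy (by omega) (by omega) (by omega))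
    (hadj x y hx hy (by omega) (by omega) (by omega))

end

/-! ### Switching arguments -/

/-- The edges between color classes whose pair of colors is in `S`. -/
def typeRestrict {V C : Type*} (χ : V → C) (S : Set (Sym2 C)) (F : SimpleGraph V) :
    SimpleGraph V where
  Adj v w := F.Adj v w ∧ s(χ v, χ w) ∈ S
  symm := ⟨fun _ _ h => ⟨h.1.symm, by rw [Sym2.eq_swap]; exact h.2⟩⟩
  loopless := ⟨fun _ h => F.irrefl h.1⟩

section
variable {V C : Type*} {χ : V → C} {S : Set (Sym2 C)} {t : Sym2 C} {F : SimpleGraph V}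

theorem typeRestrict_neighbors_of_mem {v : V} {q : C} (hq : s(χ v, q) ∈ S) :
    {w | (typeRestrict χ S F).Adj v w ∧ χ w = q} = {w | F.Adj v w ∧ χ w = q} := by
  ext w
  refine and_congr_left ?_
  rintro rfl
  exact ⟨fun h => h.1, fun h => ⟨h, hq⟩⟩

theorem typeRestrict_neighbors_of_notMem {v : V} {q : C} (hq : s(χ v, q) ∉ S) :
    {w | (typeRestrict χ S F).Adj v w ∧ χ w = q} = ∅ := by
  ext w
  simp only [Set.mem_ofPred_eq, Set.mem_empty_iff_false, iff_false, not_and]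
  rintro h rfl
  exact hq h.2

theorem Similar.typeRestrict (h : Similar χ F F) (S : Set (Sym2 C)) :
    Similar χ (typeRestrict χ S F) (typeRestrict χ S F) := by
  intro v w hvw q
  unfold colorDegree
  by_cases hq : s(χ v, q) ∈ S
  · rw [typeRestrict_neighbors_of_mem hq, typeRestrict_neighbors_of_mem (hvw ▸ hq)]
    exact h v w hvw q
  · rw [typeRestrict_neighbors_of_notMem hq, typeRestrict_neighbors_of_notMem (hvw ▸ hq)]

theorem Sparse.typeRestrict [Finite V] (h : Sparse χ F) (S : Set (Sym2 C)) :
    Sparse χ (typeRestrict χ S F) := by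
  intro v q
  by_cases hq : s(χ v, q) ∈ S
  · rw [typeRestrict_neighbors_of_mem hq]
    exact (h v q).trans (Set.ncard_le_ncard (fun w hw => ⟨hw.1, fun h => hw.2.1 h.1, hw.2.2⟩)
      (Set.toFinite _))
  · rw [typeRestrict_neighbors_of_notMem hq]
    simp

theorem IsAutOff.isAut_typeRestrict {f : Equiv.Perm V} (hf : IsAutOff χ t F f) (ht : t ∉ S) :
    IsAut χ (typeRestrict χ S F) f := by
  refine ⟨hf.1, fun u v => ?_⟩
  simp only [CountingLogic.typeRestrict]
  rw [hf.1, hf.1]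
  refine and_congr_left fun h => hf.2 u v ?_
  rintro rfl
  exact ht h

/-- Relabelling by a color-preserving permutation is the source of realizations for switching:
composing with a swap of two vertices of one color makes them trade their neighbors. -/
theorem similarAt_comap (h : Similar χ F F) {σ : Equiv.Perm V} (hσ : ColorPreserving χ σ)
    (t : Sym2 C) : SimilarAt χ t F (F.comap σ) := by
  intro v w q hvw _
  rw [h v (σ w) (hvw.trans (hσ w).symm) q]
  symm
  refine Set.ncard_congr (fun x _ => σ x) (fun x hx => ⟨hx.1, (hσ x).trans hx.2⟩)
    (fun x y _ _ hxy => σ.injective hxy) fun x hx => ⟨σ.symm x, ⟨?_, (hσ.symm x).trans hx.2⟩, ?_⟩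
  · simpa using hx.1
  · simp

theorem not_ssubset_of_perm [Finite V] {X Y : V → V → Prop} (f : Equiv.Perm V)
    (h : ∀ a b, X a b → Y (f a) (f b)) :
    ¬ {z : V × V | Y z.1 z.2} ⊂ {z : V × V | X z.1 z.2} := by
  intro hss
  refine absurd (Set.ncard_lt_ncard hss (Set.toFinite _)) (not_lt.mpr ?_)
  refine Set.ncard_le_ncard_of_injOn (fun z => (f z.1, f z.2)) (fun z hz => h _ _ hz) ?_
  rintro ⟨a, b⟩ _ ⟨c, d⟩ _ hab
  simp only [Prod.mk.injEq, f.injective.eq_iff] at hab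
  simp [hab]

/-- In a rigid graph, no switch of two edges of a realization strictly decreases the set of edges
that satisfy an invariant relation. -/
theorem Rigid.false_of_switch [Finite V] (hr : Rigid χ F) (h : Similar χ F F)
    {y₀ z₀ x₀ w₀ y z x w : V} (ht : s(χ y₀, χ x₀) = t) (hz₀ : χ z₀ = χ y₀) (hw₀ : χ w₀ = χ x₀)
    (hd₀ : [y₀, z₀, x₀, w₀].Nodup) (hyx₀ : F.Adj y₀ x₀)
    (hyN : ∀ v, s(χ y₀, χ v) = t → F.Adj y₀ v → v = x₀ ∨ v = z₀)
    (hzN : ∀ v, s(χ z₀, χ v) = t → F.Adj z₀ v → v = w₀ ∨ v = y₀)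
    (hd : [y, z, x, w].Nodup) (hy : χ y = χ y₀) (hz : χ z = χ y₀) (hx : χ x = χ x₀)
    (hw : χ w = χ x₀) {ρ : V → V → Prop} (hsymm : ∀ a b, ρ a b → ρ b a)
    (hρ : ∀ f, IsAutOff χ t F f → ∀ a b, ρ a b → ρ (f a) (f b)) (hyx : ρ y x) (hyw : ¬ ρ y w)
    (hzx : ¬ ρ z x) : False := by
  classical
  simp only [List.nodup_cons, List.mem_cons, List.not_mem_nil, or_false, not_or, not_false_eq_true,
    and_true, List.nodup_nil] at hd hd₀
  -- `σ` puts `y, z, x, w` into the positions `y₀, z₀, x₀, w₀`. The realizations to be compared are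
  -- `F` relabelled by `σ`, and the same after `y` and `z` have traded places.
  obtain ⟨σ, hσ, hσg⟩ := exists_colorPreserving_extending (χ := χ) {y, z, x, w}
    (fun v => if v = y then y₀ else if v = z then z₀ else if v = x then x₀ else w₀)
    (by
      intro a ha b hb
      simp only [Set.mem_insert_iff, Set.mem_singleton_iff] at ha hb
      grind)
    (by
      intro a ha
      simp only [Set.mem_insert_iff, Set.mem_singleton_iff] at ha
      grind)
  have e1 : σ y = y₀ := by rw [hσg y (by simp)]; simp
  have e2 : σ z = z₀ := by rw [hσg z (by simp)]; grind
  have e3 : σ x = x₀ := by rw [hσg x (by simp)]; grind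
  have e4 : σ w = w₀ := by rw [hσg w (by simp)]; grind
  obtain ⟨f, hf, hf'⟩ := hr.exists_isAutOff_of_similarAt h (similarAt_comap h hσ t)
    (similarAt_comap h ((ColorPreserving.swap (hy.trans hz.symm)).trans hσ) t)
  have hsw : ∀ v, χ (Equiv.swap y z v) = χ v := ColorPreserving.swap (hy.trans hz.symm)
  have sy : ∀ b, s(χ y, χ b) = t → F.Adj (σ (Equiv.swap y z y)) (σ (Equiv.swap y z b)) →
      b = w ∨ b = z := by
    intro b hb hyb
    rw [Equiv.swap_apply_left, e2] at hyb
    have := hzN _ (by rw [hσ, hsw, hz₀, ← hy, hb]) hyb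
    rw [← e4, ← e1, σ.injective.eq_iff, σ.injective.eq_iff] at this
    simp only [Equiv.swap_apply_def] at this
    grind
  have sz : ∀ b, s(χ y, χ b) = t → F.Adj (σ (Equiv.swap y z z)) (σ (Equiv.swap y z b)) →
      b = x ∨ b = y := by
    intro b hb hyb
    rw [Equiv.swap_apply_right, e1] at hyb
    have := hyN _ (by rw [hσ, hsw, ← hy, hb]) hyb
    rw [← e3, ← e2, σ.injective.eq_iff, σ.injective.eq_iff] at this
    simp only [Equiv.swap_apply_def] at this
    grind
  -- Among pairs in `ρ` the exchange creates no edge at `y` or `z`: `yw` and `zx` are not in `ρ`,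
  -- and an edge between `y` and `z` was present before. The edge `yx` is lost.
  have key : ∀ a b, s(χ a, χ b) = t → ρ a b →
      F.Adj (σ (Equiv.swap y z a)) (σ (Equiv.swap y z b)) → a = y ∨ a = z →
      F.Adj (σ a) (σ b) := by
    rintro a b hab hρab hadj (rfl | rfl)
    · rcases sy b hab hadj with rfl | rfl
      · exact (hyw hρab).elim
      · simpa using hadj.symm
    · rcases sz b (by rw [hy, ← hz, hab]) hadj with rfl | rfl
      · exact (hzx hρab).elim
      · simpa using hadj.symm
  refine not_ssubset_of_perm f (X := fun a b => s(χ a, χ b) = t ∧ ρ a b ∧ (F.comap σ).Adj a b)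
    (Y := fun a b => s(χ a, χ b) = t ∧ ρ a b ∧
      (F.comap ((Equiv.swap y z).trans σ)).Adj a b) ?_ ⟨?_, fun hcon => ?_⟩
  · rintro a b ⟨h1, h2, h3⟩
    exact ⟨by rw [hf.1, hf.1, h1], hρ f hf a b h2, (hf' a b h1).mp h3⟩
  · rintro ⟨a, b⟩ ⟨h1, h2, h3⟩
    refine ⟨h1, h2, ?_⟩
    dsimp only at h1 h2 h3 ⊢
    rw [comap_adj] at h3 ⊢
    by_cases ha : a = y ∨ a = z
    · exact key a b h1 h2 h3 ha
    by_cases hb : b = y ∨ b = z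
    · exact (key b a (by rw [Sym2.eq_swap, h1]) (hsymm _ _ h2) h3.symm hb).symm
    push Not at ha hb
    rwa [Equiv.trans_apply, Equiv.trans_apply, Equiv.swap_apply_of_ne_of_ne ha.1 ha.2,
      Equiv.swap_apply_of_ne_of_ne hb.1 hb.2] at h3
  · have h1 : s(χ y, χ x) = t := by rw [hy, hx, ht]
    have h2 := hcon (a := (y, x)) ⟨h1, hyx, by rw [comap_adj, e1, e3]; exact hyx₀⟩
    have h3 := sy x h1 h2.2.2
    grind

/-- In a rigid graph, no realization has two classes of an invariant equivalence relation attached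
to one, and another class attached to another one. -/
theorem Rigid.false_of_separated [Finite V] (hr : Rigid χ F) (h : Similar χ F F) {p q : C}
    (hpq : p ≠ q)
    (huniq : ∀ v a b, χ v = p → χ a = q → χ b = q → F.Adj v a → F.Adj v b → a = b)
    {ρ : V → V → Prop} (he : Equivalence ρ)
    (hρ : ∀ f, IsAutOff χ s(p, q) F f → ∀ a b, ρ a b → ρ (f a) (f b)) {σ : Equiv.Perm V}
    (hσ : ColorPreserving χ σ) {y y' z u u' w : V} (hy : χ y = p) (hy' : χ y' = p) (hz : χ z = p)
    (hu : χ u = q) (hu' : χ u' = q) (hw : χ w = q) (hyu : F.Adj (σ y) (σ u))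
    (hyu' : F.Adj (σ y') (σ u')) (hzw : F.Adj (σ z) (σ w)) (hne : y ≠ y') (hyy : ρ y y')
    (huu : ρ u u')
    (h1 : ∀ v a, χ v = p → χ a = q → F.Adj (σ v) (σ a) → ρ y v → ¬ ρ w a)
    (h2 : ∀ v a, χ v = p → χ a = q → F.Adj (σ v) (σ a) → ρ z v → ¬ ρ u a) : False := by
  classical
  have hyz : ¬ ρ y z := fun h' => h1 z w hz hw hzw h' (he.refl w)
  have hyz' : y ≠ z := fun h => hyz (h ▸ he.refl y)
  have hy'z : y' ≠ z := fun h => hyz (h ▸ hyy)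
  obtain ⟨f, hf, hf'⟩ := hr.exists_isAutOff_of_similarAt h (similarAt_comap h hσ s(p, q))
    (similarAt_comap h ((ColorPreserving.swap (hy.trans hz.symm)).trans hσ) s(p, q))
  have huniq' : ∀ v a b, χ v = p → χ a = q → χ b = q → F.Adj (σ v) (σ a) → F.Adj (σ v) (σ b) →
      a = b := fun v a b hv ha hb hva hvb => σ.injective
    (huniq (σ v) _ _ ((hσ v).trans hv) ((hσ a).trans ha) ((hσ b).trans hb) hva hvb)
  have hsw : ∀ a, χ a = q → Equiv.swap y z a = a := fun a ha =>
    Equiv.swap_apply_of_ne_of_ne (fun h => hpq (by rw [← hy, ← ha, h]))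
      (fun h => hpq (by rw [← hz, ← ha, h]))
  -- `Θ` collects the pairs of `p`-vertices in one class of `ρ` that have `q`-neighbors in one class
  -- of `ρ`. Such a pair is `(y, y')`, but after `y` and `z` have traded neighbors, neither of them
  -- is in any such pair.
  let Θ : SimpleGraph V → V → V → Prop := fun R v v' => χ v = p ∧ χ v' = p ∧ v ≠ v' ∧ ρ v v' ∧
    ∃ a b, χ a = q ∧ χ b = q ∧ R.Adj v a ∧ R.Adj v' b ∧ ρ a b
  have hΘ : ∀ R v v', Θ R v v' → Θ R v' v := by
    rintro R v v' ⟨h1, h2, h3, h4, a, b, h5, h6, h7, h8, h9⟩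
    exact ⟨h2, h1, h3.symm, he.symm h4, b, a, h6, h5, h8, h7, he.symm h9⟩
  have key : ∀ v v', Θ (F.comap ((Equiv.swap y z).trans σ)) v v' → v ≠ y ∧ v ≠ z := by
    rintro v v' ⟨k1, k2, k3, k4, a, b, k5, k6, k7, k8, k9⟩
    rw [comap_adj, Equiv.trans_apply, Equiv.trans_apply, hsw _ k5] at k7
    rw [comap_adj, Equiv.trans_apply, Equiv.trans_apply, hsw _ k6] at k8
    constructor
    · rintro rfl
      rw [Equiv.swap_apply_left] at k7
      have haw := huniq' z a w hz k5 hw k7 hzw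
      have hv'z : v' ≠ z := fun h => hyz (h ▸ k4)
      rw [Equiv.swap_apply_of_ne_of_ne k3.symm hv'z] at k8
      exact h1 v' b k2 k6 k8 k4 (haw ▸ k9)
    · rintro rfl
      rw [Equiv.swap_apply_right] at k7
      have hau := huniq' y a u hy k5 hu k7 hyu
      have hv'y : v' ≠ y := fun h => hyz (h ▸ he.symm k4)
      rw [Equiv.swap_apply_of_ne_of_ne hv'y k3.symm] at k8
      exact h2 v' b k2 k6 k8 k4 (hau ▸ k9)
  refine not_ssubset_of_perm f (X := Θ (F.comap σ))
    (Y := Θ (F.comap ((Equiv.swap y z).trans σ))) ?_ ⟨?_, fun hcon => ?_⟩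
  · rintro v v' ⟨k1, k2, k3, k4, a, b, k5, k6, k7, k8, k9⟩
    exact ⟨(hf.1 v).trans k1, (hf.1 v').trans k2, fun h => k3 (f.injective h), hρ f hf _ _ k4,
      f a, f b, (hf.1 a).trans k5, (hf.1 b).trans k6, (hf' v a (by rw [k1, k5])).mp k7,
      (hf' v' b (by rw [k2, k6])).mp k8, hρ f hf _ _ k9⟩
  · rintro ⟨v, v'⟩ hvv
    obtain ⟨e1, e2⟩ := key v v' hvv
    obtain ⟨e3, e4⟩ := key v' v (hΘ _ _ _ hvv)
    obtain ⟨k1, k2, k3, k4, a, b, k5, k6, k7, k8, k9⟩ := hvv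
    dsimp only at k1 k2 k3 k4 k7 k8
    rw [comap_adj, Equiv.trans_apply, Equiv.trans_apply, hsw _ k5,
      Equiv.swap_apply_of_ne_of_ne e1 e2] at k7
    rw [comap_adj, Equiv.trans_apply, Equiv.trans_apply, hsw _ k6,
      Equiv.swap_apply_of_ne_of_ne e3 e4] at k8
    exact ⟨k1, k2, k3, k4, a, b, k5, k6, k7, k8, k9⟩
  · exact (key y y' (hcon (a := (y, y')) ⟨hy, hy', hne, hyy, u, u', hu, hu', hyu, hyu', huu⟩)).1 rfl

end

/-! ### Rigid graphs are acyclic apart from loop classes of degree two -/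

theorem eq_of_colorDegree_le_one {V C : Type*} [Finite V] {χ : V → C} {F : SimpleGraph V}
    {v a b : V} {q : C} (hd : colorDegree χ F v q ≤ 1) (ha : F.Adj v a) (hb : F.Adj v b)
    (haq : χ a = q) (hbq : χ b = q) : a = b :=
  (Set.ncard_le_one (Set.toFinite _)).mp hd a ⟨ha, haq⟩ b ⟨hb, hbq⟩

theorem exists_injOn_mapsTo {V : Type*} [Finite V] {X Y : Set V} (h : X.ncard ≤ Y.ncard) :
    ∃ g : V → V, Set.MapsTo g X Y ∧ Set.InjOn g X := by
  rcases isEmpty_or_nonempty V with hV | hV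
  · exact ⟨id, fun v => (hV.false v).elim, Function.injective_id.injOn⟩
  · refine (Set.toFinite X).exists_injOn_of_encard_le ?_
    rw [← (Set.toFinite X).cast_ncard_eq, ← (Set.toFinite Y).cast_ncard_eq]
    exact_mod_cast h

theorem exists_colorPreserving_mapsTo {V C : Type*} [Finite V] {χ : V → C} {p : C}
    {X X' Y Y' : Set V} (hX : ∀ v ∈ X, χ v = p) (hX' : ∀ v ∈ X', χ v = p) (hY : ∀ v ∈ Y, χ v = p)
    (hY' : ∀ v ∈ Y', χ v = p) (hXX : Disjoint X X') (hYY : Disjoint Y Y')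
    (hXY : X.ncard ≤ Y.ncard) (hXY' : X'.ncard ≤ Y'.ncard) :
    ∃ σ : Equiv.Perm V, ColorPreserving χ σ ∧ (∀ v, χ v ≠ p → σ v = v) ∧ (∀ v ∈ X, σ v ∈ Y) ∧
      ∀ v ∈ X', σ v ∈ Y' := by
  classical
  obtain ⟨g, hg, hg'⟩ := exists_injOn_mapsTo hXY
  obtain ⟨k, hk, hk'⟩ := exists_injOn_mapsTo hXY'
  have hd : ∀ v ∈ X', v ∉ X := fun v hv hv' => Set.disjoint_left.mp hXX hv' hv
  have hd' : ∀ v ∈ Y, v ∉ Y' := fun v hv hv' => Set.disjoint_left.mp hYY hv hv'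
  let m : V → V := fun v => if v ∈ X then g v else if v ∈ X' then k v else v
  have m1 : ∀ v ∈ X, m v = g v := fun v hv => if_pos hv
  have m2 : ∀ v ∈ X', m v = k v := fun v hv => (if_neg (hd v hv)).trans (if_pos hv)
  have m3 : ∀ v, χ v ≠ p → m v = v := fun v hv =>
    (if_neg fun h => hv (hX v h)).trans (if_neg fun h => hv (hX' v h))
  obtain ⟨σ, hσ, hσm⟩ := exists_colorPreserving_extending (χ := χ) (X ∪ X' ∪ {v | χ v ≠ p}) m
    (by
      have c1 : ∀ v ∈ X, χ (m v) = p := fun v hv => by rw [m1 v hv]; exact hY _ (hg hv)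
      have c2 : ∀ v ∈ X', χ (m v) = p := fun v hv => by rw [m2 v hv]; exact hY' _ (hk hv)
      have c3 : ∀ v, χ v ≠ p → χ (m v) ≠ p := fun v hv => by rwa [m3 v hv]
      rintro a ((ha | ha) | ha) b ((hb | hb) | hb) hab
      · rw [m1 a ha, m1 b hb] at hab
        exact hg' ha hb hab
      · rw [m1 a ha, m2 b hb] at hab
        exact (hd' _ (hg ha) (hab ▸ hk hb)).elim
      · exact (c3 b hb (hab ▸ c1 a ha)).elim
      · rw [m2 a ha, m1 b hb] at hab
        exact (hd' _ (hg hb) (hab ▸ hk ha)).elim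
      · rw [m2 a ha, m2 b hb] at hab
        exact hk' ha hb hab
      · exact (c3 b hb (hab ▸ c2 a ha)).elim
      · exact (c3 a ha (hab.symm ▸ c1 b hb)).elim
      · exact (c3 a ha (hab.symm ▸ c2 b hb)).elim
      · rw [m3 a ha, m3 b hb] at hab
        exact hab)
    (by
      rintro a ((ha | ha) | ha)
      · rw [m1 a ha, hX a ha]; exact hY _ (hg ha)
      · rw [m2 a ha, hX' a ha]; exact hY' _ (hk ha)
      · rw [m3 a ha])
  refine ⟨σ, hσ, fun v hv => ?_, fun v hv => ?_, fun v hv => ?_⟩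
  · rw [hσm v (Or.inr hv), m3 v hv]
  · rw [hσm v (Or.inl (Or.inl hv)), m1 v hv]; exact hg hv
  · rw [hσm v (Or.inl (Or.inr hv)), m2 v hv]; exact hk hv

section
variable {V C : Type*} [Finite V] {χ : V → C} {S : Set (Sym2 C)} {t : Sym2 C} {F : SimpleGraph V}

/-- If `y` and `x` lay in one tree, sparseness and transitivity would give a copy of both in another
tree. A switch would then replace an edge inside a tree by edges between trees, although
reachability is invariant under automorphisms off `t`, since `t ∉ S`. -/
theorem Rigid.not_reachable_of_switch (hr : Rigid χ F) (h : Similar χ F F) (hs : Sparse χ F)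
    (hH : (typeRestrict χ S F).IsAcyclic) (htS : t ∉ S)
    {y₀ z₀ x₀ w₀ : V} (ht : s(χ y₀, χ x₀) = t) (hz₀ : χ z₀ = χ y₀) (hw₀ : χ w₀ = χ x₀)
    (hd₀ : [y₀, z₀, x₀, w₀].Nodup) (hyx₀ : F.Adj y₀ x₀)
    (hyN : ∀ v, s(χ y₀, χ v) = t → F.Adj y₀ v → v = x₀ ∨ v = z₀)
    (hzN : ∀ v, s(χ z₀, χ v) = t → F.Adj z₀ v → v = w₀ ∨ v = y₀)
    {y x : V} (hy : χ y = χ y₀) (hx : χ x = χ x₀) (hyx : y ≠ x) :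
    ¬ (typeRestrict χ S F).Reachable y x := by
  intro hreach
  have hex : ∃ y', χ y' = χ y ∧ y' ≠ y := by
    by_cases he : y = y₀
    · refine ⟨z₀, hz₀.trans hy.symm, ?_⟩
      rintro rfl
      simp [he] at hd₀
    · exact ⟨y₀, hy.symm, fun h => he h.symm⟩
  obtain ⟨y', hy', hne⟩ := hex
  obtain ⟨z, hz, hyz⟩ := exists_not_reachable hH (h.typeRestrict S) (hs.typeRestrict S) hy' hne
  obtain ⟨f, hf, rfl⟩ := exists_isAut_of_isAcyclic hH (h.typeRestrict S) hz.symm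
  have hzw := hf.reachable_iff.mpr hreach
  have hyw : ¬ (typeRestrict χ S F).Reachable y (f x) := fun h' => hyz (h'.trans hzw.symm)
  have hzx : ¬ (typeRestrict χ S F).Reachable (f y) x := fun h' => hyz (hreach.trans h'.symm)
  refine hr.false_of_switch h ht hz₀ hw₀ hd₀ hyx₀ hyN hzN (y := y) (z := f y) (x := x) (w := f x)
    ?_ hy (hz.trans hy) hx ((hf.1 x).trans hx) (ρ := (typeRestrict χ S F).Reachable)
    (fun _ _ h => h.symm) (fun g hg a b hab =>
      (hg.isAut_typeRestrict htS).reachable_iff.mpr hab) hreach hyw hzx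
  simp only [List.nodup_cons, List.mem_cons, List.not_mem_nil, or_false, not_or, not_false_eq_true,
    and_true, List.nodup_nil]
  exact ⟨⟨fun h => hyz (h ▸ .refl _), hyx, fun h => hyw (h ▸ .refl _)⟩, ⟨fun h => hzx (h ▸ .refl _), fun h => hyx (f.injective h)⟩,
    fun h => hyw (by rw [← h]; exact hreach)⟩

/-- Sparseness provides a vertex `w` of the color of `u` not adjacent to `x`, and `w` has a neighbor
`z` of the color of `x`. As `x` and `z` each have only one neighbor of the color of `u`, the edges
`xu` and `zw` can be switched. -/
theorem Rigid.not_reachable_of_colorDegree_le_one (hr : Rigid χ F) (h : Similar χ F F)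
    (hs : Sparse χ F) (hH : (typeRestrict χ S F).IsAcyclic) {x u : V} (hxu : F.Adj x u)
    (hd : colorDegree χ F x (χ u) ≤ 1) (htS : s(χ x, χ u) ∉ S) {y v : V} (hy : χ y = χ x)
    (hv : χ v = χ u) (hyv : y ≠ v) : ¬ (typeRestrict χ S F).Reachable y v := by
  obtain ⟨w, hw1, hw2, hw3⟩ := hs.exists_ne hxu
  obtain ⟨z, hwz, hz⟩ := h.exists_adj hw3.symm hxu.symm
  have hcol : ∀ v c, s(χ x, χ v) = s(χ x, c) → χ v = c := fun v c h =>
    Sym2.congr_right.mp h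
  have hdz : colorDegree χ F z (χ u) ≤ 1 := by rwa [h z x hz]
  refine hr.not_reachable_of_switch h hs hH htS rfl hz hw3 ?_ hxu ?_ ?_ hy hv hyv
  · simp only [List.nodup_cons, List.mem_cons, List.not_mem_nil, or_false, not_or,
      not_false_eq_true, and_true, List.nodup_nil]
    have hwu : u ≠ w := fun h => hw2 (h ▸ hxu)
    refine ⟨⟨fun h => hw2 (h ▸ hwz.symm), hxu.ne, hw1.symm⟩, ⟨fun hzu => ?_, hwz.ne'⟩, hwu⟩
    subst hzu
    exact hw1 (eq_of_colorDegree_le_one hdz hxu.symm hwz.symm hz.symm hw3).symm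
  · intro v hv hxv
    exact Or.inl (eq_of_colorDegree_le_one hd hxv hxu (hcol v _ hv) rfl)
  · intro v hv hzv
    rw [hz] at hv
    exact Or.inl (eq_of_colorDegree_le_one hdz hzv hwz.symm (hcol v _ hv) hw3)

theorem ncard_reachable_eq {H : SimpleGraph V} (hH : H.IsAcyclic) (h : Similar χ H H) {x z : V}
    (hxz : χ x = χ z) (p : C) :
    {v | χ v = p ∧ H.Reachable x v}.ncard = {v | χ v = p ∧ H.Reachable z v}.ncard := by
  obtain ⟨f, hf, rfl⟩ := exists_isAut_of_isAcyclic hH h hxz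
  refine Set.ncard_congr (fun v _ => f v) (fun v hv => ⟨(hf.1 v).trans hv.1,
    hf.reachable_iff.mpr hv.2⟩) (fun _ _ _ _ h => f.injective h) fun v hv =>
      ⟨f.symm v, ⟨(hf.1.symm v).trans hv.1, ?_⟩, by simp⟩
  rw [← hf.reachable_iff]
  simpa using hv.2

theorem ncard_children (h : Similar χ F F) {x u : V} (hd : colorDegree χ F x (χ u) ≤ 1)
    (Z : Set V) (hZ : ∀ v ∈ Z, χ v = χ u) :
    {v | χ v = χ x ∧ ∃ b ∈ Z, F.Adj v b}.ncard = Z.ncard * colorDegree χ F u (χ x) := by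
  rw [← ncard_eq_mul_of_fiber (S := {z : V × V | z.1 ∈ Z ∧ F.Adj z.1 z.2 ∧ χ z.2 = χ x})
    (P := Z) (fun z hz => hz.1) fun v hv => ?_]
  · symm
    refine Set.ncard_congr (fun z _ => z.2) ?_ ?_ ?_
    · rintro ⟨a, b⟩ ⟨h1, h2, h3⟩
      exact ⟨h3, a, h1, h2.symm⟩
    · rintro ⟨a, b⟩ ⟨a', b'⟩ ⟨h1, h2, h3⟩ ⟨h1', h2', h3'⟩ hb
      dsimp only at *
      subst hb
      rw [eq_of_colorDegree_le_one (by rw [h b x h3]; exact hd) h2.symm h2'.symm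
        (hZ a h1) (hZ a' h1')]
    · rintro v ⟨hv, b, hb, hvb⟩
      exact ⟨(b, v), ⟨hb, hvb.symm, hv⟩, rfl⟩
  · rw [← h v u (hZ v hv), colorDegree]
    congr 1
    ext w
    simp [hv]

end

/-! ### Adding one pair of classes to the forest -/

section
variable {V C : Type*} [Finite V] {χ : V → C} {S : Set (Sym2 C)} {F : SimpleGraph V}

/-- `X` is the set of vertices of the color of `x` in a tree, `Y` the set of those attached to a
tree by new edges. Their sizes are the same for the two trees compared, since equal colors have
isomorphic trees. If `X` is not larger, all of `X` for one tree can be attached to one tree;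
otherwise all of `Y` for one tree can be placed inside one tree. Doing so for two pairs of trees
gives a realization excluded by `Rigid.false_of_separated`. -/
theorem Rigid.false_of_two_leaving (hr : Rigid χ F) (h : Similar χ F F) (hs : Sparse χ F)
    (hH : (typeRestrict χ S F).IsAcyclic) {x u : V} (hxu : F.Adj x u) (hne : χ x ≠ χ u)
    (hd : colorDegree χ F x (χ u) ≤ 1) (htS : s(χ x, χ u) ∉ S) {x' : V} (hx' : χ x' = χ x)
    (hxx : x' ≠ x) (hxx' : (typeRestrict χ S F).Reachable x x') {a b : V} (ha : χ a = χ x)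
    (hb : χ b = χ u) (hab : F.Adj a b) (hax : a ≠ x) (hub : (typeRestrict χ S F).Reachable u b) :
    False := by
  set H := typeRestrict χ S F with hHdef
  have hHs : Similar χ H H := h.typeRestrict S
  have hdeg : ∀ v, χ v = χ x → colorDegree χ F v (χ u) ≤ 1 := fun v hv => by rwa [h v x hv]
  have huniq : ∀ v a b, χ v = χ x → χ a = χ u → χ b = χ u → F.Adj v a → F.Adj v b → a = b :=
    fun v a b hv ha hb hva hvb => eq_of_colorDegree_le_one (hdeg v hv) hva hvb ha hb
  have hρ : ∀ f, IsAutOff χ s(χ x, χ u) F f → ∀ a b, H.Reachable a b → H.Reachable (f a) (f b) :=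
    fun f hf a b hab => (hf.isAut_typeRestrict htS).reachable_iff.mpr hab
  obtain ⟨z₀, hz₀, hxz₀⟩ := exists_not_reachable hH hHs (hs.typeRestrict S) hx' hxx
  obtain ⟨u', hu'u, hu'⟩ := hs.exists_ne_same_color hxu.symm
  obtain ⟨w₀, hw₀, huw₀⟩ := exists_not_reachable hH hHs (hs.typeRestrict S) hu' hu'u
  let X : V → Set V := fun x₁ => {v | χ v = χ x ∧ H.Reachable x₁ v}
  let Y : V → Set V := fun u₁ => {v | χ v = χ x ∧ ∃ b ∈ {b | χ b = χ u ∧ H.Reachable u₁ b},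
    F.Adj v b}
  have hXX : Disjoint (X x) (X z₀) := Set.disjoint_left.mpr fun v hv hv' =>
    hxz₀ (hv.2.trans hv'.2.symm)
  have hYY : Disjoint (Y u) (Y w₀) := by
    refine Set.disjoint_left.mpr ?_
    rintro v ⟨hv, b, hb, hvb⟩ ⟨-, b', hb', hvb'⟩
    obtain rfl := huniq v b b' hv hb.1 hb'.1 hvb hvb'
    exact huw₀ (hb.2.trans hb'.2.symm)
  have hX : (X x).ncard = (X z₀).ncard := ncard_reachable_eq hH hHs hz₀.symm _
  have hY : (Y u).ncard = (Y w₀).ncard := by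
    rw [ncard_children h hd _ fun v hv => hv.1, ncard_children h hd _ fun v hv => hv.1,
      ncard_reachable_eq hH hHs hw₀.symm]
  rcases le_total (X x).ncard (Y u).ncard with hle | hle
  · obtain ⟨σ, hσ, hfix, h1, h2⟩ := exists_colorPreserving_mapsTo (χ := χ) (p := χ x)
      (X := X x) (X' := X z₀) (Y := Y u) (Y' := Y w₀) (fun v hv => hv.1) (fun v hv => hv.1)
      (fun v hv => hv.1) (fun v hv => hv.1) hXX hYY hle (by omega)
    have hfix' : ∀ v, χ v = χ u → σ v = v := fun v hv => hfix v fun h => hne (h.symm.trans hv)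
    obtain ⟨-, b₁, hb₁, hxb₁⟩ := h1 x ⟨rfl, .refl _⟩
    obtain ⟨-, b₂, hb₂, hxb₂⟩ := h1 x' ⟨hx', hxx'⟩
    obtain ⟨-, b₃, hb₃, hxb₃⟩ := h2 z₀ ⟨hz₀, .refl _⟩
    refine hr.false_of_separated h hne huniq H.reachable_is_equivalence hρ hσ (y := x) (y' := x')
      (z := z₀) (u := b₁) (u' := b₂) (w := b₃) rfl hx' hz₀ hb₁.1 hb₂.1 hb₃.1
      (by rwa [hfix' _ hb₁.1]) (by rwa [hfix' _ hb₂.1]) (by rwa [hfix' _ hb₃.1]) hxx.symm hxx'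
      (hb₁.2.symm.trans hb₂.2) ?_ ?_
    · intro v c hv hc hvc hxv hbc
      rw [hfix' c hc] at hvc
      obtain ⟨-, b₄, hb₄, hvb₄⟩ := h1 v ⟨hv, hxv⟩
      obtain rfl := huniq _ c b₄ ((hσ v).trans hv) hc hb₄.1 hvc hvb₄
      exact huw₀ (hb₄.2.trans (hb₃.2.trans hbc).symm)
    · intro v c hv hc hvc hxv hbc
      rw [hfix' c hc] at hvc
      obtain ⟨-, b₄, hb₄, hvb₄⟩ := h2 v ⟨hv, hxv⟩
      obtain rfl := huniq _ c b₄ ((hσ v).trans hv) hc hb₄.1 hvc hvb₄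
      exact huw₀ ((hb₁.2.trans hbc).trans hb₄.2.symm)
  · obtain ⟨τ, hτ, hfix, h1, h2⟩ := exists_colorPreserving_mapsTo (χ := χ) (p := χ x)
      (X := Y u) (X' := Y w₀) (Y := X x) (Y' := X z₀) (fun v hv => hv.1) (fun v hv => hv.1)
      (fun v hv => hv.1) (fun v hv => hv.1) hYY hXX hle (by omega)
    have hfix' : ∀ v, χ v = χ u → τ.symm v = v := fun v hv => by
      rw [Equiv.symm_apply_eq, hfix v fun h => hne (h.symm.trans hv)]
    obtain ⟨c, hw₀c, hc⟩ := h.exists_adj hw₀.symm hxu.symm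
    have m1 := h1 x ⟨rfl, u, ⟨rfl, .refl _⟩, hxu⟩
    have m2 := h1 a ⟨ha, b, ⟨hb, hub⟩, hab⟩
    have m3 := h2 c ⟨hc, w₀, ⟨hw₀, .refl _⟩, hw₀c.symm⟩
    refine hr.false_of_separated h hne huniq H.reachable_is_equivalence hρ hτ.symm (y := τ x)
      (y' := τ a) (z := τ c) (u := u) (u' := b) (w := w₀) m1.1 m2.1 m3.1 rfl hb hw₀
      (by rwa [hfix' _ rfl, Equiv.symm_apply_apply])
      (by rwa [hfix' _ hb, Equiv.symm_apply_apply])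
      (by rw [hfix' _ hw₀, Equiv.symm_apply_apply]; exact hw₀c.symm)
      (fun h => hax (τ.injective h).symm) (m1.2.symm.trans m2.2) hub ?_ ?_
    · intro v d hv hd' hvd hxv hwd
      rw [hfix' d hd'] at hvd
      have m4 := h2 _ ⟨(hτ.symm v).trans hv, d, ⟨hd', hwd⟩, hvd⟩
      rw [Equiv.apply_symm_apply] at m4
      exact hxz₀ ((m1.2.trans hxv).trans m4.2.symm)
    · intro v d hv hd' hvd hxv hwd
      rw [hfix' d hd'] at hvd
      have m4 := h1 _ ⟨(hτ.symm v).trans hv, d, ⟨hd', hwd⟩, hvd⟩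
      rw [Equiv.apply_symm_apply] at m4
      exact hxz₀ (m4.2.trans (m3.2.trans hxv).symm)

/-- `Z` is the tree of `x` or the tree of `u`. If other new edges left both, the tree of `x` would
contain a second vertex of its color and the tree of `u` would have a second attached vertex,
against `Rigid.false_of_two_leaving`. -/
theorem Rigid.exists_pendant (hr : Rigid χ F) (h : Similar χ F F) (hs : Sparse χ F)
    (hH : (typeRestrict χ S F).IsAcyclic) {x u : V} (hxu : F.Adj x u)
    (hd : colorDegree χ F x (χ u) ≤ 1) (htS : s(χ x, χ u) ∉ S) :
    ∃ Z : Set V, ∃ y z, s(y, z) = s(x, u) ∧ y ∈ Z ∧ z ∉ Z ∧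
      ∀ a b, (typeRestrict χ (insert s(χ x, χ u) S) F).Adj a b → a ∈ Z → b ∉ Z →
        s(a, b) = s(x, u) := by
  have hnr := fun y v => hr.not_reachable_of_colorDegree_le_one h hs hH hxu hd htS (y := y) (v := v)
  set H := typeRestrict χ S F with hHdef
  have hdeg : ∀ v, χ v = χ x → colorDegree χ F v (χ u) ≤ 1 := fun v hv => by rwa [h v x hv]
  have htype : ∀ v₀ a b, (typeRestrict χ (insert s(χ x, χ u) S) F).Adj a b → H.Reachable v₀ a →
      ¬ H.Reachable v₀ b → F.Adj a b ∧ ((χ a = χ x ∧ χ b = χ u) ∨ (χ a = χ u ∧ χ b = χ x)) := by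
    intro v₀ a b hab ha hb
    refine ⟨hab.1, ?_⟩
    rcases hab.2 with h1 | h1
    · exact Sym2.eq_iff.mp h1
    · exact (hb (ha.trans (Adj.reachable ⟨hab.1, h1⟩))).elim
  by_cases hA : ∀ v, χ v = χ x → H.Reachable x v → v = x
  · refine ⟨{v | H.Reachable x v}, x, u, rfl, .refl _, hnr x u rfl rfl hxu.ne, ?_⟩
    intro a b hab ha hb
    obtain ⟨hab', h1 | h1⟩ := htype x a b hab ha hb
    · obtain rfl := hA a h1.1 ha
      rw [eq_of_colorDegree_le_one hd hab' hxu h1.2 rfl]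
    · by_cases hax : x = a
      · subst hax
        rw [eq_of_colorDegree_le_one hd hab' hxu (h1.2.trans h1.1) rfl]
      · exact (hnr x a rfl h1.1 hax ha).elim
  push Not at hA
  obtain ⟨x', hx', hxx', hne⟩ := hA
  have hpq : χ x ≠ χ u := fun hpq => hnr x x' rfl (hx'.trans hpq) hne.symm hxx'
  by_cases hB : ∀ a b, χ a = χ x → χ b = χ u → F.Adj a b → H.Reachable u b → a = x
  · refine ⟨{v | H.Reachable u v}, u, x, Sym2.eq_swap, .refl _,
      fun h => hnr x u rfl rfl hxu.ne h.symm, ?_⟩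
    intro a b hab ha hb
    obtain ⟨hab', h1 | h1⟩ := htype u a b hab ha hb
    · exact (hnr a u h1.1 rfl (fun h => hpq (by rw [← h1.1, h])) (Reachable.symm ha)).elim
    · obtain rfl := hB b a h1.2 h1.1 hab'.symm ha
      rw [eq_of_colorDegree_le_one hd hab'.symm hxu h1.1 rfl, Sym2.eq_swap]
  push Not at hB
  obtain ⟨a, b, ha, hb, hab, hub, hax⟩ := hB
  exact (hr.false_of_two_leaving h hs hH hxu hpq hd htS hx' hne hxx' ha hb hab hax hub).elim

/-- The edges of the new pair form stars or a matching, so one end of each has a single neighbor in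
the other class; `Rigid.exists_pendant` is applied from that end. -/
theorem Rigid.isAcyclic_insert (hr : Rigid χ F) (h : Similar χ F F) (hs : Sparse χ F)
    (hH : (typeRestrict χ S F).IsAcyclic) {t : Sym2 C} (htS : t ∉ S)
    (hloop : ∀ v, s(χ v, χ v) = t → colorDegree χ F v (χ v) ≤ 1) :
    (typeRestrict χ (insert t S) F).IsAcyclic := by
  refine isAcyclic_of_pendant hH fun x u hxu hxu' => ?_
  have hadj : F.Adj x u := hxu.1
  have ht : s(χ x, χ u) = t := hxu.2.resolve_right fun h => hxu' ⟨hadj, h⟩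
  subst ht
  have hd : colorDegree χ F x (χ u) ≤ 1 ∨ colorDegree χ F u (χ x) ≤ 1 := by
    by_cases hc : χ x = χ u
    · exact Or.inl (hc ▸ hloop x (by rw [hc]))
    · exact hr.colorDegree_le_one h hs hc
  rcases hd with hd | hd
  · exact hr.exists_pendant h hs hH hadj hd htS
  · obtain ⟨Z, y, z, h1, h2, h3, h4⟩ := hr.exists_pendant h hs hH hadj.symm hd
      (by rwa [Sym2.eq_swap])
    rw [Sym2.eq_swap (a := χ u), Sym2.eq_swap (a := u)] at h4
    exact ⟨Z, y, z, by rw [h1, Sym2.eq_swap], h2, h3, h4⟩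

/-- The pairs of color classes other than the loop classes of degree at least two. -/
def thinTypes {V C : Type*} (χ : V → C) (F : SimpleGraph V) : Set (Sym2 C) :=
  {t | ∀ v, s(χ v, χ v) = t → colorDegree χ F v (χ v) ≤ 1}

theorem Rigid.isAcyclic_typeRestrict (hr : Rigid χ F) (h : Similar χ F F) (hs : Sparse χ F) :
    (typeRestrict χ (thinTypes χ F) F).IsAcyclic := by
  have key : ∀ S : Set (Sym2 C), S.Finite → S ⊆ thinTypes χ F →
      (typeRestrict χ S F).IsAcyclic := by
    intro S hS
    induction S, hS using Set.Finite.induction_on with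
    | empty =>
      intro _
      rw [show typeRestrict χ ∅ F = ⊥ by ext a b; simp [typeRestrict]]
      exact isAcyclic_bot
    | @insert t S ht _ ih =>
      intro hsub
      exact hr.isAcyclic_insert h hs (ih ((Set.subset_insert _ _).trans hsub)) ht
        (hsub (Set.mem_insert _ _))
  -- `C` may be infinite, but only finitely many pairs of colors occur on `V`.
  have := key (thinTypes χ F ∩ Set.range fun z : V × V => s(χ z.1, χ z.2))
    ((Set.finite_range _).subset Set.inter_subset_right) Set.inter_subset_left
  convert this using 1
  ext a b
  simp only [typeRestrict, Set.mem_inter_iff, Set.mem_range, Prod.exists]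
  exact and_congr_right fun _ => ⟨fun h => ⟨h, a, b, rfl⟩, fun h => h.1⟩

end

/-! ### Five-cycles -/

/-- The map `c` is an isomorphism from the 5-cycle to the graph induced on `S`. -/
def IsFiveCycle {V : Type*} (K : SimpleGraph V) (S : Set V) (c : Fin 5 → V) : Prop :=
  Function.Injective c ∧ Set.range c = S ∧ ∀ i j, K.Adj (c i) (c j) ↔ (cycleGraph 5).Adj i j

theorem cycleGraph_five_adj : ∀ i j : Fin 5, (cycleGraph 5).Adj i j ↔ j = i + 1 ∨ j = i + 4 := by
  decide

theorem exists_isFiveCycle {V : Type*} [Finite V] {K : SimpleGraph V} {S : Set V}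
    (hS : S.ncard = 5) (hdeg : ∀ x ∈ S, {w | w ∈ S ∧ K.Adj x w}.ncard = 2) :
    ∃ c, IsFiveCycle K S c := by
  have hother : ∀ x ∈ S, ∀ y ∈ S, K.Adj x y → ∃ z ∈ S, z ≠ y ∧ z ≠ x ∧
      ∀ w ∈ S, K.Adj x w ↔ w = y ∨ w = z := by
    intro x hx y hy hxy
    obtain ⟨p, q, hpq, hset⟩ := Set.ncard_eq_two.mp (hdeg x hx)
    have hiff : ∀ w, w ∈ S ∧ K.Adj x w ↔ w = p ∨ w = q := fun w => Set.ext_iff.mp hset w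
    have h1 := (hiff y).mp ⟨hy, hxy⟩
    have h2 := (hiff p).mpr (Or.inl rfl)
    have h3 := (hiff q).mpr (Or.inr rfl)
    rcases h1 with rfl | rfl
    · exact ⟨q, h3.1, hpq.symm, h3.2.ne', fun w hw => by rw [← hiff, and_iff_right hw]⟩
    · exact ⟨p, h2.1, hpq, h2.2.ne', fun w hw => by rw [or_comm, ← hiff, and_iff_right hw]⟩
  -- A set of three or four vertices closed under adjacency would leave one or two vertices, too few
  -- for degree two. Hence the walks from `a` in both directions meet only after exhausting `S`.
  have hclosed : ∀ Z ⊆ S, 3 ≤ Z.ncard → Z.ncard ≤ 4 → (∀ x ∈ Z, ∀ w ∈ S, K.Adj x w → w ∈ Z) →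
      False := by
    intro Z hZ h3 h4 hcl
    have hcard := Set.ncard_sdiff hZ
    obtain ⟨x, hx⟩ := (Set.ncard_pos (Set.toFinite (S \ Z))).mp (by omega)
    have hsub : {w | w ∈ S ∧ K.Adj x w} ⊆ (S \ Z) \ {x} := fun w hw =>
      ⟨⟨hw.1, fun hwZ => hx.2 (hcl w hwZ x hx.1 hw.2.symm)⟩, hw.2.ne'⟩
    have h5 := Set.ncard_le_ncard hsub (Set.toFinite _)
    rw [Set.ncard_sdiff_singleton_of_mem hx, hdeg x hx.1] at h5
    omega
  obtain ⟨a, ha⟩ := (Set.ncard_pos (Set.toFinite S)).mp (by omega)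
  obtain ⟨b, hb, hab⟩ := (Set.ncard_pos (Set.toFinite _)).mp
    (show 0 < {w | w ∈ S ∧ K.Adj a w}.ncard by rw [hdeg a ha]; norm_num)
  obtain ⟨e, he, heb, hea, hNa⟩ := hother a ha b hb hab
  have hae : K.Adj a e := (hNa e he).mpr (Or.inr rfl)
  obtain ⟨d, hd, hda, hdb, hNb⟩ := hother b hb a ha hab.symm
  have hbd : K.Adj b d := (hNb d hd).mpr (Or.inr rfl)
  obtain ⟨f, hf, hfa, hfe, hNe⟩ := hother e he a ha hae.symm
  have hef : K.Adj e f := (hNe f hf).mpr (Or.inr rfl)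
  obtain ⟨g, hg, hgb, hgd, hNd⟩ := hother d hd b hb hbd.symm
  have hdg : K.Adj d g := (hNd g hg).mpr (Or.inr rfl)
  have hde : d ≠ e := by
    rintro rfl
    have hfb : b = f := ((hNe b hb).mp hbd.symm).resolve_left hab.ne'
    refine hclosed {a, b, d} ?_ ?_ ?_ ?_
    · simp [Set.insert_subset_iff, ha, hb, hd]
    · rw [Set.ncard_eq_three.mpr ⟨a, b, d, hab.ne, hae.ne, hbd.ne, rfl⟩]
    · exact (Set.ncard_insert_le _ _).trans (by rw [Set.ncard_pair hbd.ne]; norm_num)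
    · clear hclosed hother hdeg
      intro x hx w hw hxw
      have h1 := hNa w hw
      have h2 := hNb w hw
      have h3 := hNe w hw
      simp only [Set.mem_insert_iff, Set.mem_singleton_iff] at hx ⊢
      rcases hx with rfl | rfl | rfl <;> grind
  have hfb : f ≠ b := by
    rintro rfl
    exact hde (((hNb e he).mp hef.symm).resolve_left hea).symm
  have hdf : d ≠ f := by
    rintro rfl
    have hge : e = g := ((hNd e he).mp hef.symm).resolve_left heb
    have h4 : ({a, b, e, d} : Set V).ncard = 4 := by
      rw [Set.ncard_insert_of_notMem, Set.ncard_eq_three.mpr ⟨b, e, d, heb.symm, hbd.ne, hef.ne, rfl⟩]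
      simp only [Set.mem_insert_iff, Set.mem_singleton_iff, not_or]
      exact ⟨hab.ne, hae.ne, hda.symm⟩
    refine hclosed {a, b, e, d} ?_ (by omega) (by omega) ?_
    · simp [Set.insert_subset_iff, ha, hb, he, hd]
    · clear hclosed hother hdeg
      intro x hx w hw hxw
      have h1 := hNa w hw
      have h2 := hNb w hw
      have h3 := hNe w hw
      have h4 := hNd w hw
      simp only [Set.mem_insert_iff, Set.mem_singleton_iff] at hx ⊢
      rcases hx with rfl | rfl | rfl | rfl <;> grind
  have hinj : Function.Injective ![a, b, d, f, e] := by
    rw [← List.nodup_ofFn]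
    have := hab.ne
    clear hclosed hother hdeg hNa hNb hNd hNe
    simp
    grind
  have hrange : Set.range ![a, b, d, f, e] = S := by
    refine Set.eq_of_subset_of_ncard_le ?_ ?_ (Set.toFinite _)
    · rintro _ ⟨i, rfl⟩
      fin_cases i <;> assumption
    · rw [Set.ncard_range_of_injective hinj, hS, Nat.card_fin]
  have hall : ∀ w ∈ S, w = a ∨ w = b ∨ w = d ∨ w = f ∨ w = e := by
    intro w hw
    rw [← hrange] at hw
    obtain ⟨i, rfl⟩ := hw
    fin_cases i <;> simp
  have hgf : g = f := by
    rcases hall g hg with h1 | h1 | h1 | h1 | h1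
    · have := (hNa d hd).mp (h1 ▸ hdg.symm)
      grind
    · exact (hgb h1).elim
    · exact (hgd h1).elim
    · exact h1
    · have := (hNe d hd).mp (h1 ▸ hdg.symm)
      grind
  subst hgf
  obtain ⟨k, hk, hke, hkf, hNf⟩ := hother g hf e he hef.symm
  have hkd : d = k := ((hNf d hd).mp hdg.symm).resolve_left hde
  subst hkd
  have hN : ∀ i, ∀ w ∈ S, K.Adj (![a, b, d, g, e] i) w ↔
      w = ![a, b, d, g, e] (i + 1) ∨ w = ![a, b, d, g, e] (i + 4) := by
    intro i w hw
    fin_cases i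
    · exact hNa w hw
    · exact (hNb w hw).trans or_comm
    · exact (hNd w hw).trans or_comm
    · exact hNf w hw
    · exact hNe w hw
  refine ⟨_, hinj, hrange, fun i j => ?_⟩
  rw [hN i _ (hrange ▸ Set.mem_range_self j), hinj.eq_iff, hinj.eq_iff, cycleGraph_five_adj]

section
variable {V C : Type*} [Finite V] {χ : V → C} {F F' : SimpleGraph V}

theorem exists_isFiveCycle_color {p : C} (hS : {x | χ x = p}.ncard = 5)
    (hd : ∀ v, χ v = p → colorDegree χ F v p = 2) : ∃ c, IsFiveCycle F {x | χ x = p} c := by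
  refine exists_isFiveCycle hS fun x hx => ?_
  rw [← hd x hx, colorDegree]
  congr 1
  ext w
  exact and_comm

theorem Rigid.exists_isFiveCycle (hr : Rigid χ F) (h : Similar χ F F) (hs : Sparse χ F) {v : V}
    (hv : s(χ v, χ v) ∉ thinTypes χ F) : ∃ c, IsFiveCycle F {x | χ x = χ v} c := by
  simp only [thinTypes, Set.mem_ofPred_eq, not_forall, not_le] at hv
  obtain ⟨w, hw, hd⟩ := hv
  have hwv : χ w = χ v := by simpa using hw
  obtain ⟨h1, h2⟩ := hr.colorDegree_eq_two h hs hd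
  rw [hwv] at h1 h2
  exact exists_isFiveCycle_color h2 fun x hx => by rw [← h1, h x w (hx.trans hwv.symm)]

/-- The switch takes place along the path `c 0, c 1, c 2, c 3`, whose middle vertices trade their
outer neighbors. For this the switching lemmas allow `y₀` and `z₀` to be adjacent. -/
theorem Rigid.eq_of_reachable_of_color_eq (hr : Rigid χ F) (h : Similar χ F F) (hs : Sparse χ F)
    {v w : V} (hv : s(χ v, χ v) ∉ thinTypes χ F) (hvw : χ v = χ w)
    (hreach : (typeRestrict χ (thinTypes χ F) F).Reachable v w) : v = w := by
  by_contra hne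
  obtain ⟨c, hinj, hrange, hadj⟩ := hr.exists_isFiveCycle h hs hv
  have hc : ∀ i, χ (c i) = χ v := fun i => (Set.ext_iff.mp hrange (c i)).mp ⟨i, rfl⟩
  have hnb : ∀ i x, s(χ (c i), χ x) = s(χ v, χ v) → F.Adj (c i) x →
      x = c (i + 1) ∨ x = c (i + 4) := by
    intro i x hx hix
    rw [hc] at hx
    obtain ⟨j, rfl⟩ := (Set.ext_iff.mp hrange x).mpr (Sym2.congr_right.mp hx)
    rw [hadj, cycleGraph_five_adj] at hix
    rwa [hinj.eq_iff, hinj.eq_iff]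
  refine hr.not_reachable_of_switch h hs (hr.isAcyclic_typeRestrict h hs) hv
    (y₀ := c 1) (x₀ := c 0) (z₀ := c 2) (w₀ := c 3) (by rw [hc, hc]) (by rw [hc, hc])
    (by rw [hc, hc]) ?_ ?_ ?_ ?_ (hc 1).symm (hvw.symm.trans (hc 0).symm) hne hreach
  · simp [hinj.eq_iff]
  · rw [hadj]; decide
  · exact fun x hx hx' => (hnb 1 x hx hx').symm
  · exact fun x hx hx' => by
      rw [hc, ← hc 2] at hx
      exact hnb 2 x (by rw [hx, hc]) hx'

end

theorem exists_two_adj_of_root {U : Type*} (T : SimpleGraph U) (r : U) (i : Fin 5) :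
    (bouquet T r).Adj (i, r) (i + 1, r) ∧ (bouquet T r).Adj (i, r) (i + 4, r) ∧
      ((i + 1, r) : Fin 5 × U) ≠ (i + 4, r) := by
  refine ⟨Or.inr ⟨rfl, rfl, ?_⟩, Or.inr ⟨rfl, rfl, ?_⟩, fun h => ?_⟩
  · exact (cycleGraph_five_adj _ _).mpr (Or.inl rfl)
  · exact (cycleGraph_five_adj _ _).mpr (Or.inr rfl)
  · revert h
    simp [Prod.ext_iff]

theorem IsBouquet.not_isAcyclic {W : Type u} [Finite W] {B : SimpleGraph W} (hB : IsBouquet B) :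
    ¬ B.IsAcyclic := by
  obtain ⟨U, T, r, -, ⟨f⟩⟩ := hB
  have : Finite (Fin 5 × U) := Finite.of_equiv _ f.toEquiv
  rw [f.isAcyclic_iff]
  intro hac
  obtain ⟨⟨i, x⟩, hx, hleaf⟩ := exists_leaf_of_isAcyclic hac (Y := {x | x.2 = r}) ⟨(0, r), rfl⟩
  obtain rfl : x = r := hx
  obtain ⟨h1, h2, h3⟩ := exists_two_adj_of_root T x i
  exact h3 (hleaf _ rfl _ rfl h1 h2)

theorem adj_typeRestrict_or {V C : Type*} (χ : V → C) {F : SimpleGraph V} {a b : V} (hab : F.Adj a b) :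
    (typeRestrict χ (thinTypes χ F) F).Adj a b ∨
      (s(χ a, χ a) ∉ thinTypes χ F ∧ χ b = χ a) := by
  by_cases ht : s(χ a, χ b) ∈ thinTypes χ F
  · exact Or.inl ⟨hab, ht⟩
  · right
    have ht' := ht
    simp only [thinTypes, Set.mem_ofPred_eq, not_forall] at ht'
    obtain ⟨v, hv, -⟩ := ht'
    rw [Sym2.eq_iff] at hv
    have h1 : χ b = χ a := by rcases hv with h | h <;> rw [← h.1, ← h.2]
    exact ⟨by rwa [h1] at ht, h1⟩

theorem IsFiveCycle.reachable {V : Type*} {K : SimpleGraph V} {S : Set V} {c : Fin 5 → V}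
    (hc : IsFiveCycle K S c) (i j : Fin 5) : K.Reachable (c i) (c j) := by
  have hstep : ∀ i, K.Reachable (c 0) (c i) → K.Reachable (c 0) (c (i + 1)) := fun i hi =>
    hi.trans (Adj.reachable ((hc.2.2 _ _).mpr ((cycleGraph_five_adj _ _).mpr (Or.inl rfl))))
  have h0 : K.Reachable (c 0) (c 0) := .refl _
  have hall : ∀ i, K.Reachable (c 0) (c i) := by
    intro i
    fin_cases i
    · exact h0
    · exact hstep 0 h0
    · exact hstep 1 (hstep 0 h0)
    · exact hstep 2 (hstep 1 (hstep 0 h0))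
    · exact hstep 3 (hstep 2 (hstep 1 (hstep 0 h0)))
  exact (hall i).symm.trans (hall j)

section
variable {V C : Type*} [Finite V] {χ : V → C} {F : SimpleGraph V}

/-- Two vertices in loop classes of degree two are not joined by the edges outside loop classes of
degree two. -/
theorem Rigid.eq_of_reachable (hr : Rigid χ F) (h : Similar χ F F) (hs : Sparse χ F)
    {v w : V} (hv : s(χ v, χ v) ∉ thinTypes χ F) (hw : s(χ w, χ w) ∉ thinTypes χ F)
    (hreach : (typeRestrict χ (thinTypes χ F) F).Reachable v w) : v = w := by
  by_cases hvw : χ v = χ w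
  · exact hr.eq_of_reachable_of_color_eq h hs hv hvw hreach
  exfalso
  have hH := hr.isAcyclic_typeRestrict h hs
  have hHs := h.typeRestrict (thinTypes χ F)
  obtain ⟨c, hinj, hrange, hadj⟩ := hr.exists_isFiveCycle h hs hv
  obtain ⟨d, dinj, drange, dadj⟩ := hr.exists_isFiveCycle h hs hw
  have hc : ∀ i, χ (c i) = χ v := fun i => (Set.ext_iff.mp hrange (c i)).mp ⟨i, rfl⟩
  have hd : ∀ i, χ (d i) = χ w := fun i => (Set.ext_iff.mp drange (d i)).mp ⟨i, rfl⟩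
  set H := typeRestrict χ (thinTypes χ F) F with hHdef
  have hex : ∀ i, ∃ y, χ y = χ v ∧ H.Reachable y (d i) := by
    intro i
    obtain ⟨f, hf, hfw⟩ := exists_isAut_of_isAcyclic hH hHs (hd i).symm
    exact ⟨f v, hf.1 v, by rw [← hfw]; exact hf.reachable_iff.mpr hreach⟩
  choose y hy hyd using hex
  have yinj : ∀ i j, y i = y j → i = j := by
    intro i j hij
    refine dinj (hr.eq_of_reachable_of_color_eq h hs (by rw [hd]; exact hw) (by rw [hd, hd]) ?_)
    exact (hyd i).symm.trans (hij ▸ hyd j)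
  -- The trees carry the 5-cycle on the class of `w` to a 5-cycle `ρ` on the vertices `y i`,
  -- independent of the edges within the class of `v`. In a realization with the path `y 1, y 0, y
  -- 3, y 2`, exchanging `y 0` and `y 3` loses an edge in `ρ` and gains none.
  let ρ : V → V → Prop := fun x z => ∃ a b, χ a = χ w ∧ χ b = χ w ∧ H.Reachable x a ∧
    H.Reachable z b ∧ F.Adj a b
  have hρ : ∀ i j, ρ (y i) (y j) ↔ (cycleGraph 5).Adj i j := by
    intro i j
    rw [← dadj]
    refine ⟨?_, fun hij => ⟨d i, d j, hd i, hd j, hyd i, hyd j, hij⟩⟩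
    rintro ⟨a, b, ha, hb, hia, hjb, hab⟩
    have e1 := hr.eq_of_reachable_of_color_eq h hs (v := a) (w := d i) (by rwa [ha])
      (by rw [ha, hd]) (hia.symm.trans (hyd i))
    have e2 := hr.eq_of_reachable_of_color_eq h hs (v := b) (w := d j) (by rwa [hb])
      (by rw [hb, hd]) (hjb.symm.trans (hyd j))
    rwa [← e1, ← e2]
  have hnb : ∀ i x, s(χ (c i), χ x) = s(χ v, χ v) → F.Adj (c i) x →
      x = c (i + 1) ∨ x = c (i + 4) := by
    intro i x hx hix
    rw [hc] at hx
    obtain ⟨j, rfl⟩ := (Set.ext_iff.mp hrange x).mpr (Sym2.congr_right.mp hx)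
    rw [hadj, cycleGraph_five_adj] at hix
    rwa [hinj.eq_iff, hinj.eq_iff]
  refine hr.false_of_switch h (t := s(χ v, χ v))
    (y₀ := c 1) (x₀ := c 0) (z₀ := c 2) (w₀ := c 3) (by rw [hc, hc]) (by rw [hc, hc])
    (by rw [hc, hc]) ?_ ?_ ?_ ?_ (y := y 0) (z := y 3) (x := y 1) (w := y 2) ?_
    (by rw [hy, hc]) (by rw [hy, hc]) (by rw [hy, hc]) (by rw [hy, hc]) (ρ := ρ) ?_ ?_
    ((hρ _ _).mpr (by decide)) (fun h => absurd ((hρ _ _).mp h) (by decide))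
    (fun h => absurd ((hρ _ _).mp h) (by decide))
  · simp [hinj.eq_iff]
  · rw [hadj]; decide
  · exact fun x hx hx' => (hnb 1 x hx hx').symm
  · exact fun x hx hx' => by
      rw [hc, ← hc 2] at hx
      exact hnb 2 x (by rw [hx, hc]) hx'
  · have yne : ∀ i j, y i = y j ↔ i = j := fun i j => ⟨yinj i j, fun h => h ▸ rfl⟩
    simp [yne]
  · rintro x z ⟨a, b, h1, h2, h3, h4, h5⟩
    exact ⟨b, a, h2, h1, h4, h3, h5.symm⟩
  · rintro f hf x z ⟨a, b, h1, h2, h3, h4, h5⟩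
    refine ⟨f a, f b, (hf.1 a).trans h1, (hf.1 b).trans h2,
      (hf.isAut_typeRestrict hv).reachable_iff.mpr h3,
      (hf.isAut_typeRestrict hv).reachable_iff.mpr h4, (hf.2 a b ?_).mp h5⟩
    rw [h1, h2]
    intro h6
    have : χ v = χ w := by simpa using h6.symm
    exact hvw this

end

/-! ### Components of a sparse rigid graph -/

section
variable {V : Type u} {C : Type*} [Finite V] {χ : V → C} {F : SimpleGraph V}

theorem Rigid.isTree_induce_supp (hr : Rigid χ F) (h : Similar χ F F) (hs : Sparse χ F)
    (c : F.ConnectedComponent) (hc : ∀ v ∈ c.supp, s(χ v, χ v) ∈ thinTypes χ F) :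
    (F.induce c.supp).IsTree := by
  refine ⟨c.connected_toSimpleGraph, ?_⟩
  refine IsAcyclic.comap (G' := typeRestrict χ (thinTypes χ F) F) ⟨Subtype.val, ?_⟩
    Subtype.val_injective (hr.isAcyclic_typeRestrict h hs)
  intro a b hab
  exact (adj_typeRestrict_or χ hab).resolve_right fun h => h.1 (hc a a.2)

/-- The trees at the five vertices `k i` are disjoint, because each contains only one vertex of a
5-cycle class; for the same reason no other 5-cycle is attached. They exhaust the component and are
images of the tree at `k 0` under automorphisms of the forest. -/
theorem Rigid.isBouquet_induce_supp (hr : Rigid χ F) (h : Similar χ F F) (hs : Sparse χ F)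
    (c : F.ConnectedComponent) {v : V} (hvc : v ∈ c.supp)
    (hv : s(χ v, χ v) ∉ thinTypes χ F) : IsBouquet (F.induce c.supp) := by
  have hH := hr.isAcyclic_typeRestrict h hs
  have hHs := h.typeRestrict (thinTypes χ F)
  obtain ⟨k, hcyc⟩ := hr.exists_isFiveCycle h hs hv
  have hFk := hcyc.reachable
  obtain ⟨kinj, krange, kadj⟩ := hcyc
  have hk : ∀ i, χ (k i) = χ v := fun i => (Set.ext_iff.mp krange (k i)).mp ⟨i, rfl⟩
  have hkv : ∀ x, χ x = χ v → ∃ i, k i = x := fun x hx => (Set.ext_iff.mp krange x).mpr hx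
  have hroot := fun v w => hr.eq_of_reachable h hs (v := v) (w := w)
  have hor := fun a b => adj_typeRestrict_or χ (F := F) (a := a) (b := b)
  have hle : ∀ a b, (typeRestrict χ (thinTypes χ F) F).Reachable a b → F.Reachable a b :=
    fun a b hab => hab.mono (fun _ _ h => And.left h)
  set H := typeRestrict χ (thinTypes χ F) F with hHdef
  have hthick : ∀ i, s(χ (k i), χ (k i)) ∉ thinTypes χ F := fun i => by rwa [hk]
  have hkk : ∀ i j, H.Reachable (k i) (k j) → i = j := fun i j hij =>
    kinj (hroot _ _ (hthick i) (hthick j) hij)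
  obtain ⟨i₀, hi₀⟩ := hkv v rfl
  have hsupp : ∀ x, x ∈ c.supp ↔ ∃ i, H.Reachable (k i) x := by
    intro x
    have hx : x ∈ c.supp ↔ F.Reachable v x := by
      rw [ConnectedComponent.mem_supp_iff] at hvc ⊢
      rw [← hvc, ConnectedComponent.eq]
      exact ⟨Reachable.symm, Reachable.symm⟩
    rw [hx]
    constructor
    · intro hvx
      refine mem_of_reachable (S := {x | ∃ i, H.Reachable (k i) x}) ?_ hvx ⟨i₀, hi₀ ▸ .refl _⟩
      rintro a b ⟨i, hi⟩ hab
      rcases hor a b hab with h1 | ⟨h1, h2⟩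
      · exact ⟨i, hi.trans h1.reachable⟩
      · have hia := hroot _ _ (hthick i) h1 hi
        obtain ⟨j, rfl⟩ := hkv b (by rw [h2, ← hia, hk])
        exact ⟨j, .refl _⟩
    · rintro ⟨i, hi⟩
      exact hi₀ ▸ (hFk i₀ i).trans (hle _ _ hi)
  have hf : ∀ i, ∃ f, IsAut χ H f ∧ f (k 0) = k i := fun i =>
    exists_isAut_of_isAcyclic hH hHs (by rw [hk, hk])
  choose f hf hfk using hf
  let D := (H.connectedComponentMk (k 0)).supp
  have hD : ∀ x, x ∈ D ↔ H.Reachable (k 0) x := fun x => by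
    rw [ConnectedComponent.mem_supp_iff, ConnectedComponent.eq]
    exact ⟨Reachable.symm, Reachable.symm⟩
  have hfD : ∀ i, ∀ x ∈ D, H.Reachable (k i) (f i x) := fun i x hx => by
    rw [← hfk i, (hf i).reachable_iff]
    exact (hD x).mp hx
  let r : D := ⟨k 0, (hD _).mpr (.refl _)⟩
  let φ : Fin 5 × D → c.supp := fun z => ⟨f z.1 z.2, (hsupp _).mpr ⟨z.1, hfD z.1 z.2 z.2.2⟩⟩
  have hφ : Function.Bijective φ := by
    constructor
    · rintro ⟨i, x⟩ ⟨j, y⟩ hxy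
      have hxy' : f i x = f j y := congrArg Subtype.val hxy
      have hij := hkk i j ((hfD i x x.2).trans (hxy' ▸ (hfD j y y.2).symm))
      subst hij
      rw [Subtype.ext ((f i).injective hxy')]
    · rintro ⟨x, hx⟩
      obtain ⟨i, hi⟩ := (hsupp x).mp hx
      refine ⟨(i, ⟨(f i).symm x, (hD _).mpr ?_⟩), Subtype.ext ?_⟩
      · rw [← (hf i).reachable_iff, hfk]
        simpa using hi
      · simp [φ]
  have hrx : ∀ i, ∀ x : D, s(χ (f i x), χ (f i x)) ∉ thinTypes χ F → x = r ∧ f i x = k i := by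
    intro i x hx
    have h1 := hroot _ _ (hthick i) hx (hfD i x x.2)
    refine ⟨Subtype.ext ((f i).injective ?_), h1.symm⟩
    rw [← h1]
    exact (hfk i).symm
  refine ⟨D, H.induce D, r, ⟨(H.connectedComponentMk (k 0)).connected_toSimpleGraph,
    hH.induce _⟩, ⟨RelIso.symm ⟨Equiv.ofBijective φ hφ, ?_⟩⟩⟩
  rintro ⟨i, x⟩ ⟨j, y⟩
  change F.Adj (f i x) (f j y) ↔ (i = j ∧ H.Adj x y) ∨ (x = r ∧ y = r ∧ (cycleGraph 5).Adj i j)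
  constructor
  · intro hadj
    rcases hor _ _ hadj with h1 | ⟨h1, h2⟩
    · have hij := hkk i j ((hfD i x x.2).trans (h1.reachable.trans (hfD j y y.2).symm))
      subst hij
      exact Or.inl ⟨rfl, ((hf i).2 _ _).mpr h1⟩
    · obtain ⟨e1, e2⟩ := hrx i x h1
      obtain ⟨e3, e4⟩ := hrx j y (by rwa [h2])
      rw [e2, e4, kadj] at hadj
      exact Or.inr ⟨e1, e3, hadj⟩
  · rintro (⟨rfl, h1⟩ | ⟨rfl, rfl, h1⟩)
    · exact (((hf i).2 _ _).mp h1).1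
    · change F.Adj (f i (k 0)) (f j (k 0))
      rw [hfk, hfk, kadj]
      exact h1

theorem Rigid.isBouquetForest (hr : Rigid χ F) (h : Similar χ F F) (hs : Sparse χ F) :
    IsBouquetForest F χ := by
  refine ⟨fun c => ?_, fun c d hcd hc _ ⟨φ, hφ⟩ => ?_⟩
  · by_cases hex : ∃ v ∈ c.supp, s(χ v, χ v) ∉ thinTypes χ F
    · obtain ⟨v, hvc, hv⟩ := hex
      exact Or.inr (hr.isBouquet_induce_supp h hs c hvc hv)
    · push Not at hex
      exact Or.inl (hr.isTree_induce_supp h hs c hex)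
  -- An isomorphism of colored bouquets sends a vertex of a 5-cycle class to one of the same color.
  -- That class is a single 5-cycle and lies in one component.
  · have hex : ∃ v ∈ c.supp, s(χ v, χ v) ∉ thinTypes χ F := by
      by_contra! hcon
      exact hc.not_isAcyclic (hr.isTree_induce_supp h hs c hcon).isAcyclic
    obtain ⟨v, hvc, hv⟩ := hex
    have hcol : χ (φ ⟨v, hvc⟩) = χ v := hφ ⟨v, hvc⟩
    obtain ⟨k, hcyc⟩ := hr.exists_isFiveCycle h hs hv
    obtain ⟨i, hi⟩ := (Set.ext_iff.mp hcyc.2.1 v).mpr rfl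
    obtain ⟨j, hj⟩ := (Set.ext_iff.mp hcyc.2.1 (φ ⟨v, hvc⟩)).mpr hcol
    have h1 := hcyc.reachable i j
    rw [hi, hj, ← ConnectedComponent.eq] at h1
    exact hcd (((ConnectedComponent.mem_supp_iff c v).mp hvc).symm.trans
      (h1.trans ((ConnectedComponent.mem_supp_iff d _).mp (φ ⟨v, hvc⟩).2)))

end

/-! ### Bouquet forests are rigid -/

/-- The largest set of colors such that all vertices with a color in this set have two neighbors
with a color in this set. -/
def coreColors {V C : Type*} (χ : V → C) (F : SimpleGraph V) : Set C :=
  {q | ∃ A : Set C, q ∈ A ∧ ∀ v, χ v ∈ A →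
    ∃ a b, a ≠ b ∧ F.Adj v a ∧ F.Adj v b ∧ χ a ∈ A ∧ χ b ∈ A}

section
variable {V C : Type*} {χ : V → C} {F : SimpleGraph V}

theorem exists_two_adj_of_mem_coreColors {v : V} (hv : χ v ∈ coreColors χ F) :
    ∃ a b, a ≠ b ∧ F.Adj v a ∧ F.Adj v b ∧ χ a ∈ coreColors χ F ∧ χ b ∈ coreColors χ F := by
  obtain ⟨A, hvA, hA⟩ := hv
  obtain ⟨a, b, hab, ha, hb, haA, hbA⟩ := hA v hvA
  exact ⟨a, b, hab, ha, hb, ⟨A, haA, hA⟩, ⟨A, hbA, hA⟩⟩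

/-- Without such a leaf, `A` itself would satisfy the condition that defines the core. -/
theorem exists_leaf_of_coreColors_subset {A : Set C} (hA : coreColors χ F ⊆ A)
    (hex : ∃ v, χ v ∈ A \ coreColors χ F) : ∃ v, χ v ∈ A \ coreColors χ F ∧
      ∀ a b, χ a ∈ A → χ b ∈ A → F.Adj v a → F.Adj v b → a = b := by
  by_contra! hcon
  obtain ⟨v, hv⟩ := hex
  refine hv.2 ⟨A, hv.1, fun w hw => ?_⟩
  by_cases hwc : χ w ∈ coreColors χ F
  · obtain ⟨a, b, hab, ha, hb, haA, hbA⟩ := exists_two_adj_of_mem_coreColors hwc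
    exact ⟨a, b, hab, ha, hb, hA haA, hA hbA⟩
  · obtain ⟨a, b, ha, hb, hwa, hwb, hab⟩ := hcon w ⟨hw, hwc⟩
    exact ⟨a, b, hab, hwa, hwb, ha, hb⟩

theorem IsFiveCycle.exists_apply_eq {K : SimpleGraph V} {S : Set V} {c : Fin 5 → V}
    (hc : IsFiveCycle K S c) {x y : V} (hx : x ∈ S) (hy : y ∈ S) (hxy : K.Adj x y) :
    ∃ d, IsFiveCycle K S d ∧ d 0 = x ∧ d 1 = y := by
  obtain ⟨hinj, hrange, hadj⟩ := hc
  rw [← hrange] at hx hy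
  obtain ⟨i, rfl⟩ := hx
  obtain ⟨j, rfl⟩ := hy
  -- The reindexing is `a ↦ i + s * a` with `s = 1` or `s = 4`, a rotation or a reflection.
  have key : ∀ i j : Fin 5, (cycleGraph 5).Adj i j → ∃ s : Fin 5, i + s * 0 = i ∧ i + s * 1 = j ∧
      (∀ a b : Fin 5, (cycleGraph 5).Adj (i + s * a) (i + s * b) ↔ (cycleGraph 5).Adj a b) ∧
      (∀ a b : Fin 5, i + s * a = i + s * b → a = b) ∧ ∀ a : Fin 5, ∃ b, i + s * b = a := by
    decide
  obtain ⟨s, h0, h1, h2, h3, h4⟩ := key i j ((hadj i j).mp hxy)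
  refine ⟨fun a => c (i + s * a), ⟨fun a b hab => h3 a b (hinj hab), ?_, fun a b => ?_⟩, ?_, ?_⟩
  · rw [← hrange]
    ext v
    constructor
    · rintro ⟨a, rfl⟩
      exact ⟨_, rfl⟩
    · rintro ⟨a, rfl⟩
      obtain ⟨b, rfl⟩ := h4 a
      exact ⟨b, rfl⟩
  · rw [hadj, h2]
  · simp only [h0]
  · simp only [h1]

theorem bouquet_adj_of_ne {U : Type*} {T : SimpleGraph U} {r u : U} {i : Fin 5} {z : Fin 5 × U}
    (hu : u ≠ r) (h : (bouquet T r).Adj (i, u) z) : z.1 = i ∧ T.Adj u z.2 :=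
  h.elim (fun h => ⟨h.1.symm, h.2⟩) fun h => (hu h.1).elim

theorem bouquet_adj_root {U : Type*} {T : SimpleGraph U} {r : U} {i j : Fin 5} :
    (bouquet T r).Adj (i, r) (j, r) ↔ (cycleGraph 5).Adj i j :=
  ⟨fun h => h.elim (fun h => (T.irrefl h.2).elim) fun h => h.2.2, fun h => Or.inr ⟨rfl, rfl, h⟩⟩

theorem mem_supp_connectedComponentMk {v x : V} :
    x ∈ (F.connectedComponentMk v).supp ↔ F.Reachable v x := by
  rw [ConnectedComponent.mem_supp_iff, ConnectedComponent.eq]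
  exact ⟨Reachable.symm, Reachable.symm⟩

end

section
variable {V : Type u} {C : Type*} [Finite V] {χ : V → C} {F : SimpleGraph V}

/-- The core vertices of a tree component would include a leaf. In a bouquet, a vertex other than a
root has all its neighbors in its own copy of the tree, so only roots can be core; and the two core
neighbors of a core root are its neighbors on the cycle, which makes all five roots core. -/
theorem exists_isFiveCycle_of_mem_coreColors
    (hF : ∀ c : F.ConnectedComponent, (F.induce c.supp).IsTree ∨ IsBouquet (F.induce c.supp))
    {v : V} (hv : χ v ∈ coreColors χ F) :
    IsBouquet (F.induce (F.connectedComponentMk v).supp) ∧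
      ∃ k, IsFiveCycle F {x | F.Reachable v x ∧ χ x ∈ coreColors χ F} k := by
  have hsupp : ∀ x, x ∈ (F.connectedComponentMk v).supp ↔ F.Reachable v x := fun x =>
    mem_supp_connectedComponentMk
  have hnb : ∀ x a, x ∈ (F.connectedComponentMk v).supp → F.Adj x a →
      a ∈ (F.connectedComponentMk v).supp := by
    intro x a hx hxa
    rw [hsupp] at hx ⊢
    exact hx.trans hxa.reachable
  rcases hF (F.connectedComponentMk v) with hT | hB
  · exfalso
    obtain ⟨x, hx, hleaf⟩ := exists_leaf_of_isAcyclic hT.isAcyclic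
      (Y := {x | χ x.1 ∈ coreColors χ F}) ⟨⟨v, (hsupp v).mpr (.refl _)⟩, hv⟩
    obtain ⟨a, b, hab, ha, hb, hac, hbc⟩ := exists_two_adj_of_mem_coreColors hx
    exact hab (congrArg Subtype.val (hleaf ⟨a, hnb x a x.2 ha⟩ hac ⟨b, hnb x b x.2 hb⟩ hbc ha hb))
  refine ⟨hB, ?_⟩
  obtain ⟨U, T, r, hT, ⟨g⟩⟩ := hB
  have hfin : Finite (Fin 5 × U) := Finite.of_equiv _ g.toEquiv
  have hfinU : Finite U := Finite.of_injective (fun u => ((0 : Fin 5), u)) fun a b h =>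
    congrArg Prod.snd h
  have hadj : ∀ z z', F.Adj (g.symm z).1 (g.symm z').1 ↔ (bouquet T r).Adj z z' := fun z z' =>
    g.symm.map_rel_iff (a := z) (b := z')
  have hsymm : ∀ a (ha : a ∈ (F.connectedComponentMk v).supp), (g.symm (g ⟨a, ha⟩)).1 = a := by
    intro a ha
    rw [RelIso.symm_apply_apply]
  have hroot : ∀ i, ∀ u, χ (g.symm (i, u)).1 ∈ coreColors χ F → u = r := by
    intro i
    refine subset_singleton_of_isAcyclic hT.isAcyclic
      (Y := {u | χ (g.symm (i, u)).1 ∈ coreColors χ F}) fun u hu hur => ?_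
    obtain ⟨a, b, hab, ha, hb, hac, hbc⟩ := exists_two_adj_of_mem_coreColors hu
    have key : ∀ a, F.Adj (g.symm (i, u)).1 a → ∃ y, (g.symm (i, y)).1 = a ∧ T.Adj u y := by
      intro a ha
      have has := hnb _ a (g.symm (i, u)).2 ha
      rw [← hsymm a has, hadj] at ha
      obtain ⟨h1, h2⟩ := bouquet_adj_of_ne hur ha
      refine ⟨(g ⟨a, has⟩).2, ?_, h2⟩
      rw [← h1]
      exact hsymm a has
    obtain ⟨y, rfl, hy⟩ := key a ha
    obtain ⟨y', rfl, hy'⟩ := key b hb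
    exact ⟨y, hac, y', hbc, fun h => hab (by rw [h]), hy, hy'⟩
  have hmem : ∀ x, F.Reachable v x → χ x ∈ coreColors χ F → ∃ i, (g.symm (i, r)).1 = x := by
    intro x hx hxc
    have hxs := (hsupp x).mpr hx
    refine ⟨(g ⟨x, hxs⟩).1, ?_⟩
    have h1 := hroot (g ⟨x, hxs⟩).1 (g ⟨x, hxs⟩).2 (by rw [Prod.mk.eta, hsymm]; exact hxc)
    rw [show ((g ⟨x, hxs⟩).1, r) = g ⟨x, hxs⟩ from Prod.ext rfl h1.symm, hsymm]
  have hreach : ∀ z, F.Reachable v (g.symm z).1 := fun z => (hsupp _).mp (g.symm z).2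
  obtain ⟨i₀, hi₀⟩ := hmem v (.refl _) hv
  have hstep : ∀ i, χ (g.symm (i, r)).1 ∈ coreColors χ F →
      χ (g.symm (i + 1, r)).1 ∈ coreColors χ F := by
    intro i hi
    obtain ⟨a, b, hab, ha, hb, hac, hbc⟩ := exists_two_adj_of_mem_coreColors hi
    obtain ⟨j, rfl⟩ := hmem a ((hreach _).trans ha.reachable) hac
    obtain ⟨j', rfl⟩ := hmem b ((hreach _).trans hb.reachable) hbc
    rw [hadj, bouquet_adj_root, cycleGraph_five_adj] at ha hb
    rcases ha with rfl | rfl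
    · exact hac
    rcases hb with rfl | rfl
    · exact hbc
    · exact (hab rfl).elim
  have hall : ∀ i, χ (g.symm (i, r)).1 ∈ coreColors χ F := by
    have h0 : χ (g.symm (i₀, r)).1 ∈ coreColors χ F := by rwa [hi₀]
    have h1 := hstep _ h0
    have h2 := hstep _ h1
    have h3 := hstep _ h2
    have h4 := hstep _ h3
    intro i
    have : ∀ i₀ i : Fin 5, i = i₀ ∨ i = i₀ + 1 ∨ i = i₀ + 1 + 1 ∨ i = i₀ + 1 + 1 + 1 ∨
      i = i₀ + 1 + 1 + 1 + 1 := by decide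
    rcases this i₀ i with rfl | rfl | rfl | rfl | rfl <;> assumption
  refine ⟨fun i => (g.symm (i, r)).1, ?_, ?_, fun i j => by rw [hadj, bouquet_adj_root]⟩
  · intro i j hij
    have := g.symm.injective (Subtype.ext hij)
    exact congrArg Prod.fst this
  · ext x
    constructor
    · rintro ⟨i, rfl⟩
      exact ⟨hreach _, hall i⟩
    · rintro ⟨hx, hxc⟩
      exact hmem x hx hxc

end

section
variable {V C : Type*} {χ : V → C} {F : SimpleGraph V}

theorem IsFiveCycle.adj_core {v : V} {k : Fin 5 → V}
    (hk : IsFiveCycle F {x | F.Reachable v x ∧ χ x ∈ coreColors χ F} k) {i : Fin 5} {u : V}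
    (hu : F.Adj (k i) u) (huc : χ u ∈ coreColors χ F) : u = k (i + 1) ∨ u = k (i + 4) := by
  obtain ⟨hinj, hrange, hadj⟩ := hk
  have hi : F.Reachable v (k i) := ((Set.ext_iff.mp hrange _).mp ⟨i, rfl⟩).1
  obtain ⟨j, rfl⟩ := (Set.ext_iff.mp hrange u).mpr ⟨hi.trans hu.reachable, huc⟩
  rwa [hadj, cycleGraph_five_adj, ← hinj.eq_iff, ← hinj.eq_iff (b := i + 4)] at hu

theorem IsFiveCycle.colorDegree_eq_two {k : Fin 5 → V} {v : V}
    (hk : IsFiveCycle F {x | χ x = χ v} k) {x : V} (hx : χ x = χ v) :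
    colorDegree χ F x (χ v) = 2 := by
  obtain ⟨i, rfl⟩ := (Set.ext_iff.mp hk.2.1 x).mpr hx
  refine Set.ncard_eq_two.mpr ⟨k (i + 1), k (i + 4), fun h => ?_, ?_⟩
  · exact (by decide : ∀ i : Fin 5, i + 1 ≠ i + 4) i (hk.1 h)
  · ext w
    simp only [Set.mem_ofPred_eq, Set.mem_insert_iff, Set.mem_singleton_iff]
    constructor
    · rintro ⟨h1, h2⟩
      obtain ⟨j, rfl⟩ := (Set.ext_iff.mp hk.2.1 w).mpr h2
      rwa [hk.2.2, cycleGraph_five_adj, ← hk.1.eq_iff, ← hk.1.eq_iff (b := i + 4)] at h1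
    · intro h1
      obtain ⟨j, rfl, hj⟩ : ∃ j, w = k j ∧ (j = i + 1 ∨ j = i + 4) :=
        h1.elim (fun h => ⟨_, h, Or.inl rfl⟩) fun h => ⟨_, h, Or.inr rfl⟩
      exact ⟨(hk.2.2 _ _).mpr ((cycleGraph_five_adj _ _).mpr hj),
        (Set.ext_iff.mp hk.2.1 _).mp ⟨j, rfl⟩⟩

theorem exists_swap_of_disjoint {k l : Fin 5 → V} (hk : Function.Injective k)
    (hl : Function.Injective l) (hkl : ∀ i j, k i ≠ l j) :
    ∃ f : V → V, (∀ i, f (k i) = l i) ∧ (∀ i, f (l i) = k i) ∧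
      (∀ x, (∀ i, x ≠ k i) → (∀ i, x ≠ l i) → f x = x) ∧ ∀ x, f (f x) = x := by
  have hex : ∀ x, ∃ y, (∀ i, x = k i → y = l i) ∧ (∀ i, x = l i → y = k i) ∧
      ((∀ i, x ≠ k i) → (∀ i, x ≠ l i) → y = x) := by
    intro x
    by_cases h1 : ∃ i, x = k i
    · obtain ⟨i, rfl⟩ := h1
      exact ⟨l i, fun j hj => by rw [hk hj], fun j hj => (hkl _ _ hj).elim,
        fun h => (h i rfl).elim⟩
    by_cases h2 : ∃ i, x = l i
    · obtain ⟨i, rfl⟩ := h2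
      exact ⟨k i, fun j hj => (hkl _ _ hj.symm).elim, fun j hj => by rw [hl hj],
        fun _ h => (h i rfl).elim⟩
    · push Not at h1 h2
      exact ⟨x, fun i hi => (h1 i hi).elim, fun i hi => (h2 i hi).elim, fun _ _ => rfl⟩
  choose f h1 h2 h3 using hex
  refine ⟨f, fun i => h1 _ i rfl, fun i => h2 _ i rfl, h3, fun x => ?_⟩
  by_cases e1 : ∃ i, x = k i
  · obtain ⟨i, rfl⟩ := e1
    rw [h1 _ i rfl, h2 _ i rfl]
  by_cases e2 : ∃ i, x = l i
  · obtain ⟨i, rfl⟩ := e2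
    rw [h2 _ i rfl, h1 _ i rfl]
  · push Not at e1 e2
    rw [h3 x e1 e2, h3 x e1 e2]

end

/-! ### Core classes of sparse bouquet forests -/

section
variable {V : Type u} {C : Type*} [Finite V] {χ : V → C} {F F' : SimpleGraph V}

theorem Similar.color_eq_of_two_adj (h : Similar χ F F) {A : Set C} {x y a b a' b' : V}
    (hxy : χ x = χ y) (ha : F.Adj x a) (hb : F.Adj x b) (hab : a ≠ b) (haA : χ a ∈ A)
    (hbA : χ b ∈ A) (hy : ∀ u, F.Adj y u → χ u ∈ A → u = a' ∨ u = b') (haa : χ a = χ a') :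
    χ b = χ b' := by
  obtain ⟨u, w, hu, hw, huw, hua, hwb⟩ := h.exists_two_adj hxy ha hb hab
  have h1 := hy u hu (hua ▸ haA)
  have h2 := hy w hw (hwb ▸ hbA)
  grind

theorem exists_isAut_of_core (h : Similar χ F F) {f₀ : Equiv.Perm V}
    (hf₀ : IsoOn χ (coreColors χ F) F F f₀) :
    ∃ f, IsAut χ F f ∧ ∀ v, χ v ∈ coreColors χ F → f v = f₀ v := by
  obtain ⟨f, hf, hf'⟩ := exists_isoOn_extending h
    (fun A hA hex => exists_leaf_of_coreColors_subset hA hex) hf₀ Set.univ (Set.subset_univ _)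
  exact ⟨f, ⟨hf.1, fun u v => hf.2 u v trivial trivial⟩, hf'⟩

/-- Otherwise `v` and `w` lie on the cycles of two bouquets. By equitability, the colors of two
consecutive vertices determine the next one, so the cycles can be aligned with equal colors.
Exchanging them is an isomorphism on the core and extends to an automorphism, which makes the two
bouquets isomorphic. -/
theorem IsBouquetForest.reachable_of_color_eq (hF : IsBouquetForest F χ) (h : Similar χ F F)
    {v w : V} (hv : χ v ∈ coreColors χ F) (hvw : χ v = χ w) : F.Reachable v w := by
  by_contra hnr
  have hw : χ w ∈ coreColors χ F := hvw ▸ hv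
  obtain ⟨hBv, k, hk⟩ := exists_isFiveCycle_of_mem_coreColors hF.1 hv
  obtain ⟨hBw, l, hl⟩ := exists_isFiveCycle_of_mem_coreColors hF.1 hw
  obtain ⟨a, -, -, hva, -, hac, -⟩ := exists_two_adj_of_mem_coreColors hv
  obtain ⟨b, hwb, hba⟩ := h.exists_adj hvw hva
  obtain ⟨k, hk, hk0, hk1⟩ := hk.exists_apply_eq (x := v) (y := a) ⟨.refl _, hv⟩
    ⟨hva.reachable, hac⟩ hva
  obtain ⟨l, hl, hl0, hl1⟩ := hl.exists_apply_eq (x := w) (y := b) ⟨.refl _, hw⟩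
    ⟨hwb.reachable, hba ▸ hac⟩ hwb
  have hkr : ∀ i, F.Reachable v (k i) ∧ χ (k i) ∈ coreColors χ F := fun i =>
    (Set.ext_iff.mp hk.2.1 _).mp ⟨i, rfl⟩
  have hlr : ∀ i, F.Reachable w (l i) ∧ χ (l i) ∈ coreColors χ F := fun i =>
    (Set.ext_iff.mp hl.2.1 _).mp ⟨i, rfl⟩
  have hkadj : ∀ i, F.Adj (k i) (k (i + 1)) ∧ F.Adj (k i) (k (i + 4)) := fun i =>
    ⟨(hk.2.2 _ _).mpr ((cycleGraph_five_adj _ _).mpr (Or.inl rfl)),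
      (hk.2.2 _ _).mpr ((cycleGraph_five_adj _ _).mpr (Or.inr rfl))⟩
  have hstep : ∀ i, χ (k i) = χ (l i) → χ (k (i + 1)) = χ (l (i + 1)) →
      χ (k (i + 1 + 1)) = χ (l (i + 1 + 1)) := by
    intro i h0 h1
    have e : i + 1 + 4 = i := (by decide : ∀ i : Fin 5, i + 1 + 4 = i) i
    refine h.color_eq_of_two_adj (A := coreColors χ F) (x := k (i + 1)) (y := l (i + 1))
      (a := k (i + 1 + 4)) (a' := l (i + 1 + 4)) h1 (hkadj (i + 1)).2 (hkadj (i + 1)).1 ?_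
      (hkr _).2 (hkr _).2 (fun u hu huc => (hl.adj_core hu huc).symm) (by rw [e, h0])
    exact fun h => (by decide : ∀ i : Fin 5, i + 1 + 4 ≠ i + 1 + 1) i (hk.1 h)
  have c0 : χ (k 0) = χ (l 0) := by rw [hk0, hl0, hvw]
  have c1 : χ (k 1) = χ (l 1) := by rw [hk1, hl1, hba]
  have c2 := hstep 0 c0 c1
  have c3 := hstep 1 c1 c2
  have c4 := hstep 2 c2 c3
  have hcol : ∀ i, χ (k i) = χ (l i) := by
    intro i
    fin_cases i
    · exact c0
    · exact c1
    · exact c2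
    · exact c3
    · exact c4
  have hkl : ∀ i j, k i ≠ l j := fun i j hij => hnr ((hkr i).1.trans (hij ▸ (hlr j).1.symm))
  obtain ⟨f, f1, f2, f3, f4⟩ := exists_swap_of_disjoint hk.1 hl.1 hkl
  let f₀ : Equiv.Perm V := Function.Involutive.toPerm f f4
  have hf₀ : IsoOn χ (coreColors χ F) F F f₀ := by
    refine isoOn_of_involutive (fun x => ?_) f4 fun x y hx hy hxy => ?_
    · change χ (f x) = χ x
      by_cases e1 : ∃ i, x = k i
      · obtain ⟨i, rfl⟩ := e1
        rw [f1, hcol]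
      by_cases e2 : ∃ i, x = l i
      · obtain ⟨i, rfl⟩ := e2
        rw [f2, hcol]
      · push Not at e1 e2
        rw [f3 x e1 e2]
    · change F.Adj (f x) (f y)
      by_cases e1 : ∃ i, x = k i
      · obtain ⟨i, rfl⟩ := e1
        obtain ⟨j, rfl⟩ : ∃ j, y = k j := (hk.adj_core hxy hy).elim (fun h => ⟨_, h⟩)
          fun h => ⟨_, h⟩
        rwa [f1, f1, hl.2.2, ← hk.2.2]
      by_cases e2 : ∃ i, x = l i
      · obtain ⟨i, rfl⟩ := e2
        obtain ⟨j, rfl⟩ : ∃ j, y = l j := (hl.adj_core hxy hy).elim (fun h => ⟨_, h⟩)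
          fun h => ⟨_, h⟩
        rwa [f2, f2, hk.2.2, ← hl.2.2]
      push Not at e1 e2
      have e3 : ∀ i, y ≠ k i := by
        rintro i rfl
        exact (hk.adj_core hxy.symm hx).elim (e1 _) (e1 _)
      have e4 : ∀ i, y ≠ l i := by
        rintro i rfl
        exact (hl.adj_core hxy.symm hx).elim (e2 _) (e2 _)
      rwa [f3 x e1 e2, f3 y e3 e4]
  obtain ⟨g, hg, hg'⟩ := exists_isAut_of_core h hf₀
  have hgv : g v = w := by
    rw [hg' v hv]
    change f v = w
    rw [← hk0, f1, hl0]
  have hsupp : ∀ x, x ∈ (F.connectedComponentMk v).supp ↔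
      g x ∈ (F.connectedComponentMk w).supp := by
    intro x
    rw [mem_supp_connectedComponentMk, mem_supp_connectedComponentMk, ← hgv, hg.reachable_iff]
  refine hF.2 (F.connectedComponentMk v) (F.connectedComponentMk w)
    (fun h => hnr (ConnectedComponent.eq.mp h)) hBv hBw
    ⟨⟨g.subtypeEquiv hsupp, fun {a b} => (hg.2 a b).symm⟩, fun x => hg.1 x⟩

/-- All vertices with a color from the cycle lie on the cycle. Sparseness then compares, at each of
its vertices, the two neighbors with the two non-neighbors, and this leaves room for one color only.
-/
theorem IsBouquetForest.isFiveCycle_color (hF : IsBouquetForest F χ) (h : Similar χ F F)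
    (hs : Sparse χ F) {v : V} (hv : χ v ∈ coreColors χ F) :
    ∃ k, IsFiveCycle F {x | χ x = χ v} k ∧ ∀ u, F.Adj v u → χ u ∈ coreColors χ F → χ u = χ v := by
  obtain ⟨-, k, hk⟩ := exists_isFiveCycle_of_mem_coreColors hF.1 hv
  have hkr : ∀ i, F.Reachable v (k i) ∧ χ (k i) ∈ coreColors χ F := fun i =>
    (Set.ext_iff.mp hk.2.1 _).mp ⟨i, rfl⟩
  have hclass : ∀ i x, χ x = χ (k i) → ∃ j, k j = x := fun i x hx =>
    (Set.ext_iff.mp hk.2.1 x).mpr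
      ⟨(hkr i).1.trans (hF.reachable_of_color_eq h (hkr i).2 hx.symm), hx ▸ (hkr i).2⟩
  have hnon : ∀ i, ∀ q, ∀ w ∈ {w | w ≠ k i ∧ ¬ F.Adj (k i) w ∧ χ w = q},
      (∃ j, χ (k j) = q) → w = k (i + 2) ∨ w = k (i + 3) := by
    rintro i q w ⟨h1, h2, h3⟩ ⟨j, hj⟩
    obtain ⟨m, rfl⟩ := hclass j w (h3.trans hj.symm)
    rw [hk.2.2] at h2
    rw [ne_eq, hk.1.eq_iff] at h1
    rw [hk.1.eq_iff, hk.1.eq_iff]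
    revert h1 h2
    clear h3
    revert i m
    decide
  have hbal : ∀ i, (χ (k (i + 1)) = χ (k (i + 2)) ∧ χ (k (i + 4)) = χ (k (i + 3))) ∨
      (χ (k (i + 1)) = χ (k (i + 3)) ∧ χ (k (i + 4)) = χ (k (i + 2))) := by
    intro i
    have a1 : F.Adj (k i) (k (i + 1)) :=
      (hk.2.2 _ _).mpr ((cycleGraph_five_adj _ _).mpr (Or.inl rfl))
    have a4 : F.Adj (k i) (k (i + 4)) :=
      (hk.2.2 _ _).mpr ((cycleGraph_five_adj _ _).mpr (Or.inr rfl))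
    have hne : k (i + 1) ≠ k (i + 4) := by
      exact fun h => (by decide : ∀ i : Fin 5, i + 1 ≠ i + 4) i (hk.1 h)
    have hone : ∀ j, F.Adj (k i) (k j) → χ (k (i + 2)) = χ (k j) ∨ χ (k (i + 3)) = χ (k j) := by
      intro j hj
      obtain ⟨w, h1, h2, h3⟩ := hs.exists_ne hj
      rcases hnon i _ w ⟨h1, h2, h3⟩ ⟨j, rfl⟩ with rfl | rfl
      · exact Or.inl h3
      · exact Or.inr h3
    have h1 := hone _ a1
    have h4 := hone _ a4
    by_cases h14 : χ (k (i + 1)) = χ (k (i + 4))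
    · have h5 := hs (k i) (χ (k (i + 1)))
      have h6 : 1 < {w | F.Adj (k i) w ∧ χ w = χ (k (i + 1))}.ncard :=
        (Set.one_lt_ncard_iff (Set.toFinite _)).mpr ⟨_, _, ⟨a1, rfl⟩, ⟨a4, h14.symm⟩, hne⟩
      obtain ⟨x, y, hx, hy, hxy⟩ :=
        (Set.one_lt_ncard_iff (Set.toFinite _)).mp (h6.trans_le h5)
      have hx' := hnon i _ x hx ⟨_, rfl⟩
      have hy' := hnon i _ y hy ⟨_, rfl⟩
      have hx2 := hx.2.2
      have hy2 := hy.2.2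
      clear hnon hone hclass hkr
      grind
    · clear hnon hone hclass hkr
      grind
  have b0 := hbal 0
  have b1 := hbal 1
  have b2 := hbal 2
  have b3 := hbal 3
  have b4 := hbal 4
  -- The indicator `f` of any color satisfies `f (i + 1) + f (i + 4) = f (i + 2) + f (i + 3)` around
  -- the cycle, and only constant functions do.
  have hconst : ∀ i, χ (k i) = χ (k 0) := by
    have e : χ (k 1) = χ (k 0) ∧ χ (k 2) = χ (k 0) ∧ χ (k 3) = χ (k 0) ∧ χ (k 4) = χ (k 0) := by
      simp only [show (0 : Fin 5) + 1 = 1 from rfl, show (0 : Fin 5) + 2 = 2 from rfl,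
        show (0 : Fin 5) + 3 = 3 from rfl, show (0 : Fin 5) + 4 = 4 from rfl,
        show (1 : Fin 5) + 1 = 2 from rfl, show (1 : Fin 5) + 2 = 3 from rfl,
        show (1 : Fin 5) + 3 = 4 from rfl, show (1 : Fin 5) + 4 = 0 from rfl,
        show (2 : Fin 5) + 1 = 3 from rfl, show (2 : Fin 5) + 2 = 4 from rfl,
        show (2 : Fin 5) + 3 = 0 from rfl, show (2 : Fin 5) + 4 = 1 from rfl,
        show (3 : Fin 5) + 1 = 4 from rfl, show (3 : Fin 5) + 2 = 0 from rfl,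
        show (3 : Fin 5) + 3 = 1 from rfl, show (3 : Fin 5) + 4 = 2 from rfl,
        show (4 : Fin 5) + 1 = 0 from rfl, show (4 : Fin 5) + 2 = 1 from rfl,
        show (4 : Fin 5) + 3 = 2 from rfl, show (4 : Fin 5) + 4 = 3 from rfl] at b0 b1 b2 b3 b4
      generalize χ (k 0) = x0 at *
      generalize χ (k 1) = x1 at *
      generalize χ (k 2) = x2 at *
      generalize χ (k 3) = x3 at *
      generalize χ (k 4) = x4 at *
      clear hbal hnon hclass hkr hk hF h hs hv
      grind
    intro i
    fin_cases i
    · rfl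
    · exact e.1
    · exact e.2.1
    · exact e.2.2.1
    · exact e.2.2.2
  obtain ⟨i₀, hi₀⟩ := (Set.ext_iff.mp hk.2.1 v).mpr ⟨.refl _, hv⟩
  have hkv : ∀ i, χ (k i) = χ v := fun i => by rw [hconst i, ← hi₀, hconst i₀]
  refine ⟨k, ⟨hk.1, ?_, hk.2.2⟩, fun u hu huc => ?_⟩
  · ext x
    constructor
    · rintro ⟨i, rfl⟩
      exact hkv i
    · intro hx
      exact hclass i₀ x (by rw [hi₀]; exact hx)
  · rw [← hi₀] at hu
    rcases hk.adj_core hu huc with rfl | rfl <;> exact hkv _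

/-- A core class has five vertices of inner degree two, so it is a 5-cycle in `F'` as well. Core
vertices of different colors are adjacent in neither graph. Hence isomorphisms chosen for each core
class combine and extend over the leaf classes. -/
theorem IsBouquetForest.rigid (hF : IsBouquetForest F χ) (h : Similar χ F F) (hs : Sparse χ F) :
    Rigid χ F := by
  intro F' hF'
  have hex : ∀ p, ∃ g : V → V, p ∈ coreColors χ F → ∀ x y, χ x = p → χ y = p →
      χ (g x) = p ∧ (g x = g y → x = y) ∧ (F.Adj x y ↔ F'.Adj (g x) (g y)) := by
    intro p
    by_cases hp : p ∈ coreColors χ F ∧ ∃ v, χ v = p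
    · obtain ⟨hp, v, rfl⟩ := hp
      obtain ⟨k, hk, -⟩ := hF.isFiveCycle_color h hs hp
      have hcard : {x | χ x = χ v}.ncard = 5 := by
        rw [← hk.2.1, Set.ncard_range_of_injective hk.1, Nat.card_fin]
      obtain ⟨l, hl⟩ := exists_isFiveCycle_color (F := F') hcard fun x hx => by
        rw [← hF' x x rfl, hk.colorDegree_eq_two hx]
      have hinv : ∀ x, ∃ y, ∀ i, k i = x → y = l i := by
        intro x
        by_cases hx : ∃ i, k i = x
        · obtain ⟨i, rfl⟩ := hx
          exact ⟨l i, fun j hj => by rw [hk.1 hj]⟩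
        · push Not at hx
          exact ⟨x, fun i hi => (hx i hi).elim⟩
      choose g hg using hinv
      have hg' : ∀ i, g (k i) = l i := fun i => hg _ i rfl
      refine ⟨g, fun _ x y hx hy => ?_⟩
      obtain ⟨i, rfl⟩ := (Set.ext_iff.mp hk.2.1 x).mpr hx
      obtain ⟨j, rfl⟩ := (Set.ext_iff.mp hk.2.1 y).mpr hy
      rw [hg', hg']
      exact ⟨(Set.ext_iff.mp hl.2.1 _).mp ⟨i, rfl⟩, fun h => by rw [hl.1 h],
        by rw [hk.2.2, hl.2.2]⟩
    · refine ⟨id, fun h1 x y hx => (hp ⟨h1, x, hx⟩).elim⟩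
  choose g hg using hex
  obtain ⟨f₀, hf₀, hfg⟩ := exists_colorPreserving_extending (χ := χ)
    {x | χ x ∈ coreColors χ F} (fun x => g (χ x) x)
    (by
      intro x hx y hy hxy
      simp only at hxy
      have e1 := (hg _ hx x x rfl rfl).1
      have e2 := (hg _ hy y y rfl rfl).1
      have e3 : χ x = χ y := by rw [← e1, ← e2, hxy]
      rw [e3] at hxy
      exact (hg _ hy x y e3 rfl).2.1 hxy)
    (fun x hx => (hg _ hx x x rfl rfl).1)
  have hF₁ : ∀ u v, χ u ∈ coreColors χ F → χ v ∈ coreColors χ F → F.Adj u v → χ v = χ u := by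
    intro u v hu hv huv
    obtain ⟨-, -, hk⟩ := hF.isFiveCycle_color h hs hu
    exact hk v huv hv
  have hiso : IsoOn χ (coreColors χ F) F F' f₀ := by
    refine ⟨hf₀, fun u v hu hv => ?_⟩
    by_cases huv : χ v = χ u
    · rw [hfg u hu, hfg v hv]
      simp only [huv]
      exact (hg _ hu u v rfl huv).2.2
    · refine iff_of_false (fun h' => huv (hF₁ u v hu hv h')) fun h' => ?_
      obtain ⟨w, hw, hwv⟩ := hF'.symm.exists_adj (hf₀ u) h'
      rw [hf₀] at hwv
      exact huv (hwv.symm.trans (hF₁ u w hu (hwv ▸ hv) hw))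
  obtain ⟨f, hf, -⟩ := exists_isoOn_extending hF'
    (fun A hA hex => exists_leaf_of_coreColors_subset hA hex) hiso Set.univ (Set.subset_univ _)
  exact ⟨f, hf.1, fun u v => hf.2 u v trivial trivial⟩

end

end CountingLogic

/-! ### The theorem: rigidity transferred to the flip -/

open CountingLogic in
theorem mainTheorem1 {V : Type u} [Finite V] (G : SimpleGraph V) :
    CountingLogic.IsIdentified 2 G ↔
      CountingLogic.IsBouquetForest (CountingLogic.flipGraph G) (CountingLogic.c2Coloring G) := by
  have h := (similar_c2Coloring G).flipBy (majorityPairs (c2Coloring G) G)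
  have hs := sparse_flipBy_majorityPairs (similar_c2Coloring G)
  rw [isIdentified_iff_rigid, flipGraph_eq_flipBy,
    ← rigid_flipBy_iff (M := majorityPairs (c2Coloring G) G)]
  exact ⟨fun hr => hr.isBouquetForest h hs, fun hF => hF.rigid h hs⟩
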